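/- Let $\Lambda\mathrm{SL}(2,\mathbb{C})$ be the group of analytic maps $\Phi:S^1\to\mathrm{SL}(2,\mathbb{C})$ on the unit circle $S^1\subset\mathbb{C}$, i.e. of those maps that extend holomorphically to a neighbourhood of $S^1$. It is regarded as a subset of the space $E$ of all analytic maps $S^1\to\mathbb{C}^{2\times 2}$, which carries its usual topology: the locally convex inductive limit, as $r\downarrow 1$, of the Banach spaces of bounded holomorphic functions on the annuli $r^{-1}<|\lambda|<r$. Subsets of $E$ and $E\times E$ carry the induced topology. For a set $K$ with $\{|\lambda|\le 1\}\subseteq K\subseteq\mathbb{C}$, let $\Lambda_K^{+,\mathrm{SU}(2)}$ be the set of all $\Phi\in\Lambda\mathrm{SL}(2,\mathbb{C})$ that extend analytically to $K$ with $\Phi(0)\in\mathrm{SU}(2)$, and let $\Lambda_K^{-,\mathbb{R}}$ be the set of all $\Phi\in\Lambda\mathrm{SL}(2,\mathbb{C})$ that extend analytically to $\{\lambda\in\mathbb{P}^1 : \lambda^{-1}\in K\}$ with $\Phi(\infty)=\begin{pmatrix}\rho & c\\ 0&\rho^{-1}\end{pmatrix}$ for some $\rho>0$ and $c\in\mathbb{C}$.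 Here "extends analytically to a set" means: extends holomorphically to an open neighbourhood of this set. Let $\Lambda^*\mathrm{SL}(2,\mathbb{C})$ be the set of all $\Phi\in\Lambda\mathrm{SL}(2,\mathbb{C})$ that extend holomorphically to $\mathbb{C}^*=\mathbb{C}\setminus\{0\}$. A map on a subset $X$ of a locally convex space is called real analytic if near each point of $X$ it is the restriction to $X$ of a map on an open subset of the surrounding space that is continuous and, near each point, the sum of a series of continuous homogeneous real polynomials. A real analytic diffeomorphism is a bijection that is real analytic together with its inverse. **Proposition (modified Birkhoff decomposition).** There is a subset $\mathcal{U}$ of $\Lambda\mathrm{SL}(2,\mathbb{C})$ (the big cell) with the following properties. 1. $\mathcal{U}$ is open and dense in $\Lambda\mathrm{SL}(2,\mathbb{C})$, and for $K=\{|\lambda|\le1\}$ the map $(F,B)\mapsto F\cdot B$ is a real analytic diffeomorphism of $\Lambda_K^{+,\mathrm{SU}(2)}\times\Lambda_K^{-,\mathbb{R}}$ onto $\mathcal{U}$. 2. $\mathcal{U}\cap\Lambda^*\mathrm{SL}(2,\mathbb{C})$ is open and dense in $\Lambda^*\mathrm{SL}(2,\mathbb{C})$, and for $K=\mathbb{C}$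 (so that the first factor consists of loops holomorphic on $\mathbb{C}$ and the second of loops holomorphic on $\mathbb{P}^1\setminus\{0\}$) the map $(F,B)\mapsto F\cdot B$ is a real analytic diffeomorphism of $\Lambda_K^{+,\mathrm{SU}(2)}\times\Lambda_K^{-,\mathbb{R}}$ onto $\mathcal{U}\cap\Lambda^*\mathrm{SL}(2,\mathbb{C})$. -/

import Mathlib

open scoped Topology

/-- Complex `2 × 2` matrices. -/
abbrev M2 : Type := Matrix (Fin 2) (Fin 2) ℂ

/-- `g` is an analytic extension of the loop `Φ` (a function on the unit circle) to the set `K`: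
`g` agrees with `Φ` on the circle, and each of its entries is complex analytic at every point
of `K` (hence holomorphic on an open neighbourhood of `K`). -/
def IsHolExt (K : Set ℂ) (Φ : Circle → M2) (g : ℂ → M2) : Prop :=
  (∀ i j, AnalyticOnNhd ℂ (fun z => g z i j) K) ∧ ∀ z : Circle, g (z : ℂ) = Φ z

/-- The algebra of analytic maps from the unit circle to the `2 × 2` matrices, that is of those
maps which extend holomorphically to a neighbourhood of the circle. -/
def analyticLoops : Subalgebra ℝ (Circle → M2) where
  carrier := {Φ | ∃ g, IsHolExt (Metric.sphere 0 1) Φ g}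
  mul_mem' := by
    rintro a b ⟨f, hf, hfa⟩ ⟨g, hg, hgb⟩
    refine ⟨fun z => f z * g z, fun i j => ?_, fun z => by simp [hfa, hgb]⟩
    simp only [Matrix.mul_apply]
    exact Finset.analyticOnNhd_fun_sum _ fun k _ => (hf i k).mul (hg k j)
  add_mem' := by
    rintro a b ⟨f, hf, hfa⟩ ⟨g, hg, hgb⟩
    exact ⟨fun z => f z + g z, fun i j => (hf i j).add (hg i j), fun z => by simp [hfa, hgb]⟩
  algebraMap_mem' := fun c =>
    ⟨fun _ => algebraMap ℝ M2 c, fun _ _ => analyticOnNhd_const, fun _ => rfl⟩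

/-- The space of analytic loops of `2 × 2` matrices, without the topology of pointwise
convergence that the subtype would inherit. -/
def Loop : Type := analyticLoops

noncomputable instance : Ring Loop := inferInstanceAs (Ring analyticLoops)
noncomputable instance : Algebra ℝ Loop := inferInstanceAs (Algebra ℝ analyticLoops)
instance : CoeFun Loop (fun _ => Circle → M2) := ⟨fun Φ => Φ.1⟩

/-- The open annulus `1/r < |z| < r`. -/
def annulus (r : ℝ) : Set ℂ := {z | r⁻¹ < ‖z‖ ∧ ‖z‖ < r}

/-- A seminorm on the space of analytic loops is admissible if, for each `r > 1`, its restriction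
to the loops that extend to bounded holomorphic functions on the annulus `1/r < |z| < r` is
continuous for the supremum norm over this annulus. -/
def Admissible (p : Seminorm ℝ Loop) : Prop :=
  ∀ r : ℝ, 1 < r → ∃ C : ℝ, ∀ (Φ : Loop) (g : ℂ → M2) (M : ℝ),
    IsHolExt (annulus r) Φ g → (∀ z ∈ annulus r, ∀ i j, ‖g z i j‖ ≤ M) → p Φ ≤ C * M

instance : Nonempty {p : Seminorm ℝ Loop // Admissible p} :=
  ⟨⟨0, fun _ _ => ⟨0, fun _ _ _ _ _ => by simp⟩⟩⟩

/-- The family of all admissible seminorms. -/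
def loopSeminorms : SeminormFamily ℝ Loop {p : Seminorm ℝ Loop // Admissible p} :=
  fun p => p.1

/-- The usual topology of the space of analytic loops: the locally convex inductive limit,
as `r` decreases to `1`, of the Banach spaces of bounded holomorphic functions on the annuli
`1/r < |z| < r`. It is generated by all seminorms that are continuous on each of these spaces. -/
noncomputable instance : TopologicalSpace Loop := loopSeminorms.moduleFilterBasis.topology

theorem loop_withSeminorms : WithSeminorms loopSeminorms := ⟨rfl⟩

instance : IsTopologicalAddGroup Loop := loop_withSeminorms.topologicalAddGroup
instance : ContinuousSMul ℝ Loop := loop_withSeminorms.continuousSMul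

section RealAnalytic

variable {E F : Type*}
  [AddCommGroup E] [Module ℝ E] [TopologicalSpace E] [IsTopologicalAddGroup E]
  [ContinuousConstSMul ℝ E]
  [AddCommGroup F] [Module ℝ F] [TopologicalSpace F] [IsTopologicalAddGroup F]
  [ContinuousConstSMul ℝ F]

/-- Real analytic maps between locally convex spaces, on an open set `W`: `f` is continuous on `W`
and near each point of `W` it is the sum of a series of continuous homogeneous polynomials. -/
def RealAnalyticOnOpen (f : E → F) (W : Set E) : Prop :=
  ContinuousOn f W ∧ ∀ a ∈ W, ∃ p : FormalMultilinearSeries ℝ E F,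
    ∀ᶠ h in 𝓝 (0 : E), HasSum (fun n => p n fun _ => h) (f (a + h))

/-- Real analytic maps on an embedded subset `X`: near each point of `X`, the map is the
restriction to `X` of a real analytic map on an open subset of the surrounding space. -/
def RealAnalyticOnSubset (f : E → F) (X : Set E) : Prop :=
  ∀ x ∈ X, ∃ W : Set E, IsOpen W ∧ x ∈ W ∧
    ∃ f' : E → F, RealAnalyticOnOpen f' W ∧ ∀ y ∈ X ∩ W, f' y = f y

/-- `f` restricts to a real analytic diffeomorphism of `X` onto `Y`: it is a bijection of `X`
onto `Y`, and both it and its inverse are real analytic. -/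
def IsRealAnalyticDiffeo (f : E → F) (X : Set E) (Y : Set F) : Prop :=
  Set.MapsTo f X Y ∧ RealAnalyticOnSubset f X ∧
    ∃ k : F → E, Set.MapsTo k Y X ∧ Set.InvOn k f X Y ∧ RealAnalyticOnSubset k Y

end RealAnalytic

/-- The loop group `ΛSL(2,ℂ)` of analytic maps from the unit circle to `SL(2,ℂ)`. -/
def LambdaSL : Set Loop := {Φ | ∀ z, (Φ z).det = 1}

/-- The loops in `ΛSL(2,ℂ)` that extend holomorphically to the punctured plane. -/
def LambdaStarSL : Set Loop := {Φ | Φ ∈ LambdaSL ∧ ∃ g, IsHolExt {0}ᶜ Φ g}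

/-- The loops in `ΛSL(2,ℂ)` that extend analytically to `K` (a set that contains the closed unit
disc), with value in `SU(2)` at `0`. -/
def LambdaPlusSU (K : Set ℂ) : Set Loop :=
  {Φ | Φ ∈ LambdaSL ∧ ∃ g, IsHolExt K Φ g ∧ g 0 ∈ Matrix.specialUnitaryGroup (Fin 2) ℂ}

/-- The loops in `ΛSL(2,ℂ)` that extend analytically to the subset of the Riemann sphere which is
`K` in the coordinate `1/z` around `∞` (`K` contains the closed unit disc), with upper triangular
value at `∞` that has positive real diagonal entries `ρ`, `1/ρ`. -/
def LambdaMinusR (K : Set ℂ) : Set Loop :=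
  {Φ | Φ ∈ LambdaSL ∧ ∃ g, IsHolExt K (fun z => Φ z⁻¹) g ∧
    ∃ (ρ : ℝ) (c : ℂ), 0 < ρ ∧ g 0 = !![(ρ : ℂ), c; 0, (ρ : ℂ)⁻¹]}

/-! Everything is expressed through the matrix Laurent coefficients of a loop. Analyticity on the
circle is exponential decay of the coefficients, extension to the disc or to its exterior is
one-sided support, and extension to ℂ* is decay faster than every exponential (`Loop.Rapid`). The
inductive limit topology is generated by weighted ℓ¹ norms of the coefficients, with
submultiplicative weights of subexponential growth (`Admissible.exists_weight`,
`Loop.mem_nhds_iff`). Hence multiplication is jointly continuous, and the space can be treated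
almost like a Banach algebra.

The big cell consists of the products of a plus loop and a minus loop in ΛSL. Near the identity, 1 +
h = G X⁻¹, where X solves X + P(hX) = 1 and P is the projection to negative exponents. For h of
Wiener norm below 1 a Neumann series solves this equation, and it is a power series in h. The
identity `birkhoffMinus_add` transports analyticity from 0 to other h. Multiplying by F₀⁻¹ and B₀⁻¹
moves any point F₀B₀ of the big cell to 1, which gives openness and analytic local factors
(`localFactors_mem`, `loopAnalyticAt_localFactors`). The factors are normalized by the Iwasawa
decomposition of the product of their constant terms (`normalize_mem`). Uniqueness (`injOn_mul`)
holds because a loop that is both plus and minus is constant. The factors of a rapidly decaying loop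
decay rapidly (`Loop.rapid_factors`), so the statement for ℂ* is a restriction of the first one.

For density, let S be the set of loops s such that right multiplication by s preserves the closure
of `starCell`, the part of the big cell that extends to ℂ*. It is a closed submonoid. It contains
the rapidly decaying minus loops, and also 1 + czE₂₁, because multiplication by the latter stays in
the big cell for all but at most one c (`mul_oneAdd_mem_bigCell`). These elements generate all
unipotent monomial loops, and by closedness S contains all unipotent analytic loops. After a
constant shear, every loop in ΛSL is a product of three unipotent ones. So S contains ΛSL, and
applying its elements to the loop 1 gives the density in both groups. -/

section BigCell

/-! ### Scalar Laurent coefficients: Cauchy estimates and Fourier series. -/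

section ScalarLaurent

open Metric Complex

/-- The `k`-th Laurent coefficient of a function defined near the unit circle. -/
noncomputable def laurentCoeff (f : ℂ → ℂ) (k : ℤ) : ℂ :=
  (2 * Real.pi * I)⁻¹ * ∮ z in C(0, 1), z ^ (-k - 1) * f z

theorem annulus_bounds_of_mem_closedBall_diff_ball {r R : ℝ} {z : ℂ}
    (hz : z ∈ closedBall (0 : ℂ) R \ ball 0 r) : r ≤ ‖z‖ ∧ ‖z‖ ≤ R := by
  simpa [and_comm] using hz

theorem circleIntegral_eq_of_analyticOnNhd {r R : ℝ} (h0 : 0 < r) (hle : r ≤ R) {f : ℂ → ℂ}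
    (hf : AnalyticOnNhd ℂ f {z | r ≤ ‖z‖ ∧ ‖z‖ ≤ R}) :
    (∮ z in C(0, R), f z) = ∮ z in C(0, r), f z := by
  refine circleIntegral_eq_of_differentiable_on_annulus_off_countable h0 hle
    Set.countable_empty (fun z hz => ?_) fun z hz => ?_
  · exact (hf z (annulus_bounds_of_mem_closedBall_diff_ball hz)).continuousAt.continuousWithinAt
  · refine (hf z ?_).differentiableAt
    have := hz.1
    simp only [Set.mem_sdiff, mem_ball, mem_closedBall, dist_zero_right, not_le] at this
    exact ⟨this.2.le, this.1.le⟩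

theorem analyticAt_zpow_mul {f : ℂ → ℂ} {z : ℂ} (k : ℤ) (hz : z ≠ 0) (hf : AnalyticAt ℂ f z) :
    AnalyticAt ℂ (fun z => z ^ k * f z) z :=
  (analyticAt_id.zpow hz).mul hf

theorem norm_circleIntegral_zpow_mul_le {f : ℂ → ℂ} {ρ M : ℝ} (hρ : 0 < ρ)
    (hM : ∀ z : ℂ, ‖z‖ = ρ → ‖f z‖ ≤ M) (k : ℤ) :
    ‖(2 * Real.pi * I)⁻¹ * ∮ z in C(0, ρ), z ^ (-k - 1) * f z‖ ≤ M * ρ ^ (-k) := by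
  have h := circleIntegral.norm_two_pi_i_inv_smul_integral_le_of_norm_le_const
    (c := 0) (R := ρ) (f := fun z => z ^ (-k - 1) * f z) (C := ρ ^ (-k - 1) * M) hρ.le (by
      intro z hz
      have hz' : ‖z‖ = ρ := by simpa using hz
      rw [norm_mul, norm_zpow, hz']
      exact mul_le_mul_of_nonneg_left (hM z hz') (zpow_nonneg hρ.le _))
  rw [smul_eq_mul] at h
  refine h.trans (le_of_eq ?_)
  rw [zpow_sub_one₀ hρ.ne']
  field_simp

theorem norm_laurentCoeff_le_of_one_le {f : ℂ → ℂ} {ρ M : ℝ} (hρ : 1 ≤ ρ)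
    (hf : AnalyticOnNhd ℂ f {z | 1 ≤ ‖z‖ ∧ ‖z‖ ≤ ρ})
    (hM : ∀ z : ℂ, ‖z‖ = ρ → ‖f z‖ ≤ M) (k : ℤ) : ‖laurentCoeff f k‖ ≤ M * ρ ^ (-k) := by
  rw [laurentCoeff, ← circleIntegral_eq_of_analyticOnNhd one_pos hρ fun z hz =>
    analyticAt_zpow_mul _ (norm_pos_iff.1 (one_pos.trans_le hz.1)) (hf z hz)]
  exact norm_circleIntegral_zpow_mul_le (by positivity) hM k

theorem norm_laurentCoeff_le_of_le_one {f : ℂ → ℂ} {ρ M : ℝ} (h0 : 0 < ρ) (hρ : ρ ≤ 1)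
    (hf : AnalyticOnNhd ℂ f {z | ρ ≤ ‖z‖ ∧ ‖z‖ ≤ 1})
    (hM : ∀ z : ℂ, ‖z‖ = ρ → ‖f z‖ ≤ M) (k : ℤ) : ‖laurentCoeff f k‖ ≤ M * ρ ^ (-k) := by
  rw [laurentCoeff, circleIntegral_eq_of_analyticOnNhd h0 hρ fun z hz =>
    analyticAt_zpow_mul _ (norm_pos_iff.1 (h0.trans_le hz.1)) (hf z hz)]
  exact norm_circleIntegral_zpow_mul_le h0 hM k

/-- Cauchy's estimate after moving the contour outwards to |z| = r for k ≥ 0 and inwards to |z| =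
1/r for k ≤ 0. -/
theorem norm_laurentCoeff_le {f : ℂ → ℂ} {r M : ℝ} (hr : 1 ≤ r)
    (hf : AnalyticOnNhd ℂ f {z | r⁻¹ ≤ ‖z‖ ∧ ‖z‖ ≤ r})
    (hM : ∀ z : ℂ, r⁻¹ ≤ ‖z‖ → ‖z‖ ≤ r → ‖f z‖ ≤ M) (k : ℤ) :
    ‖laurentCoeff f k‖ ≤ M * (r ^ k.natAbs)⁻¹ := by
  have hr1 : r⁻¹ ≤ 1 := inv_le_one_of_one_le₀ hr
  have hr0 : 0 < r := one_pos.trans_le hr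
  rcases le_total 0 k with hk | hk
  · have := norm_laurentCoeff_le_of_one_le (ρ := r) (M := M) hr
      (hf.mono fun z hz => ⟨hr1.trans hz.1, hz.2⟩) (fun z hz => hM z (hz ▸ hr1.trans hr) hz.le) k
    have h2 : k = (k.natAbs : ℤ) := by omega
    rwa [zpow_neg, h2, zpow_natCast, ← h2] at this
  · have := norm_laurentCoeff_le_of_le_one (ρ := r⁻¹) (M := M) (inv_pos.2 hr0) hr1
      (hf.mono fun z hz => ⟨hz.1, hz.2.trans hr⟩)
      (fun z hz => hM z hz.ge (hz ▸ hr1.trans hr)) k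
    have h2 : (-k) = (k.natAbs : ℤ) := by omega
    rwa [h2, zpow_natCast, inv_pow] at this

/-- The closed annulus `1/r ≤ |z| ≤ r` is compact. -/
theorem isCompact_closedAnnulus (r : ℝ) : IsCompact {z : ℂ | r⁻¹ ≤ ‖z‖ ∧ ‖z‖ ≤ r} := by
  refine (isCompact_closedBall (0 : ℂ) r).of_isClosed_subset ?_ fun z hz => by simpa using hz.2
  exact (isClosed_le continuous_const continuous_norm).inter
    (isClosed_le continuous_norm continuous_const)

theorem exists_analyticOnNhd_closedAnnulus {f : ℂ → ℂ} (hf : AnalyticOnNhd ℂ f (sphere 0 1)) :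
    ∃ r : ℝ, 1 < r ∧ AnalyticOnNhd ℂ f {z | r⁻¹ ≤ ‖z‖ ∧ ‖z‖ ≤ r} := by
  obtain ⟨δ, hδ, h⟩ := (isCompact_sphere (0 : ℂ) 1).exists_thickening_subset_open
    (isOpen_analyticAt ℂ f) hf
  obtain ⟨r, hr1, hr⟩ : ∃ r : ℝ, 1 < r ∧ r < 1 + δ := exists_between (by linarith)
  refine ⟨r, hr1, fun z hz => h ?_⟩
  have hr0 : 0 < r := by linarith
  -- The annulus is at most as thick inside the circle as outside, so r - 1 < δ controls both sides.
  have hri : 1 - r⁻¹ ≤ r - 1 := by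
    have : (r - 1) - (1 - r⁻¹) = (r - 1) ^ 2 * r⁻¹ := by field_simp
    have : 0 ≤ (r - 1) ^ 2 * r⁻¹ := by positivity
    linarith
  have hz0 : 0 < ‖z‖ := (inv_pos.2 hr0).trans_le hz.1
  rw [mem_thickening_iff]
  -- The radial projection of z to the circle lies at distance |‖z‖ - 1| from z.
  refine ⟨(‖z‖⁻¹ : ℂ) * z, by simp [hz0.ne'], ?_⟩
  rw [dist_eq_norm]
  have : z - (‖z‖⁻¹ : ℂ) * z = ((1 - ‖z‖⁻¹ : ℝ) : ℂ) * z := by push_cast; ring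
  rw [this, norm_mul, norm_real, ← abs_norm z, Real.norm_eq_abs, ← abs_mul, abs_norm]
  have : (1 - ‖z‖⁻¹) * ‖z‖ = ‖z‖ - 1 := by field_simp
  rw [this, abs_lt]
  constructor <;> linarith [hz.1, hz.2]

theorem summable_pow_natAbs {r : ℝ} (h0 : 0 ≤ r) (h1 : r < 1) :
    Summable fun k : ℤ => r ^ k.natAbs := by
  refine Summable.of_nat_of_neg ?_ ?_ <;> simpa using summable_geometric_of_lt_one h0 h1

theorem summable_pow_mul_norm_laurentCoeff {f : ℂ → ℂ} {r s : ℝ} (hs : 0 ≤ s) (hr : 1 ≤ r)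
    (hsr : s < r) (hf : AnalyticOnNhd ℂ f {z | r⁻¹ ≤ ‖z‖ ∧ ‖z‖ ≤ r}) :
    Summable fun k : ℤ => s ^ k.natAbs * ‖laurentCoeff f k‖ := by
  obtain ⟨M, hM⟩ := (isCompact_closedAnnulus r).exists_bound_of_continuousOn hf.continuousOn
  have hr0 : 0 < r := by linarith
  refine Summable.of_nonneg_of_le (fun k => by positivity) (fun k => ?_)
    ((summable_pow_natAbs (r := s / r) (by positivity) ((div_lt_one hr0).2 hsr)).mul_left M)
  have := norm_laurentCoeff_le hr hf (fun z h1 h2 => hM z ⟨h1, h2⟩) k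
  calc s ^ k.natAbs * ‖laurentCoeff f k‖ ≤ s ^ k.natAbs * (M * (r ^ k.natAbs)⁻¹) := by gcongr
    _ = M * (s / r) ^ k.natAbs := by rw [div_pow]; ring

instance fact_zero_lt_two_pi : Fact (0 < 2 * Real.pi) := ⟨Real.two_pi_pos⟩

theorem coe_toCircle_two_pi (x : ℝ) :
    ((AddCircle.toCircle (x : AddCircle (2 * Real.pi)) : Circle) : ℂ) = circleMap 0 1 x := by
  rw [AddCircle.toCircle_apply_mk, div_self Real.two_pi_pos.ne', one_mul, Circle.coe_exp,
    circleMap]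
  simp

theorem coe_fourier_two_pi (k : ℤ) (x : AddCircle (2 * Real.pi)) :
    fourier k x = ((AddCircle.toCircle x : Circle) : ℂ) ^ k := by
  rw [fourier_apply, AddCircle.toCircle_zsmul, Circle.coe_zpow]

theorem fourierCoeff_comp_toCircle (f : ℂ → ℂ) (k : ℤ) :
    fourierCoeff (fun x : AddCircle (2 * Real.pi) => f (AddCircle.toCircle x)) k =
      laurentCoeff f k := by
  rw [fourierCoeff_eq_intervalIntegral _ _ 0, laurentCoeff, circleIntegral, zero_add]
  have : ∀ θ : ℝ, deriv (circleMap 0 1) θ • (circleMap 0 1 θ ^ (-k - 1) * f (circleMap 0 1 θ)) =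
      I * (fourier (-k) (θ : AddCircle (2 * Real.pi)) •
        f (AddCircle.toCircle (θ : AddCircle (2 * Real.pi)))) := by
    intro θ
    rw [coe_fourier_two_pi, coe_toCircle_two_pi, deriv_circleMap, smul_eq_mul, smul_eq_mul,
      zpow_sub_one₀ (circleMap_ne_center one_ne_zero)]
    field_simp [circleMap_ne_center (c := 0) (R := 1) (θ := θ) one_ne_zero]
  simp_rw [this]
  rw [intervalIntegral.integral_const_mul, ← mul_assoc, real_smul]
  congr 1
  push_cast
  field_simp [I_ne_zero]

theorem hasSum_laurentCoeff {f : ℂ → ℂ} (hf : ContinuousOn f (sphere 0 1))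
    (hs : Summable fun k => ‖laurentCoeff f k‖) (z : Circle) :
    HasSum (fun k : ℤ => (z : ℂ) ^ k * laurentCoeff f k) (f z) := by
  let F : C(AddCircle (2 * Real.pi), ℂ) :=
    ⟨fun x => f (AddCircle.toCircle x), hf.comp_continuous
      (f := fun x : AddCircle (2 * Real.pi) => ((AddCircle.toCircle x : Circle) : ℂ))
      (continuous_subtype_val.comp AddCircle.continuous_toCircle) fun x => by
        rw [mem_sphere_zero_iff_norm]; exact Circle.norm_coe _⟩
  have hF : fourierCoeff F = laurentCoeff f := funext fun k => fourierCoeff_comp_toCircle f k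
  obtain ⟨x, hx⟩ : ∃ x : AddCircle (2 * Real.pi), AddCircle.toCircle x = z :=
    (AddCircle.homeomorphCircle Real.two_pi_pos.ne').surjective z |>.imp fun x hx => by
      rwa [AddCircle.homeomorphCircle_apply] at hx
  have := has_pointwise_sum_fourier_series_of_summable (f := F) (hF ▸ hs.of_norm) x
  have hz : F x = f z := by rw [← hx]; rfl
  rw [hF, hz] at this
  refine this.congr_fun fun k => ?_
  rw [coe_fourier_two_pi, hx, smul_eq_mul, mul_comm]

/-- Absolute summability gives convergence in the space of continuous functions, hence in L², where
the coordinates in the Fourier basis are continuous and can be applied term by term. -/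
theorem fourierCoeff_eq_of_hasSum {f : Circle → ℂ} {a : ℤ → ℂ} (ha : Summable fun k => ‖a k‖)
    (h : ∀ z : Circle, HasSum (fun k : ℤ => (z : ℂ) ^ k * a k) (f z)) (n : ℤ) :
    fourierCoeff (fun x : AddCircle (2 * Real.pi) => f (AddCircle.toCircle x)) n = a n := by
  have hsum : HasSum (fun k => a k • @fourier (2 * Real.pi) k)
      (∑' k, a k • @fourier (2 * Real.pi) k) :=
    (Summable.of_norm (by simpa only [norm_smul, fourier_norm, mul_one] using ha)).hasSum
  set F := ∑' k, a k • @fourier (2 * Real.pi) k with hF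
  have hFf : (fun x : AddCircle (2 * Real.pi) => f (AddCircle.toCircle x)) = F := by
    funext x
    have h1 := (ContinuousMap.evalCLM ℂ x).hasSum hsum
    refine (h (AddCircle.toCircle x)).unique ?_
    simpa only [map_smul, ContinuousMap.evalCLM_apply, coe_fourier_two_pi, smul_eq_mul,
      mul_comm] using h1
  rw [hFf]
  have h2 := ((fourierBasis (T := 2 * Real.pi)).repr.toContinuousLinearEquiv.toContinuousLinearMap.comp
    (ContinuousMap.toLp (E := ℂ) 2 AddCircle.haarAddCircle ℂ)).hasSum hsum
  have h3 := (lp.evalCLM (𝕜 := ℂ) (fun _ : ℤ => ℂ) 2 n).hasSum h2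
  have h4 : ∀ G : C(AddCircle (2 * Real.pi), ℂ), (fourierBasis (T := 2 * Real.pi)).repr
      (ContinuousMap.toLp (E := ℂ) 2 AddCircle.haarAddCircle ℂ G) n = fourierCoeff G n :=
    fun G => by rw [fourierBasis_repr, fourierCoeff_toLp]
  have h5 : HasSum (fun k => a k * (Pi.single k 1 : ℤ → ℂ) n) (fourierCoeff F n) := by
    rw [← h4]
    have h6 : ∀ k, (lp.evalCLM (𝕜 := ℂ) (fun _ : ℤ => ℂ) 2 n)
        (fourierBasis.repr (ContinuousMap.toLp (E := ℂ) 2 AddCircle.haarAddCircle ℂ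
          (a k • @fourier (2 * Real.pi) k))) = a k * (Pi.single k 1 : ℤ → ℂ) n := fun k => by
      refine (h4 (a k • fourier k)).trans ((fourierCoeff.const_smul _ (a k) n).trans ?_)
      rw [fourierCoeff_fourier, smul_eq_mul]
    exact h3.congr_fun fun k => (h6 k).symm
  refine h5.unique ?_
  convert hasSum_ite_eq n (a n) using 2 with k
  by_cases hk : k = n <;> simp [hk]

/-- For k < 0 the exponent -k - 1 is nonnegative, so the integrand is holomorphic on the disc and
Cauchy's theorem applies. -/
theorem laurentCoeff_of_neg {f : ℂ → ℂ} (hf : AnalyticOnNhd ℂ f (closedBall 0 1)) {k : ℤ}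
    (hk : k < 0) : laurentCoeff f k = 0 := by
  obtain ⟨n, hn⟩ : ∃ n : ℕ, -k - 1 = n := ⟨(-k - 1).toNat, by omega⟩
  rw [laurentCoeff, hn, Complex.circleIntegral_eq_zero_of_differentiable_on_off_countable
    zero_le_one Set.countable_empty, mul_zero]
  · simp_rw [zpow_natCast]
    exact (continuous_pow n).continuousOn.mul hf.continuousOn
  · intro z hz
    simp_rw [zpow_natCast]
    exact (differentiableAt_pow n).mul (hf z (ball_subset_closedBall hz.1)).differentiableAt

theorem laurentCoeff_zero {f : ℂ → ℂ} (hf : AnalyticOnNhd ℂ f (closedBall 0 1)) :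
    laurentCoeff f 0 = f 0 := by
  have := (hf.differentiableOn.diffContOnCl_ball subset_rfl).two_pi_i_inv_smul_circleIntegral_sub_inv_smul
    (mem_ball_self one_pos)
  simpa [laurentCoeff] using this

end ScalarLaurent

/-! ### Laurent coefficients of matrix loops and their convolution. -/

section LoopCoefficients

open scoped Matrix.Norms.Operator ENNReal NNReal

theorem norm_entry_le (m : M2) (i j : Fin 2) : ‖m i j‖ ≤ ‖m‖ := by
  rw [Matrix.linfty_opNorm_def, ← coe_nnnorm, NNReal.coe_le_coe]
  exact (Finset.single_le_sum (f := fun j => ‖m i j‖₊) (fun _ _ => zero_le)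
    (Finset.mem_univ j)).trans
    (Finset.le_sup (f := fun i => ∑ j, ‖m i j‖₊) (Finset.mem_univ i))

theorem norm_le_two_mul {m : M2} {C : ℝ} (h : ∀ i j, ‖m i j‖ ≤ C) : ‖m‖ ≤ 2 * C := by
  have hC : 0 ≤ C := (norm_nonneg _).trans (h 0 0)
  lift C to ℝ≥0 using hC
  rw [Matrix.linfty_opNorm_def]
  have : (Finset.univ.sup fun i => ∑ j, ‖m i j‖₊) ≤ 2 * C := by
    refine Finset.sup_le fun i _ => ?_
    rw [Fin.sum_univ_two, two_mul]
    exact add_le_add (h i 0) (h i 1)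
  exact_mod_cast this

theorem hasSum_matrix {ι : Type*} {f : ι → M2} {a : M2} :
    HasSum f a ↔ ∀ i j, HasSum (fun n => f n i j) (a i j) :=
  Pi.hasSum.trans (forall_congr' fun _ => Pi.hasSum)

/-- The Laurent (Fourier) coefficients of a matrix-valued function on the circle. -/
noncomputable def loopCoeff (Φ : Circle → M2) (k : ℤ) : M2 := fun i j =>
  fourierCoeff (fun x : AddCircle (2 * Real.pi) => Φ (AddCircle.toCircle x) i j) k

theorem loopCoeff_apply_of_ext {Φ : Circle → M2} {g : ℂ → M2} (h : ∀ z : Circle, g z = Φ z)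
    (k : ℤ) (i j : Fin 2) : loopCoeff Φ k i j = laurentCoeff (fun z => g z i j) k := by
  rw [← fourierCoeff_comp_toCircle]
  simp only [loopCoeff, h]

theorem loopCoeff_eq_of_hasSum {Φ : Circle → M2} {a : ℤ → M2} (ha : Summable fun k => ‖a k‖)
    (h : ∀ z : Circle, HasSum (fun k : ℤ => (z : ℂ) ^ k • a k) (Φ z)) : loopCoeff Φ = a := by
  funext k
  ext i j
  exact fourierCoeff_eq_of_hasSum (f := fun z => Φ z i j) (a := fun k => a k i j)
    (ha.of_nonneg_of_le (fun _ => norm_nonneg _) fun k => norm_entry_le _ _ _)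
    (fun z => by simpa using hasSum_matrix.1 (h z) i j) k

theorem summable_natAbs_of_ext {Φ : Circle → M2} {g : ℂ → M2} {r s : ℝ} (hs : 0 ≤ s) (hr : 1 ≤ r)
    (hsr : s < r) (h : IsHolExt {z | r⁻¹ ≤ ‖z‖ ∧ ‖z‖ ≤ r} Φ g) :
    Summable fun k : ℤ => s ^ k.natAbs * ‖loopCoeff Φ k‖ := by
  have hij : ∀ i j, Summable fun k : ℤ => s ^ k.natAbs * ‖loopCoeff Φ k i j‖ := fun i j => by
    simpa only [loopCoeff_apply_of_ext h.2] using
      summable_pow_mul_norm_laurentCoeff hs hr hsr (h.1 i j)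
  refine Summable.of_nonneg_of_le (fun k => by positivity) (fun k => ?_)
    ((summable_sum (s := Finset.univ) fun i _ => summable_sum (s := Finset.univ)
      fun j _ => hij i j).mul_left 2)
  simp_rw [← Finset.mul_sum]
  rw [← Fintype.sum_prod_type' (fun i j => ‖loopCoeff Φ k i j‖), mul_left_comm]
  gcongr
  refine norm_le_two_mul fun i j => ?_
  exact Finset.single_le_sum (f := fun p : Fin 2 × Fin 2 => ‖loopCoeff Φ k p.1 p.2‖)
    (fun _ _ => norm_nonneg _) (Finset.mem_univ (i, j))

theorem Loop.ext {Φ Ψ : Loop} (h : ∀ z, Φ z = Ψ z) : Φ = Ψ := Subtype.ext (funext h)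

theorem Loop.mul_apply (Φ Ψ : Loop) (z : Circle) : (Φ * Ψ) z = Φ z * Ψ z := rfl
theorem Loop.add_apply (Φ Ψ : Loop) (z : Circle) : (Φ + Ψ) z = Φ z + Ψ z := rfl
theorem Loop.one_apply (z : Circle) : (1 : Loop) z = 1 := rfl
theorem Loop.smul_apply (c : ℝ) (Φ : Loop) (z : Circle) : (c • Φ) z = c • Φ z := rfl

theorem Loop.exists_ext_closedAnnulus (Φ : Loop) :
    ∃ r : ℝ, 1 < r ∧ ∃ g, IsHolExt {z | r⁻¹ ≤ ‖z‖ ∧ ‖z‖ ≤ r} Φ g := by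
  obtain ⟨g, hg, hgΦ⟩ := Φ.2
  choose r hr hgr using fun i j => exists_analyticOnNhd_closedAnnulus (hg i j)
  obtain ⟨⟨i₀, j₀⟩, hmin⟩ := Finite.exists_min fun p : Fin 2 × Fin 2 => r p.1 p.2
  refine ⟨r i₀ j₀, hr _ _, g, fun i j => (hgr i j).mono fun z hz => ?_, hgΦ⟩
  exact ⟨(inv_anti₀ (by linarith [hr i₀ j₀]) (hmin (i, j))).trans hz.1, hz.2.trans (hmin (i, j))⟩

theorem Loop.exists_summable (Φ : Loop) :
    ∃ r : ℝ, 1 < r ∧ Summable fun k : ℤ => r ^ k.natAbs * ‖loopCoeff Φ k‖ := by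
  obtain ⟨r, hr, g, hg⟩ := Φ.exists_ext_closedAnnulus
  obtain ⟨s, h1, h2⟩ := exists_between hr
  exact ⟨s, h1, summable_natAbs_of_ext (by linarith) hr.le h2 hg⟩

theorem summable_norm_of_summable_pow {E : Type*} [SeminormedAddCommGroup E] {a : ℤ → E} {r : ℝ}
    (hr : 1 ≤ r) (h : Summable fun k : ℤ => r ^ k.natAbs * ‖a k‖) : Summable fun k => ‖a k‖ :=
  h.of_nonneg_of_le (fun _ => norm_nonneg _) fun _ =>
    le_mul_of_one_le_left (norm_nonneg _) (one_le_pow₀ hr)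

theorem Loop.summable_norm_coeff (Φ : Loop) : Summable fun k : ℤ => ‖loopCoeff Φ k‖ := by
  obtain ⟨r, hr, h⟩ := Φ.exists_summable
  exact summable_norm_of_summable_pow hr.le h

theorem Loop.hasSum_coeff (Φ : Loop) (z : Circle) :
    HasSum (fun k : ℤ => (z : ℂ) ^ k • loopCoeff Φ k) (Φ z) := by
  obtain ⟨g, hg, hgΦ⟩ := Φ.2
  rw [hasSum_matrix]
  intro i j
  have := hasSum_laurentCoeff (f := fun z => g z i j) (hg i j).continuousOn (by
    simp_rw [← loopCoeff_apply_of_ext hgΦ]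
    exact Φ.summable_norm_coeff.of_nonneg_of_le (fun _ => norm_nonneg _)
      fun k => norm_entry_le _ _ _) z
  simp only [← loopCoeff_apply_of_ext hgΦ, hgΦ] at this
  simpa using this

theorem Loop.ext_coeff {Φ Ψ : Loop} (h : ∀ k, loopCoeff Φ k = loopCoeff Ψ k) : Φ = Ψ :=
  Loop.ext fun z => (Φ.hasSum_coeff z).unique (by simpa only [h] using Ψ.hasSum_coeff z)

/-- Weierstrass' theorem. The hypothesis `h0` covers at once the annulus, which avoids 0, and the
disc, where the negative powers are absent. -/
theorem analyticOnNhd_tsum_zpow {U : Set ℂ} (hU : IsOpen U) {a : ℤ → ℂ} {u : ℤ → ℝ}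
    (hu : Summable u) (hb : ∀ k, ∀ z ∈ U, ‖z ^ k * a k‖ ≤ u k)
    (h0 : ∀ k < 0, a k = 0 ∨ (0 : ℂ) ∉ U) : AnalyticOnNhd ℂ (fun z => ∑' k, z ^ k * a k) U := by
  refine DifferentiableOn.analyticOnNhd (Complex.differentiableOn_tsum_of_summable_norm hu
    (fun k z hz => ?_) hU hb) hU
  refine DifferentiableAt.differentiableWithinAt ?_
  by_cases hk : k < 0
  · rcases h0 k hk with h | h
    · simp [h]
    · exact (differentiableAt_zpow.2 (.inl fun h' => h (h' ▸ hz))).mul_const _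
  · exact (differentiableAt_zpow.2 (.inr (not_lt.1 hk))).mul_const _

theorem norm_zpow_le_pow_natAbs {z : ℂ} {r : ℝ} (hr : 0 < r) (h1 : r⁻¹ ≤ ‖z‖) (h2 : ‖z‖ ≤ r)
    (k : ℤ) : ‖z ^ k‖ ≤ r ^ k.natAbs := by
  rw [norm_zpow]
  rcases le_total 0 k with hk | hk
  · have : k = (k.natAbs : ℤ) := by omega
    rw [this, zpow_natCast, Int.natAbs_natCast]
    exact pow_le_pow_left₀ (norm_nonneg _) h2 _
  · have : k = -(k.natAbs : ℤ) := by omega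
    rw [this, zpow_neg, zpow_natCast, Int.natAbs_neg, Int.natAbs_natCast, ← inv_pow]
    exact pow_le_pow_left₀ (by positivity) (inv_le_of_inv_le₀ hr h1) _

/-- The sum of a Laurent series with matrix coefficients. -/
noncomputable def laurentSum (a : ℤ → M2) (z : ℂ) : M2 := fun i j => ∑' k : ℤ, z ^ k * a k i j

theorem hasSum_laurentSum {a : ℤ → M2} (ha : Summable fun k => ‖a k‖) (z : Circle) :
    HasSum (fun k : ℤ => (z : ℂ) ^ k • a k) (laurentSum a z) := by
  rw [hasSum_matrix]
  intro i j
  simp only [Matrix.smul_apply, smul_eq_mul]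
  refine (Summable.of_norm ?_).hasSum
  refine ha.of_nonneg_of_le (fun _ => norm_nonneg _) fun k => ?_
  simpa [Circle.norm_coe] using norm_entry_le (a k) i j

theorem isOpen_annulus (r : ℝ) : IsOpen (annulus r) :=
  (isOpen_lt continuous_const continuous_norm).inter (isOpen_lt continuous_norm continuous_const)

theorem zero_notMem_annulus {r : ℝ} (hr : 0 ≤ r) : (0 : ℂ) ∉ annulus r := fun h => by
  have := h.1
  rw [norm_zero] at this
  exact absurd (inv_nonneg.2 hr) (not_le.2 this)

theorem analyticOnNhd_laurentSum {r : ℝ} (hr : 0 < r) {a : ℤ → M2}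
    (ha : Summable fun k : ℤ => r ^ k.natAbs * ‖a k‖) (i j : Fin 2) :
    AnalyticOnNhd ℂ (fun z => laurentSum a z i j) (annulus r) := by
  refine analyticOnNhd_tsum_zpow (isOpen_annulus r) ha (fun k z hz => ?_)
    fun k _ => .inr (zero_notMem_annulus hr.le)
  rw [norm_mul]
  exact mul_le_mul (norm_zpow_le_pow_natAbs hr hz.1.le hz.2.le k) (norm_entry_le _ _ _)
    (norm_nonneg _) (by positivity)

theorem norm_laurentSum_apply_le {r : ℝ} (hr : 0 < r) {a : ℤ → M2}
    (ha : Summable fun k : ℤ => r ^ k.natAbs * ‖a k‖) {z : ℂ} (hz : z ∈ annulus r) (i j : Fin 2) :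
    ‖laurentSum a z i j‖ ≤ ∑' k : ℤ, r ^ k.natAbs * ‖a k‖ := by
  refine tsum_of_norm_bounded ha.hasSum fun k => ?_
  rw [norm_mul]
  exact mul_le_mul (norm_zpow_le_pow_natAbs hr hz.1.le hz.2.le k) (norm_entry_le _ _ _)
    (norm_nonneg _) (by positivity)

theorem analyticOnNhd_laurentSum_ball {r : ℝ} (hr : 0 < r) {a : ℤ → M2}
    (ha : Summable fun k : ℤ => r ^ k.natAbs * ‖a k‖) (h0 : ∀ k < 0, a k = 0) (i j : Fin 2) :
    AnalyticOnNhd ℂ (fun z => laurentSum a z i j) (Metric.ball 0 r) := by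
  refine analyticOnNhd_tsum_zpow Metric.isOpen_ball ha (fun k z hz => ?_)
    fun k hk => .inl (by simp [h0 k hk])
  rcases lt_or_ge k 0 with hk | hk
  · simp [h0 k hk]
  · rw [norm_mul]
    refine mul_le_mul ?_ (norm_entry_le _ _ _) (norm_nonneg _) (by positivity)
    have : k = (k.natAbs : ℤ) := by omega
    rw [this, zpow_natCast, Int.natAbs_natCast, norm_pow]
    exact pow_le_pow_left₀ (norm_nonneg _) (mem_ball_zero_iff.1 hz).le _

theorem sphere_subset_annulus {r : ℝ} (hr : 1 < r) : Metric.sphere (0 : ℂ) 1 ⊆ annulus r :=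
  fun z hz => by
    have hz' : ‖z‖ = 1 := by simpa using hz
    exact ⟨hz' ▸ inv_lt_one_of_one_lt₀ hr, hz' ▸ hr⟩

/-- The loop with given Laurent coefficients. -/
noncomputable def Loop.ofCoeff (a : ℤ → M2)
    (ha : ∃ r : ℝ, 1 < r ∧ Summable fun k : ℤ => r ^ k.natAbs * ‖a k‖) : Loop :=
  ⟨fun z => laurentSum a z, laurentSum a, fun i j =>
    (analyticOnNhd_laurentSum (one_pos.trans ha.choose_spec.1) ha.choose_spec.2 i j).mono
      (sphere_subset_annulus ha.choose_spec.1), fun _ => rfl⟩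

theorem Loop.coeff_ofCoeff {a : ℤ → M2}
    (ha : ∃ r : ℝ, 1 < r ∧ Summable fun k : ℤ => r ^ k.natAbs * ‖a k‖) :
    loopCoeff (Loop.ofCoeff a ha) = a := by
  obtain ⟨r, hr, h⟩ := id ha
  have h1 := summable_norm_of_summable_pow hr.le h
  exact loopCoeff_eq_of_hasSum h1 fun z => hasSum_laurentSum h1 z

theorem Loop.laurentSum_coeff (Φ : Loop) (z : Circle) : laurentSum (loopCoeff Φ) z = Φ z :=
  (hasSum_laurentSum Φ.summable_norm_coeff z).unique (Φ.hasSum_coeff z)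

theorem Loop.coeff_add (Φ Ψ : Loop) (k : ℤ) :
    loopCoeff (Φ + Ψ : Loop) k = loopCoeff Φ k + loopCoeff Ψ k := by
  refine congrFun (loopCoeff_eq_of_hasSum (a := fun k => loopCoeff Φ k + loopCoeff Ψ k) ?_
    fun z => ?_) k
  · exact (Φ.summable_norm_coeff.add Ψ.summable_norm_coeff).of_nonneg_of_le
      (fun _ => norm_nonneg _) fun _ => norm_add_le _ _
  · exact ((Φ.hasSum_coeff z).add (Ψ.hasSum_coeff z)).congr_fun fun k => smul_add _ _ _

theorem Loop.coeff_smul (c : ℝ) (Φ : Loop) (k : ℤ) :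
    loopCoeff (c • Φ : Loop) k = c • loopCoeff Φ k := by
  refine congrFun (loopCoeff_eq_of_hasSum (a := fun k => c • loopCoeff Φ k) ?_ fun z => ?_) k
  · simpa only [norm_smul] using Φ.summable_norm_coeff.mul_left ‖c‖
  · exact ((Φ.hasSum_coeff z).const_smul c).congr_fun fun k => smul_comm _ _ _

/-- A fixed Laurent coefficient, as a linear map. -/
noncomputable def Loop.coeffₗ (k : ℤ) : Loop →ₗ[ℝ] M2 where
  toFun Φ := loopCoeff Φ k
  map_add' Φ Ψ := Loop.coeff_add Φ Ψ k
  map_smul' c Φ := Loop.coeff_smul c Φ k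

theorem Loop.coeff_sub (Φ Ψ : Loop) (k : ℤ) :
    loopCoeff (Φ - Ψ : Loop) k = loopCoeff Φ k - loopCoeff Ψ k := map_sub (Loop.coeffₗ k) Φ Ψ

theorem Loop.coeff_neg (Φ : Loop) (k : ℤ) : loopCoeff (-Φ : Loop) k = -loopCoeff Φ k :=
  map_neg (Loop.coeffₗ k) Φ

theorem Loop.coeff_zero (k : ℤ) : loopCoeff (0 : Loop) k = 0 := map_zero (Loop.coeffₗ k)

/-- The reindexing `(k, j) ↦ (j, k - j)` of the terms of a convolution. -/
def convEquiv : ℤ × ℤ ≃ ℤ × ℤ where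
  toFun p := (p.2, p.1 - p.2)
  invFun p := (p.1 + p.2, p.1)
  left_inv p := by simp
  right_inv p := by simp

theorem hasSum_conv_of_summable_norm {R : Type*} [NormedRing R] [CompleteSpace R]
    {u v : ℤ → R} {A B : R} (h1 : Summable fun k : ℤ => ‖u k‖) (h2 : Summable fun k : ℤ => ‖v k‖)
    (hA : HasSum u A) (hB : HasSum v B) :
    HasSum (fun p : ℤ × ℤ => u p.2 * v (p.1 - p.2)) (A * B) :=
  (Equiv.hasSum_iff convEquiv).2 (hA.mul hB (summable_mul_of_summable_norm h1 h2))

theorem hasSum_laurent_mul {R : Type*} [NormedRing R] [NormedAlgebra ℂ R] [CompleteSpace R]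
    {z : ℂ} (hz : z ≠ 0) {a b : ℤ → R} {A B : R}
    (h1 : Summable fun k : ℤ => ‖z ^ k • a k‖) (h2 : Summable fun k : ℤ => ‖z ^ k • b k‖)
    (hA : HasSum (fun k : ℤ => z ^ k • a k) A) (hB : HasSum (fun k : ℤ => z ^ k • b k) B) :
    HasSum (fun p : ℤ × ℤ => z ^ p.1 • (a p.2 * b (p.1 - p.2))) (A * B) := by
  refine (hasSum_conv_of_summable_norm h1 h2 hA hB).congr_fun fun p => ?_
  have h3 : z ^ p.1 = z ^ p.2 * z ^ (p.1 - p.2) := by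
    rw [← zpow_add₀ hz, add_sub_cancel]
  rw [h3]
  exact (smul_mul_smul_comm _ _ _ _).symm

theorem Loop.hasSum_mul_prod (Φ Ψ : Loop) (z : Circle) :
    HasSum (fun p : ℤ × ℤ => (z : ℂ) ^ p.1 • (loopCoeff Φ p.2 * loopCoeff Ψ (p.1 - p.2)))
      ((Φ * Ψ) z) := by
  have h (Φ : Loop) : Summable fun k : ℤ => ‖(z : ℂ) ^ k • loopCoeff Φ k‖ := by
    simpa [norm_smul, Circle.norm_coe] using Φ.summable_norm_coeff
  rw [Loop.mul_apply]
  exact hasSum_laurent_mul (Circle.coe_ne_zero z) (h Φ) (h Ψ) (Φ.hasSum_coeff z) (Ψ.hasSum_coeff z)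

theorem Loop.summable_conv (Φ Ψ : Loop) :
    Summable fun p : ℤ × ℤ => ‖loopCoeff Φ p.2 * loopCoeff Ψ (p.1 - p.2)‖ := by
  have h := summable_mul_of_summable_norm Φ.summable_norm_coeff.norm Ψ.summable_norm_coeff.norm
  exact ((Equiv.summable_iff convEquiv).2 h).of_nonneg_of_le (fun _ => norm_nonneg _)
    fun p => norm_mul_le _ _

/-- The double series of the product converges absolutely and may be grouped by the total exponent.
Uniqueness of Laurent coefficients identifies the inner sums. -/
theorem Loop.hasSum_coeff_mul (Φ Ψ : Loop) (k : ℤ) :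
    HasSum (fun j : ℤ => loopCoeff Φ j * loopCoeff Ψ (k - j)) (loopCoeff (Φ * Ψ : Loop) k) := by
  have hs : ∀ k : ℤ, Summable fun j : ℤ => ‖loopCoeff Φ j * loopCoeff Ψ (k - j)‖ := fun k =>
    (Φ.summable_conv Ψ).prod_factor k
  have : loopCoeff (Φ * Ψ : Loop) = fun k => ∑' j : ℤ, loopCoeff Φ j * loopCoeff Ψ (k - j) := by
    refine loopCoeff_eq_of_hasSum ?_ fun z => ?_
    · exact (Φ.summable_conv Ψ).prod.of_nonneg_of_le (fun _ => norm_nonneg _)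
        fun k => norm_tsum_le_tsum_norm (hs k)
    · exact (Φ.hasSum_mul_prod Ψ z).prod_fiberwise fun k => (hs k).of_norm.hasSum.const_smul _
  rw [this]
  exact (hs k).of_norm.hasSum

end LoopCoefficients

/-! ### Weighted ℓ¹ norms of the coefficients, with values in [0, ∞]. -/

section WeightedNorms

open scoped Matrix.Norms.Operator ENNReal NNReal
open Filter

/-- The weighted `ℓ¹` norm of the Laurent coefficients of a loop. -/
noncomputable def wnorm (v : ℕ → ℝ≥0) (Φ : Loop) : ℝ≥0∞ :=
  ∑' k : ℤ, (v k.natAbs : ℝ≥0∞) * ‖loopCoeff Φ k‖ₑ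

/-- Submultiplicative weights. -/
structure IsWeight (v : ℕ → ℝ≥0) : Prop where
  one_le : ∀ n, 1 ≤ v n
  mono : Monotone v
  mul_le : ∀ m n, v (m + n) ≤ v m * v n

/-- Weights that grow more slowly than every exponential. -/
def IsSubexp (v : ℕ → ℝ≥0) : Prop := ∀ r : ℝ≥0, 1 < r → ∃ C : ℝ≥0, ∀ n, v n ≤ C * r ^ n

/-- The exponential weight `n ↦ r ^ n`. -/
def powWeight (r : ℝ≥0) (n : ℕ) : ℝ≥0 := r ^ n

theorem isWeight_powWeight {r : ℝ≥0} (hr : 1 ≤ r) : IsWeight (powWeight r) where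
  one_le _ := one_le_pow₀ hr
  mono := pow_right_mono₀ hr
  mul_le m n := (pow_add r m n).le

theorem isSubexp_powWeight_one : IsSubexp (powWeight 1) := fun r hr =>
  ⟨1, fun n => by simpa [powWeight] using one_le_pow₀ hr.le⟩

theorem wnorm_zero (v : ℕ → ℝ≥0) : wnorm v 0 = 0 := by
  simp [wnorm, Loop.coeff_zero]

theorem wnorm_add_le (v : ℕ → ℝ≥0) (Φ Ψ : Loop) : wnorm v (Φ + Ψ) ≤ wnorm v Φ + wnorm v Ψ := by
  rw [wnorm, wnorm, wnorm, ← ENNReal.tsum_add]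
  refine ENNReal.tsum_le_tsum fun k => ?_
  rw [← mul_add, Loop.coeff_add]
  gcongr
  exact enorm_add_le _ _

theorem wnorm_neg (v : ℕ → ℝ≥0) (Φ : Loop) : wnorm v (-Φ) = wnorm v Φ := by
  simp [wnorm, Loop.coeff_neg]

theorem wnorm_sub_comm (v : ℕ → ℝ≥0) (Φ Ψ : Loop) : wnorm v (Φ - Ψ) = wnorm v (Ψ - Φ) := by
  rw [← wnorm_neg, neg_sub]

theorem wnorm_smul (v : ℕ → ℝ≥0) (c : ℝ) (Φ : Loop) : wnorm v (c • Φ) = ‖c‖ₑ * wnorm v Φ := by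
  rw [wnorm, wnorm, ← ENNReal.tsum_mul_left]
  refine tsum_congr fun k => ?_
  rw [Loop.coeff_smul, enorm_smul, mul_left_comm]

theorem wnorm_le_mul {v w : ℕ → ℝ≥0} {C : ℝ≥0} (h : ∀ n, v n ≤ C * w n) (Φ : Loop) :
    wnorm v Φ ≤ C * wnorm w Φ := by
  rw [wnorm, wnorm, ← ENNReal.tsum_mul_left]
  refine ENNReal.tsum_le_tsum fun k => ?_
  rw [← mul_assoc]
  gcongr
  exact_mod_cast h _

theorem wnorm_mono {v w : ℕ → ℝ≥0} (h : ∀ n, v n ≤ w n) (Φ : Loop) : wnorm v Φ ≤ wnorm w Φ := by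
  simpa using wnorm_le_mul (C := 1) (by simpa using h) Φ

theorem wnorm_powWeight_one_le {v : ℕ → ℝ≥0} (hv : IsWeight v) (Φ : Loop) :
    wnorm (powWeight 1) Φ ≤ wnorm v Φ :=
  wnorm_mono (fun n => by simpa [powWeight] using hv.one_le n) Φ

theorem enorm_coeff_le {v : ℕ → ℝ≥0} (hv : IsWeight v) (Φ : Loop) (k : ℤ) :
    ‖loopCoeff Φ k‖ₑ ≤ wnorm v Φ := by
  refine le_trans ?_ (ENNReal.le_tsum k)
  exact le_mul_of_one_le_left' (by exact_mod_cast hv.one_le _)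

theorem enorm_tsum_le {ι : Type*} {E : Type*} [NormedAddCommGroup E] [CompleteSpace E]
    {f : ι → E} {a : E} (h : HasSum f a) : ‖a‖ₑ ≤ ∑' i, ‖f i‖ₑ := by
  by_cases hf : ∑' i, ‖f i‖ₑ = ∞
  · rw [hf]; exact le_top
  · have hs : Summable fun i => ‖f i‖₊ := ENNReal.tsum_coe_ne_top_iff_summable.1 hf
    simp only [enorm_eq_nnnorm]
    rw [← ENNReal.coe_tsum hs, ENNReal.coe_le_coe, ← h.tsum_eq]
    exact nnnorm_tsum_le hs

/-- The weights need to be compared only at indices that contribute to the convolution. For factors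
with one-sided support this allows different weights on the two sides, as needed for
`Loop.Rapid.left` and `Loop.Rapid.right`. -/
theorem wnorm_mul_le_of_forall {u v w : ℕ → ℝ≥0} {Φ Ψ : Loop}
    (h : ∀ k j : ℤ, loopCoeff (Φ * Ψ : Loop) k = 0 ∨ loopCoeff Φ j = 0 ∨
      loopCoeff Ψ (k - j) = 0 ∨ u k.natAbs ≤ v j.natAbs * w (k - j).natAbs) :
    wnorm u (Φ * Ψ) ≤ wnorm v Φ * wnorm w Ψ := by
  calc wnorm u (Φ * Ψ)
      ≤ ∑' k : ℤ, ∑' j : ℤ, ((v j.natAbs : ℝ≥0∞) * ‖loopCoeff Φ j‖ₑ) *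
          ((w (k - j).natAbs : ℝ≥0∞) * ‖loopCoeff Ψ (k - j)‖ₑ) := by
        refine ENNReal.tsum_le_tsum fun k => ?_
        by_cases hk : loopCoeff (Φ * Ψ : Loop) k = 0
        · rw [enorm_eq_zero.2 hk, mul_zero]
          exact zero_le
        refine (mul_le_mul_right (enorm_tsum_le (Φ.hasSum_coeff_mul Ψ k)) _).trans ?_
        rw [← ENNReal.tsum_mul_left]
        refine ENNReal.tsum_le_tsum fun j => ?_
        rcases h k j with h | h | h | h
        · exact absurd h hk
        · rw [enorm_eq_zero.2 (mul_eq_zero_of_left h _), mul_zero]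
          exact zero_le
        · rw [enorm_eq_zero.2 (mul_eq_zero_of_right _ h), mul_zero]
          exact zero_le
        have h1 : (u k.natAbs : ℝ≥0∞) ≤ v j.natAbs * w (k - j).natAbs := by
          rwa [← ENNReal.coe_mul, ENNReal.coe_le_coe]
        have h2 : ‖loopCoeff Φ j * loopCoeff Ψ (k - j)‖ₑ ≤
            ‖loopCoeff Φ j‖ₑ * ‖loopCoeff Ψ (k - j)‖ₑ := by
          simp only [enorm_eq_nnnorm]
          rw [← ENNReal.coe_mul, ENNReal.coe_le_coe]
          exact nnnorm_mul_le _ _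
        exact (mul_le_mul' h1 h2).trans_eq (mul_mul_mul_comm _ _ _ _)
    _ = ∑' j : ℤ, ∑' k : ℤ, ((v j.natAbs : ℝ≥0∞) * ‖loopCoeff Φ j‖ₑ) *
          ((w (k - j).natAbs : ℝ≥0∞) * ‖loopCoeff Ψ (k - j)‖ₑ) := ENNReal.tsum_comm
    _ = wnorm v Φ * wnorm w Ψ := by
        rw [wnorm, wnorm, ← ENNReal.tsum_mul_right]
        refine tsum_congr fun j => ?_
        rw [ENNReal.tsum_mul_left]
        congr 1
        exact (Equiv.subRight j).tsum_eq
          fun l : ℤ => (w l.natAbs : ℝ≥0∞) * ‖loopCoeff Ψ l‖ₑ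

theorem wnorm_mul_le {v : ℕ → ℝ≥0} (hv : IsWeight v) (Φ Ψ : Loop) :
    wnorm v (Φ * Ψ) ≤ wnorm v Φ * wnorm v Ψ :=
  wnorm_mul_le_of_forall fun k j => .inr (.inr (.inr
    ((hv.mono (by omega)).trans (hv.mul_le j.natAbs (k - j).natAbs))))

theorem tsum_weight_ne_top_iff {a : ℤ → M2} {r : ℝ≥0} :
    ∑' k : ℤ, (powWeight r k.natAbs : ℝ≥0∞) * ‖a k‖ₑ ≠ ∞ ↔
      Summable fun k : ℤ => (r : ℝ) ^ k.natAbs * ‖a k‖ := by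
  have : ∀ k : ℤ, (powWeight r k.natAbs : ℝ≥0∞) * ‖a k‖ₑ =
      ((r ^ k.natAbs * ‖a k‖₊ : ℝ≥0) : ℝ≥0∞) := fun k => by
    rw [ENNReal.coe_mul]; rfl
  simp_rw [this]
  rw [ENNReal.tsum_coe_ne_top_iff_summable, ← NNReal.summable_coe]
  simp

theorem wnorm_powWeight_ne_top_iff {Φ : Loop} {r : ℝ≥0} :
    wnorm (powWeight r) Φ ≠ ∞ ↔ Summable fun k : ℤ => (r : ℝ) ^ k.natAbs * ‖loopCoeff Φ k‖ :=
  tsum_weight_ne_top_iff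

theorem wnorm_powWeight_eq_ofReal {Φ : Loop} {r : ℝ≥0}
    (hs : Summable fun k : ℤ => (r : ℝ) ^ k.natAbs * ‖loopCoeff Φ k‖) :
    wnorm (powWeight r) Φ = ENNReal.ofReal (∑' k : ℤ, (r : ℝ) ^ k.natAbs * ‖loopCoeff Φ k‖) := by
  rw [ENNReal.ofReal_tsum_of_nonneg (fun _ => by positivity) hs, wnorm]
  refine tsum_congr fun k => ?_
  rw [ENNReal.ofReal_mul (by positivity), ofReal_norm, ENNReal.ofReal_pow r.coe_nonneg,
    ENNReal.ofReal_coe_nnreal, powWeight, ENNReal.coe_pow]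

theorem Loop.exists_wnorm_ne_top (Φ : Loop) : ∃ r : ℝ≥0, 1 < r ∧ wnorm (powWeight r) Φ ≠ ∞ := by
  obtain ⟨r, hr, h⟩ := Φ.exists_summable
  lift r to ℝ≥0 using by linarith
  exact ⟨r, by exact_mod_cast hr, wnorm_powWeight_ne_top_iff.2 h⟩

/-- The coefficients of each loop decay at some exponential rate, which beats a subexponential
weight. For `powWeight r` with r > 1, by contrast, the value may be infinite. -/
theorem wnorm_ne_top {v : ℕ → ℝ≥0} (hv : IsSubexp v) (Φ : Loop) : wnorm v Φ ≠ ∞ := by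
  obtain ⟨r, hr, h⟩ := Φ.exists_wnorm_ne_top
  obtain ⟨C, hC⟩ := hv r hr
  exact ne_top_of_le_ne_top (ENNReal.mul_ne_top ENNReal.coe_ne_top h)
    (wnorm_le_mul (w := powWeight r) hC Φ)

theorem wnorm_eq_zero {v : ℕ → ℝ≥0} (hv : IsWeight v) {Φ : Loop} (h : wnorm v Φ = 0) : Φ = 0 := by
  refine Loop.ext_coeff fun k => ?_
  have := enorm_coeff_le hv Φ k
  rw [h, nonpos_iff_eq_zero, enorm_eq_zero] at this
  rw [this, Loop.coeff_zero]

/-- The loop `z ↦ z ^ k • m`. -/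
noncomputable def Loop.monomial (k : ℤ) (m : M2) : Loop :=
  ⟨fun z => (z : ℂ) ^ k • m, fun z => z ^ k • m, fun i j z hz => by
    simp only [Matrix.smul_apply, smul_eq_mul]
    exact (analyticAt_id.zpow (by rintro rfl; simp at hz)).mul analyticAt_const, fun _ => rfl⟩

theorem Loop.monomial_apply (k : ℤ) (m : M2) (z : Circle) :
    Loop.monomial k m z = (z : ℂ) ^ k • m := rfl

theorem Loop.coeff_monomial (k : ℤ) (m : M2) :
    loopCoeff (Loop.monomial k m) = Pi.single k m := by
  refine loopCoeff_eq_of_hasSum ?_ fun z => ?_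
  · exact summable_of_ne_finset_zero (s := {k}) fun l hl => by
      simp [Pi.single_eq_of_ne (by simpa using hl : l ≠ k)]
  · have h : HasSum (fun l : ℤ => (z : ℂ) ^ l • (Pi.single k m : ℤ → M2) l)
        ((z : ℂ) ^ k • (Pi.single k m : ℤ → M2) k) :=
      hasSum_single k fun l hl => by rw [Pi.single_eq_of_ne hl, smul_zero]
    rw [Pi.single_eq_same] at h
    exact h

theorem Loop.one_eq_monomial : (1 : Loop) = Loop.monomial 0 1 :=
  Loop.ext fun z => by rw [Loop.one_apply, Loop.monomial_apply, zpow_zero, one_smul]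

theorem wnorm_monomial (v : ℕ → ℝ≥0) (k : ℤ) (m : M2) :
    wnorm v (Loop.monomial k m) = v k.natAbs * ‖m‖ₑ := by
  rw [wnorm, tsum_eq_single k, Loop.coeff_monomial, Pi.single_eq_same]
  intro l hl
  rw [Loop.coeff_monomial, Pi.single_eq_of_ne hl]
  simp

theorem Loop.coeff_one (k : ℤ) : loopCoeff (1 : Loop) k = if k = 0 then 1 else 0 := by
  rw [Loop.one_eq_monomial, Loop.coeff_monomial, Pi.single_apply]

theorem wnorm_one_le (v : ℕ → ℝ≥0) : wnorm v 1 ≤ v 0 := by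
  rw [Loop.one_eq_monomial, wnorm_monomial, Int.natAbs_zero, enorm_eq_nnnorm, nnnorm_one]
  simp

theorem Loop.coeff_sum {ι : Type*} (s : Finset ι) (f : ι → Loop) (k : ℤ) :
    loopCoeff (∑ i ∈ s, f i : Loop) k = ∑ i ∈ s, loopCoeff (f i) k := map_sum (Loop.coeffₗ k) f s

theorem wnorm_sub_sum_monomial (v : ℕ → ℝ≥0) (Φ : Loop) (s : Finset ℤ) :
    wnorm v (Φ - ∑ k ∈ s, Loop.monomial k (loopCoeff Φ k)) =
      ∑' k : {k // k ∉ s}, (v k.1.natAbs : ℝ≥0∞) * ‖loopCoeff Φ k.1‖ₑ := by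
  rw [wnorm, ← tsum_subtype_eq_of_support_subset (s := {k | k ∉ s})]
  · refine tsum_congr fun k => ?_
    have hk : k.1 ∉ s := k.2
    rw [Loop.coeff_sub, Loop.coeff_sum, Finset.sum_eq_zero, sub_zero]
    intro l hl
    rw [Loop.coeff_monomial, Pi.single_eq_of_ne]
    rintro h
    exact hk (h ▸ hl)
  · intro k hk hks
    refine hk ?_
    beta_reduce
    have hks : k ∈ s := by simpa using hks
    rw [Loop.coeff_sub, Loop.coeff_sum, Finset.sum_eq_single_of_mem k hks, Loop.coeff_monomial,
      Pi.single_eq_same, sub_self]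
    · simp
    intro l _ hl
    rw [Loop.coeff_monomial, Pi.single_eq_of_ne hl.symm]

end WeightedNorms

/-! ### The inductive limit topology in terms of weights. -/

section LoopTopology

open scoped Matrix.Norms.Operator ENNReal NNReal
open Filter

/-- The weighted norm as a seminorm. -/
noncomputable def weightSeminorm (v : ℕ → ℝ≥0) (hv : IsSubexp v) : Seminorm ℝ Loop :=
  Seminorm.of (fun Φ => (wnorm v Φ).toReal)
    (fun Φ Ψ => by
      rw [← ENNReal.toReal_add (wnorm_ne_top hv _) (wnorm_ne_top hv _)]
      exact ENNReal.toReal_mono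
        (ENNReal.add_ne_top.2 ⟨wnorm_ne_top hv _, wnorm_ne_top hv _⟩) (wnorm_add_le v Φ Ψ))
    (fun c Φ => by rw [wnorm_smul, ENNReal.toReal_mul, toReal_enorm])

theorem weightSeminorm_apply (v : ℕ → ℝ≥0) (hv : IsSubexp v) (Φ : Loop) :
    weightSeminorm v hv Φ = (wnorm v Φ).toReal := rfl

theorem norm_loopCoeff_le {Φ : Circle → M2} {g : ℂ → M2} {r M : ℝ} (hr : 1 ≤ r)
    (h : IsHolExt {z | r⁻¹ ≤ ‖z‖ ∧ ‖z‖ ≤ r} Φ g)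
    (hM : ∀ z : ℂ, r⁻¹ ≤ ‖z‖ → ‖z‖ ≤ r → ∀ i j, ‖g z i j‖ ≤ M) (k : ℤ) :
    ‖loopCoeff Φ k‖ ≤ 2 * (M * (r ^ k.natAbs)⁻¹) :=
  norm_le_two_mul fun i j => by
    rw [loopCoeff_apply_of_ext h.2]
    exact norm_laurentCoeff_le hr (h.1 i j) (fun z h1 h2 => hM z h1 h2 i j) k

theorem closedAnnulus_subset_annulus {s r : ℝ} (hs : 0 < s) (hsr : s < r) :
    {z : ℂ | s⁻¹ ≤ ‖z‖ ∧ ‖z‖ ≤ s} ⊆ annulus r := fun _ hz =>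
  ⟨(inv_strictAnti₀ hs hsr).trans_le hz.1, hz.2.trans_lt hsr⟩

/-- Choose 1 < t < s < r. Cauchy's estimate on the annulus of radius s gives coefficients of size M
s^(-|k|), the weight is at most C t^|k|, and the geometric series in t/s converges. -/
theorem admissible_weightSeminorm (v : ℕ → ℝ≥0) (hv : IsSubexp v) :
    Admissible (weightSeminorm v hv) := by
  intro r hr
  obtain ⟨s, hs1, hsr⟩ := exists_between hr
  obtain ⟨t, ht1, hts⟩ := exists_between hs1
  have hs0 : 0 < s := by linarith
  lift t to ℝ≥0 using by linarith
  obtain ⟨C, hC⟩ := hv t (by exact_mod_cast ht1)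
  have hsum := summable_pow_natAbs (r := t / s) (by positivity) ((div_lt_one hs0).2 hts)
  refine ⟨2 * C * ∑' k : ℤ, (t / s : ℝ) ^ k.natAbs, fun Φ g M hg hM => ?_⟩
  have hsub := closedAnnulus_subset_annulus hs0 hsr
  have hb := norm_loopCoeff_le (Φ := Φ) (M := M) hs1.le
    ⟨fun i j => (hg.1 i j).mono hsub, hg.2⟩ fun z h1 h2 => hM z (hsub ⟨h1, h2⟩)
  have hterm : ∀ k : ℤ, (v k.natAbs : ℝ) * ‖loopCoeff Φ k‖ ≤
      2 * C * M * (t / s : ℝ) ^ k.natAbs := fun k => by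
    have h1 : (v k.natAbs : ℝ) ≤ C * t ^ k.natAbs := by exact_mod_cast hC k.natAbs
    calc (v k.natAbs : ℝ) * ‖loopCoeff Φ k‖
        ≤ (C * t ^ k.natAbs) * (2 * (M * (s ^ k.natAbs)⁻¹)) :=
          mul_le_mul h1 (hb k) (norm_nonneg _) (by positivity)
      _ = _ := by rw [div_pow]; ring
  have hs2 : Summable fun k : ℤ => (v k.natAbs : ℝ) * ‖loopCoeff Φ k‖ :=
    (hsum.mul_left (2 * C * M)).of_nonneg_of_le (fun _ => by positivity) hterm
  have hw : (wnorm v Φ).toReal = ∑' k : ℤ, (v k.natAbs : ℝ) * ‖loopCoeff Φ k‖ := by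
    rw [wnorm, ENNReal.tsum_toReal_eq]
    · simp
    · intro k; exact ENNReal.mul_ne_top ENNReal.coe_ne_top enorm_ne_top
  rw [weightSeminorm_apply, hw]
  calc ∑' k : ℤ, (v k.natAbs : ℝ) * ‖loopCoeff Φ k‖
      ≤ ∑' k : ℤ, 2 * C * M * (t / s : ℝ) ^ k.natAbs :=
        hs2.tsum_le_tsum hterm (hsum.mul_left _)
    _ = _ := by rw [tsum_mul_left]; ring

/-- The supremum of the Laurent series over the annulus of radius r is at most the norm with weight
r^|k|, so admissibility applies whenever that norm is finite. -/
theorem Admissible.exists_le_powWeight {p : Seminorm ℝ Loop} (hp : Admissible p) {r : ℝ≥0}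
    (hr : 1 < r) :
    ∃ C : ℝ≥0, 1 ≤ C ∧ ∀ Φ, ENNReal.ofReal (p Φ) ≤ C * wnorm (powWeight r) Φ := by
  obtain ⟨C, hC⟩ := hp r (by exact_mod_cast hr)
  -- The given constant may be negative; a constant of at least 1 is needed for the infimum of these
  -- bounds to be a submultiplicative weight.
  refine ⟨max 1 C.toNNReal, le_max_left _ _, fun Φ => ?_⟩
  by_cases h : wnorm (powWeight r) Φ = ∞
  · rw [h, ENNReal.mul_top]
    · exact le_top
    · simp
  · have hs := wnorm_powWeight_ne_top_iff.1 h
    have hr0 : (0 : ℝ) < r := by exact_mod_cast one_pos.trans hr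
    have h1 := hC Φ (laurentSum (loopCoeff Φ)) _
      ⟨analyticOnNhd_laurentSum hr0 hs, fun z => Φ.laurentSum_coeff z⟩
      fun z hz => norm_laurentSum_apply_le hr0 hs hz
    rw [wnorm_powWeight_eq_ofReal hs]
    set S := ∑' k : ℤ, (r : ℝ) ^ k.natAbs * ‖loopCoeff Φ k‖
    have hS : 0 ≤ S := tsum_nonneg fun _ => by positivity
    rw [← ENNReal.ofReal_coe_nnreal, ← ENNReal.ofReal_mul (by positivity)]
    refine ENNReal.ofReal_le_ofReal (h1.trans ?_)
    gcongr
    push_cast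
    exact (Real.le_coe_toNNReal C).trans (le_max_right _ _)

/-- Every admissible seminorm is dominated by a weighted norm with a submultiplicative
subexponential weight. -/
theorem Admissible.exists_weight {p : Seminorm ℝ Loop} (hp : Admissible p) :
    ∃ v, IsWeight v ∧ IsSubexp v ∧ ∀ Φ, ENNReal.ofReal (p Φ) ≤ wnorm v Φ := by
  choose C hC1 hC using fun r : {r : ℝ≥0 // 1 < r} => hp.exists_le_powWeight r.2
  have : Nonempty {r : ℝ≥0 // 1 < r} := ⟨⟨2, one_lt_two⟩⟩
  -- The lower envelope of all available exponential bounds: subexponential because it lies below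
  -- each of them.
  let v : ℕ → ℝ≥0 := fun n => ⨅ r : {r : ℝ≥0 // 1 < r}, C r * r.1 ^ n
  have hv_le : ∀ n r, v n ≤ C r * r.1 ^ n := fun n r => ciInf_le' _ _
  have hvw : IsWeight v := by
    refine ⟨fun n => le_ciInf fun r => one_le_mul (hC1 r) (one_le_pow₀ r.2.le), fun m n hmn =>
      ciInf_mono (OrderBot.bddBelow _) fun r => ?_, fun m n =>
      NNReal.le_iInf_mul_iInf fun r s => ?_⟩
    · gcongr
      exact r.2.le
    -- The mixed product of the bounds for r and s dominates the bound for the smaller radius; the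
    -- surplus constant is at least 1.
    · rcases le_total r s with h | h
      · have h' : r.1 ≤ s.1 := h
        calc v (m + n) ≤ C r * r.1 ^ (m + n) := hv_le _ r
          _ = C r * r.1 ^ m * (1 * r.1 ^ n) := by ring
          _ ≤ C r * r.1 ^ m * (C s * s.1 ^ n) := by gcongr; exact hC1 s
      · have h' : s.1 ≤ r.1 := h
        calc v (m + n) ≤ C s * s.1 ^ (m + n) := hv_le _ s
          _ = (1 * s.1 ^ m) * (C s * s.1 ^ n) := by ring
          _ ≤ C r * r.1 ^ m * (C s * s.1 ^ n) := by gcongr; exact hC1 r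
  refine ⟨v, hvw, fun r hr => ⟨C ⟨r, hr⟩, fun n => hv_le n ⟨r, hr⟩⟩, fun Φ => ?_⟩
  -- A monomial has finite norm for every r, so all bounds hold for it simultaneously and the
  -- infimum may be taken.
  have hmono : ∀ k m, ENNReal.ofReal (p (Loop.monomial k m)) ≤ v k.natAbs * ‖m‖ₑ := by
    intro k m
    by_cases hm : m = 0
    · have : Loop.monomial k m = 0 := Loop.ext fun z => by
        rw [Loop.monomial_apply, hm, smul_zero]; rfl
      simp [this]
    · have hm0 : ‖m‖₊ ≠ 0 := by simpa using hm
      rw [enorm_eq_nnnorm, ← ENNReal.coe_mul, ENNReal.ofReal, ENNReal.coe_le_coe,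
        ← div_le_iff₀ (pos_iff_ne_zero.2 hm0)]
      refine le_ciInf fun r => ?_
      rw [div_le_iff₀ (pos_iff_ne_zero.2 hm0)]
      have := hC r (Loop.monomial k m)
      rw [wnorm_monomial, enorm_eq_nnnorm, ENNReal.ofReal, powWeight] at this
      rw [mul_assoc]
      exact_mod_cast this
  obtain ⟨r, hr, hrΦ⟩ := Φ.exists_wnorm_ne_top
  -- A Laurent polynomial part of Φ costs at most `wnorm v Φ`. The remainder is bounded through one
  -- radius at which Φ has finite norm, and it tends to zero.
  have hlim := (ENNReal.Tendsto.const_mul (a := C ⟨r, hr⟩)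
    (ENNReal.tendsto_tsum_compl_atTop_zero hrΦ) (.inr ENNReal.coe_ne_top)).add_const (wnorm v Φ)
  rw [mul_zero, zero_add] at hlim
  refine ge_of_tendsto' hlim fun s => ?_
  rw [← wnorm_sub_sum_monomial]
  set Ψ := ∑ k ∈ s, Loop.monomial k (loopCoeff Φ k) with hΨ
  have h1 : p Φ ≤ p (Φ - Ψ) + ∑ k ∈ s, p (Loop.monomial k (loopCoeff Φ k)) := by
    calc p Φ = p ((Φ - Ψ) + Ψ) := by rw [sub_add_cancel]
      _ ≤ p (Φ - Ψ) + p Ψ := map_add_le_add p _ _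
      _ ≤ _ := by gcongr; exact Finset.le_sum_of_subadditive p (map_zero p).le (map_add_le_add p) _ _
  refine (ENNReal.ofReal_le_ofReal h1).trans ?_
  rw [ENNReal.ofReal_add (apply_nonneg _ _) (Finset.sum_nonneg fun _ _ => apply_nonneg _ _),
    ENNReal.ofReal_sum_of_nonneg fun _ _ => apply_nonneg _ _]
  refine add_le_add (hC ⟨r, hr⟩ _) ?_
  refine (Finset.sum_le_sum fun k _ => hmono k _).trans ?_
  exact ENNReal.sum_le_tsum s

theorem admissible_sum (s : Finset {p : Seminorm ℝ Loop // Admissible p}) :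
    Admissible (∑ p ∈ s, p.1) := by
  intro r hr
  choose C hC using fun p : {p : Seminorm ℝ Loop // Admissible p} => p.2 r hr
  refine ⟨∑ p ∈ s, C p, fun Φ g M hg hM => ?_⟩
  have h : (∑ p ∈ s, p.1) Φ = ∑ p ∈ s, p.1 Φ := by
    classical
    induction s using Finset.induction_on with
    | empty => simp
    | insert a s ha ih => rw [Finset.sum_insert ha, Finset.sum_insert ha, ← ih]; rfl
  rw [h, Finset.sum_mul]
  exact Finset.sum_le_sum fun p _ => hC p Φ g M hg hM

/-- A finite supremum of admissible seminorms is below their sum, which is admissible and hence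
dominated by a single weighted norm. -/
theorem Loop.mem_nhds_iff {U : Set Loop} {a : Loop} :
    U ∈ 𝓝 a ↔ ∃ v, IsWeight v ∧ IsSubexp v ∧ ∃ ε : ℝ≥0∞, 0 < ε ∧
      {x | wnorm v (x - a) < ε} ⊆ U := by
  rw [loop_withSeminorms.mem_nhds_iff]
  constructor
  · rintro ⟨s, r, hr, h⟩
    obtain ⟨v, hv, hv', hle⟩ := (admissible_sum s).exists_weight
    refine ⟨v, hv, hv', ENNReal.ofReal r, ENNReal.ofReal_pos.2 hr, fun x hx => h ?_⟩
    rw [Seminorm.mem_ball]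
    refine ((Seminorm.finset_sup_le_sum loopSeminorms s) (x - a)).trans_lt ?_
    exact (ENNReal.ofReal_lt_ofReal_iff hr).1 ((hle _).trans_lt hx)
  · rintro ⟨v, hv, hv', ε, hε, h⟩
    -- Since ε may be infinite, a finite radius below it is needed to pass to real numbers.
    obtain ⟨δ, hδ, hδε⟩ := exists_between hε
    have hδt : δ ≠ ∞ := hδε.ne_top
    refine ⟨{⟨weightSeminorm v hv', admissible_weightSeminorm v hv'⟩}, δ.toReal,
      ENNReal.toReal_pos hδ.ne' hδt, fun x hx => h ?_⟩
    rw [Finset.sup_singleton, Seminorm.mem_ball] at hx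
    exact ((ENNReal.toReal_lt_toReal (wnorm_ne_top hv' _) hδt).1 hx).trans hδε

theorem Loop.tendsto_nhds_iff {α : Type*} {l : Filter α} {f : α → Loop} {a : Loop} :
    Tendsto f l (𝓝 a) ↔
      ∀ v, IsWeight v → IsSubexp v → Tendsto (fun x => wnorm v (f x - a)) l (𝓝 0) := by
  constructor
  · intro h v hv hv'
    rw [ENNReal.tendsto_nhds_zero]
    intro ε hε
    have := h (Loop.mem_nhds_iff.2 ⟨v, hv, hv', ε, hε, subset_rfl⟩)
    filter_upwards [this] with x hx using le_of_lt hx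
  · intro h U hU
    obtain ⟨v, hv, hv', ε, hε, hs⟩ := Loop.mem_nhds_iff.1 hU
    exact ((h v hv hv').eventually (gt_mem_nhds hε)).mono fun x hx => hs hx

theorem Loop.tendsto_wnorm_sub {v : ℕ → ℝ≥0} (hv : IsWeight v) (hv' : IsSubexp v) (a : Loop) :
    Tendsto (fun x => wnorm v (x - a)) (𝓝 a) (𝓝 0) :=
  Loop.tendsto_nhds_iff.1 tendsto_id v hv hv'

/-- Joint continuity is not automatic in an inductive limit. Here it follows from the
submultiplicativity of the defining norms, by expanding xy - ab around (a, b). -/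
theorem Loop.continuousMul : ContinuousMul Loop := ⟨by
  rw [continuous_iff_continuousAt]
  rintro ⟨a, b⟩
  refine Loop.tendsto_nhds_iff.2 fun v hv hv' => ?_
  have h1 : Tendsto (fun x : Loop × Loop => wnorm v (x.1 - a)) (𝓝 (a, b)) (𝓝 0) :=
    (Loop.tendsto_wnorm_sub hv hv' a).comp continuousAt_fst
  have h2 : Tendsto (fun x : Loop × Loop => wnorm v (x.2 - b)) (𝓝 (a, b)) (𝓝 0) :=
    (Loop.tendsto_wnorm_sub hv hv' b).comp continuousAt_snd
  have h3 := ((ENNReal.Tendsto.mul h1 (.inr ENNReal.zero_ne_top) h2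
    (.inr ENNReal.zero_ne_top)).add
    (ENNReal.Tendsto.const_mul h2 (.inr (wnorm_ne_top hv' a)))).add
    (ENNReal.Tendsto.mul_const h1 (.inr (wnorm_ne_top hv' b)))
  simp only [mul_zero, zero_mul, add_zero] at h3
  refine tendsto_of_tendsto_of_tendsto_of_le_of_le tendsto_const_nhds h3 (fun _ => zero_le)
    fun x => ?_
  have : x.1 * x.2 - a * b = (x.1 - a) * (x.2 - b) + a * (x.2 - b) + (x.1 - a) * b := by
    noncomm_ring
  dsimp only
  rw [this]
  refine (wnorm_add_le _ _ _).trans (add_le_add ((wnorm_add_le _ _ _).trans ?_)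
    (wnorm_mul_le hv _ _))
  exact add_le_add (wnorm_mul_le hv _ _) (wnorm_mul_le hv _ _)⟩

attribute [local instance] Loop.continuousMul

theorem Loop.isTopologicalRing : IsTopologicalRing Loop where

attribute [local instance] Loop.isTopologicalRing

theorem Loop.continuous_of_wnorm_le (L : Loop →ₗ[ℝ] Loop) (C : ℝ≥0)
    (h : ∀ v Φ, wnorm v (L Φ) ≤ C * wnorm v Φ) : Continuous L := by
  rw [continuous_iff_continuousAt]
  intro a
  refine Loop.tendsto_nhds_iff.2 fun v hv hv' => ?_
  have h1 := ENNReal.Tendsto.const_mul (a := C) (Loop.tendsto_wnorm_sub hv hv' a)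
    (.inr ENNReal.coe_ne_top)
  rw [mul_zero] at h1
  refine tendsto_of_tendsto_of_tendsto_of_le_of_le tendsto_const_nhds h1 (fun _ => zero_le)
    fun x => ?_
  dsimp only
  rw [← map_sub]
  exact h v _

theorem Loop.continuous_of_enorm_le {E : Type*} [NormedAddCommGroup E] [Module ℝ E]
    (L : Loop →ₗ[ℝ] E) (h : ∀ Φ, ‖L Φ‖ₑ ≤ wnorm (powWeight 1) Φ) : Continuous L := by
  rw [continuous_iff_continuousAt]
  intro a
  rw [ContinuousAt, tendsto_iff_edist_tendsto_0]
  refine tendsto_of_tendsto_of_tendsto_of_le_of_le tendsto_const_nhds (Loop.tendsto_wnorm_sub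
    (isWeight_powWeight le_rfl) isSubexp_powWeight_one a) (fun _ => zero_le) fun x => ?_
  dsimp only
  rw [edist_eq_enorm_sub, ← map_sub]
  exact h _

/-- A fixed Laurent coefficient, as a continuous linear map. -/
noncomputable def Loop.coeffL (k : ℤ) : Loop →L[ℝ] M2 :=
  ⟨Loop.coeffₗ k, Loop.continuous_of_enorm_le _ fun Φ =>
    enorm_coeff_le (isWeight_powWeight le_rfl) Φ k⟩

theorem Loop.coeffL_apply (k : ℤ) (Φ : Loop) : Loop.coeffL k Φ = loopCoeff Φ k := rfl

instance : T2Space Loop :=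
  T2Space.of_injective_continuous (f := fun (Φ : Loop) (k : ℤ) => Loop.coeffL k Φ)
    (fun _ _ h => Loop.ext_coeff fun k => congrFun h k)
    (continuous_pi fun k => (Loop.coeffL k).continuous)

/-- Only coefficientwise convergence is required, so the bound is available before convergence in
`Loop` is known. -/
theorem wnorm_le_tsum_of_hasSum {ι : Type*} {y : ι → Loop} {Y : Loop}
    (h : ∀ k, HasSum (fun n => loopCoeff (y n) k) (loopCoeff Y k)) (v : ℕ → ℝ≥0) :
    wnorm v Y ≤ ∑' n, wnorm v (y n) := by
  simp only [wnorm]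
  rw [ENNReal.tsum_comm]
  refine ENNReal.tsum_le_tsum fun k => ?_
  rw [ENNReal.tsum_mul_left]
  gcongr
  exact enorm_tsum_le (h k)

theorem Loop.wnorm_le_of_hasSum {ι : Type*} {y : ι → Loop} {Y : Loop} (h : HasSum y Y)
    (v : ℕ → ℝ≥0) : wnorm v Y ≤ ∑' n, wnorm v (y n) :=
  wnorm_le_tsum_of_hasSum (fun k => (Loop.coeffL k).hasSum h) v

/-- A series of loops which converges absolutely for an exponential weight converges. -/
theorem Loop.summable_of_wnorm {ι : Type*} {y : ι → Loop} {r : ℝ≥0} (hr : 1 < r)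
    (h : ∑' n, wnorm (powWeight r) (y n) ≠ ∞) : Summable y := by
  have hk : ∀ k, Summable fun n => loopCoeff (y n) k := fun k => by
    refine Summable.of_nnnorm (ENNReal.tsum_coe_ne_top_iff_summable.1 (ne_top_of_le_ne_top h ?_))
    exact ENNReal.tsum_le_tsum fun n => enorm_coeff_le (isWeight_powWeight hr.le) _ k
  have hb : ∑' k : ℤ, (powWeight r k.natAbs : ℝ≥0∞) * ‖∑' n, loopCoeff (y n) k‖ₑ ≠ ∞ := by
    refine ne_top_of_le_ne_top h ?_
    simp only [wnorm]
    rw [ENNReal.tsum_comm]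
    refine ENNReal.tsum_le_tsum fun k => ?_
    rw [ENNReal.tsum_mul_left]
    gcongr
    exact enorm_tsum_le (hk k).hasSum
  -- The candidate limit is assembled coefficientwise. The finite norm at radius r makes it an
  -- analytic loop, and tails measured at radius r dominate tails in every subexponential weight.
  let Y := Loop.ofCoeff (fun k => ∑' n, loopCoeff (y n) k)
    ⟨r, by exact_mod_cast hr, tsum_weight_ne_top_iff.1 hb⟩
  have hY : ∀ k, loopCoeff Y k = ∑' n, loopCoeff (y n) k := fun k => by
    rw [Loop.coeff_ofCoeff]
  refine ⟨Y, Loop.tendsto_nhds_iff.2 fun v hv hv' => ?_⟩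
  obtain ⟨C, hC⟩ := hv' r hr
  have hlim := ENNReal.Tendsto.const_mul (a := C)
    (ENNReal.tendsto_tsum_compl_atTop_zero h) (.inr ENNReal.coe_ne_top)
  rw [mul_zero] at hlim
  refine tendsto_of_tendsto_of_tendsto_of_le_of_le tendsto_const_nhds hlim (fun _ => zero_le)
    fun s => ?_
  dsimp only
  refine (wnorm_le_mul (w := powWeight r) hC _).trans ?_
  gcongr
  rw [wnorm_sub_comm]
  refine wnorm_le_tsum_of_hasSum (fun k => ?_) _
  rw [Loop.coeff_sub, hY, Loop.coeff_sum]
  have h1 := (hk k).hasSum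
  refine (Finset.hasSum_compl_iff (f := fun n => loopCoeff (y n) k) s).2 ?_
  rwa [sub_add_cancel]

end LoopTopology

attribute [local instance] Loop.continuousMul Loop.isTopologicalRing

/-! ### Truncations of Laurent series and one-sided supports. -/

section Support

open scoped Matrix.Norms.Operator ENNReal NNReal
open Filter

theorem Loop.exists_summable_indicator (S : Set ℤ) (Φ : Loop) : ∃ r : ℝ, 1 < r ∧
    Summable fun k : ℤ => r ^ k.natAbs * ‖S.indicator (loopCoeff Φ) k‖ := by
  obtain ⟨r, hr, h⟩ := Φ.exists_summable
  refine ⟨r, hr, h.of_nonneg_of_le (fun k => by positivity) fun k => ?_⟩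
  gcongr
  exact norm_indicator_le_norm_self _ _

/-- Truncation of the Laurent series to the exponents in `S`. -/
noncomputable def Loop.restrictₗ (S : Set ℤ) : Loop →ₗ[ℝ] Loop where
  toFun Φ := Loop.ofCoeff (S.indicator (loopCoeff Φ)) (Φ.exists_summable_indicator S)
  map_add' Φ Ψ := Loop.ext_coeff fun k => by
    rw [Loop.coeff_add, Loop.coeff_ofCoeff, Loop.coeff_ofCoeff, Loop.coeff_ofCoeff]
    by_cases hk : k ∈ S <;> simp [hk, Loop.coeff_add]
  map_smul' c Φ := Loop.ext_coeff fun k => by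
    rw [RingHom.id_apply, Loop.coeff_smul, Loop.coeff_ofCoeff, Loop.coeff_ofCoeff]
    by_cases hk : k ∈ S <;> simp [hk, Loop.coeff_smul]

theorem Loop.coeff_restrictₗ (S : Set ℤ) (Φ : Loop) :
    loopCoeff (Loop.restrictₗ S Φ) = S.indicator (loopCoeff Φ) :=
  Loop.coeff_ofCoeff (Φ.exists_summable_indicator S)

theorem Loop.wnorm_restrictₗ_le (S : Set ℤ) (v : ℕ → ℝ≥0) (Φ : Loop) :
    wnorm v (Loop.restrictₗ S Φ) ≤ wnorm v Φ := by
  refine ENNReal.tsum_le_tsum fun k => ?_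
  rw [Loop.coeff_restrictₗ]
  gcongr
  simp only [enorm_eq_nnnorm, ENNReal.coe_le_coe]
  exact norm_indicator_le_norm_self _ _

/-- Truncation of the Laurent series to the exponents in `S`, as a continuous linear map. -/
noncomputable def Loop.restrict (S : Set ℤ) : Loop →L[ℝ] Loop :=
  ⟨Loop.restrictₗ S, Loop.continuous_of_wnorm_le _ 1 fun v Φ => by
    simpa using Loop.wnorm_restrictₗ_le S v Φ⟩

theorem Loop.coeff_restrict (S : Set ℤ) (Φ : Loop) :
    loopCoeff (Loop.restrict S Φ) = S.indicator (loopCoeff Φ) := Loop.coeff_restrictₗ S Φ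

theorem Loop.wnorm_restrict_le (S : Set ℤ) (v : ℕ → ℝ≥0) (Φ : Loop) :
    wnorm v (Loop.restrict S Φ) ≤ wnorm v Φ := Loop.wnorm_restrictₗ_le S v Φ

theorem Loop.restrict_univ (Φ : Loop) : Loop.restrict Set.univ Φ = Φ :=
  Loop.ext_coeff fun k => by rw [Loop.coeff_restrict, Set.indicator_univ]

/-- All Laurent coefficients with exponent outside `S` vanish. -/
def Loop.SupportedIn (S : Set ℤ) (Φ : Loop) : Prop := ∀ k ∉ S, loopCoeff Φ k = 0

theorem Loop.SupportedIn.mul {S T U : Set ℤ} (h : ∀ i ∈ S, ∀ j ∈ T, i + j ∈ U) {Φ Ψ : Loop}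
    (hΦ : Φ.SupportedIn S) (hΨ : Ψ.SupportedIn T) : (Φ * Ψ).SupportedIn U := by
  intro k hk
  refine (Φ.hasSum_coeff_mul Ψ k).unique ?_
  convert hasSum_zero with j
  by_cases hj : j ∈ S
  · rw [hΨ (k - j) fun h' => hk (by simpa using h j hj _ h'), mul_zero]
  · rw [hΦ j hj, zero_mul]

theorem Loop.SupportedIn.mono {S T : Set ℤ} (h : S ⊆ T) {Φ : Loop} (hΦ : Φ.SupportedIn S) :
    Φ.SupportedIn T := fun k hk => hΦ k fun h' => hk (h h')

theorem Loop.SupportedIn.add {S : Set ℤ} {Φ Ψ : Loop} (hΦ : Φ.SupportedIn S)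
    (hΨ : Ψ.SupportedIn S) : (Φ + Ψ).SupportedIn S := fun k hk => by
  rw [Loop.coeff_add, hΦ k hk, hΨ k hk, add_zero]

theorem Loop.SupportedIn.neg {S : Set ℤ} {Φ : Loop} (hΦ : Φ.SupportedIn S) :
    (-Φ).SupportedIn S := fun k hk => by
  rw [Loop.coeff_neg, hΦ k hk, neg_zero]

theorem Loop.supportedIn_monomial {S : Set ℤ} {k : ℤ} (hk : k ∈ S) (m : M2) :
    (Loop.monomial k m).SupportedIn S := fun l hl => by
  rw [Loop.coeff_monomial, Pi.single_eq_of_ne]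
  rintro rfl
  exact hl hk

theorem Loop.supportedIn_one {S : Set ℤ} (hS : 0 ∈ S) : (1 : Loop).SupportedIn S := by
  rw [Loop.one_eq_monomial]
  exact Loop.supportedIn_monomial hS 1

theorem Loop.supportedIn_restrict (S : Set ℤ) (Φ : Loop) : (Loop.restrict S Φ).SupportedIn S :=
  fun k hk => by rw [Loop.coeff_restrict, Set.indicator_of_notMem hk]

theorem Loop.SupportedIn.restrict_eq {S : Set ℤ} {Φ : Loop} (h : Φ.SupportedIn S) :
    Loop.restrict S Φ = Φ := Loop.ext_coeff fun k => by
  rw [Loop.coeff_restrict]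
  by_cases hk : k ∈ S
  · rw [Set.indicator_of_mem hk]
  · rw [Set.indicator_of_notMem hk, h k hk]

theorem Loop.SupportedIn.restrict_compl {S : Set ℤ} {Φ : Loop} (h : Φ.SupportedIn Sᶜ) :
    Loop.restrict S Φ = 0 := Loop.ext_coeff fun k => by
  rw [Loop.coeff_restrict, Loop.coeff_zero]
  by_cases hk : k ∈ S
  · rw [Set.indicator_of_mem hk, h k (by simpa using hk)]
  · rw [Set.indicator_of_notMem hk]

theorem Loop.supportedIn_compl_of_restrict_eq_zero {S : Set ℤ} {Φ : Loop}
    (h : Loop.restrict S Φ = 0) : Φ.SupportedIn Sᶜ := fun k hk => by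
  have hk : k ∈ S := by simpa using hk
  rw [← Set.indicator_of_mem hk (loopCoeff Φ), ← Loop.coeff_restrict, h, Loop.coeff_zero]

/-- By dominated convergence the norm at radius r tends to the Wiener norm as r ↓ 1. This turns
smallness in the Wiener norm into smallness on some actual annulus. -/
theorem Loop.exists_wnorm_lt {h : Loop} {ε : ℝ≥0∞} (hh : wnorm (powWeight 1) h < ε) :
    ∃ r : ℝ≥0, 1 < r ∧ wnorm (powWeight r) h < ε := by
  obtain ⟨r₀, hr₀, hr₀h⟩ := h.exists_wnorm_ne_top
  have hs₀ := wnorm_powWeight_ne_top_iff.1 hr₀h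
  have hbd : ∀ r : ℝ, 0 ≤ r → r ≤ r₀ → ∀ k : ℤ,
      ‖r ^ k.natAbs * ‖loopCoeff h k‖‖ ≤ (r₀ : ℝ) ^ k.natAbs * ‖loopCoeff h k‖ := by
    intro r h0 hr k
    rw [Real.norm_of_nonneg (by positivity)]
    gcongr
  have hr₀' : (1 : ℝ) < r₀ := by exact_mod_cast hr₀
  have hnear : ∀ᶠ r : ℝ in 𝓝[>] 1, 1 < r ∧ r ≤ r₀ :=
    Filter.inter_mem self_mem_nhdsWithin
      (mem_nhdsWithin_of_mem_nhds (Iic_mem_nhds hr₀'))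
  have hlim : Tendsto (fun r : ℝ => ∑' k : ℤ, r ^ k.natAbs * ‖loopCoeff h k‖) (𝓝[>] 1)
      (𝓝 (∑' k : ℤ, (1 : ℝ) ^ k.natAbs * ‖loopCoeff h k‖)) := by
    refine tendsto_tsum_of_dominated_convergence hs₀ (fun k => ?_) ?_
    · refine Tendsto.mono_left ?_ nhdsWithin_le_nhds
      exact ((continuous_pow _).mul continuous_const).tendsto _
    · exact hnear.mono fun r hr => hbd r (by linarith [hr.1]) hr.2
  have h1 := wnorm_powWeight_eq_ofReal (Φ := h) (r := 1) (by
    simpa using h.summable_norm_coeff)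
  have hlim' := (ENNReal.continuous_ofReal.tendsto _).comp hlim
  rw [NNReal.coe_one] at h1
  rw [← h1] at hlim'
  obtain ⟨r, hr, hr1, hr2⟩ := ((hlim'.eventually (gt_mem_nhds hh)).and hnear).exists
  lift r to ℝ≥0 using by linarith
  refine ⟨r, by exact_mod_cast hr1, ?_⟩
  rwa [wnorm_powWeight_eq_ofReal]
  exact hs₀.of_nonneg_of_le (fun _ => by positivity) fun k =>
    (le_abs_self _).trans (hbd r r.2 hr2 k)

end Support

/-! ### The Neumann series for the equation X + P(hX) = 1. -/

section Neumann

open scoped Matrix.Norms.Operator ENNReal NNReal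
open Filter

/-- The series whose `n`-th term is `T h₁ (T h₂ (⋯ (T hₙ 1)))`, where `T h Ψ` is the truncation of
`-hΨ` to the exponents in `S`. -/
noncomputable def neumannSeries (S : Set ℤ) : FormalMultilinearSeries ℝ Loop Loop
  | 0 => ContinuousMultilinearMap.constOfIsEmpty ℝ _ 1
  | n + 1 =>
    { toFun := fun m => -Loop.restrict S (m 0 * neumannSeries S n (Fin.tail m))
      map_update_add' := by
        intro inst m i x y
        cases Subsingleton.elim inst (instDecidableEqFin (n + 1))
        cases i using Fin.cases with
        | zero => simp only [Fin.tail_update_zero, Function.update_self, add_mul, map_add, neg_add]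
        | succ i =>
          simp only [Fin.tail_update_succ, ContinuousMultilinearMap.map_update_add,
            Function.update_of_ne (Fin.succ_ne_zero i).symm, mul_add, map_add, neg_add]
      map_update_smul' := by
        intro inst m i c x
        cases Subsingleton.elim inst (instDecidableEqFin (n + 1))
        cases i using Fin.cases with
        | zero =>
          simp only [Fin.tail_update_zero, Function.update_self, smul_mul_assoc, map_smul, smul_neg]
        | succ i =>
          simp only [Fin.tail_update_succ, ContinuousMultilinearMap.map_update_smul,
            Function.update_of_ne (Fin.succ_ne_zero i).symm, mul_smul_comm, map_smul, smul_neg]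
      cont := by
        refine ((Loop.restrict S).continuous.comp ((continuous_apply 0).mul
          ((neumannSeries S n).cont.comp ?_))).neg
        exact continuous_pi fun i => continuous_apply _ }

theorem neumannSeries_zero (S : Set ℤ) (m : Fin 0 → Loop) : neumannSeries S 0 m = 1 := rfl

theorem neumannSeries_succ (S : Set ℤ) (n : ℕ) (m : Fin (n + 1) → Loop) :
    neumannSeries S (n + 1) m = -Loop.restrict S (m 0 * neumannSeries S n (Fin.tail m)) := rfl

theorem wnorm_neumannSeries_le (S : Set ℤ) {v : ℕ → ℝ≥0} (hv : IsWeight v) (n : ℕ)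
    (m : Fin n → Loop) : wnorm v (neumannSeries S n m) ≤ v 0 * ∏ i, wnorm v (m i) := by
  induction n with
  | zero => simpa [neumannSeries_zero] using wnorm_one_le v
  | succ n ih =>
    rw [neumannSeries_succ, wnorm_neg, Fin.prod_univ_succ, mul_left_comm]
    refine (Loop.wnorm_restrict_le S v _).trans ((wnorm_mul_le hv _ _).trans ?_)
    gcongr
    exact ih _

theorem wnorm_neumannSeries_diag_le (S : Set ℤ) {v : ℕ → ℝ≥0} (hv : IsWeight v) (n : ℕ)
    (h : Loop) : wnorm v (neumannSeries S n fun _ => h) ≤ v 0 * wnorm v h ^ n := by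
  simpa using wnorm_neumannSeries_le S hv n fun _ => h

theorem tsum_wnorm_neumannSeries_ne_top (S : Set ℤ) {v : ℕ → ℝ≥0} (hv : IsWeight v) {h : Loop}
    (hh : wnorm v h < 1) : ∑' n, wnorm v (neumannSeries S n fun _ => h) ≠ ∞ := by
  refine ne_top_of_le_ne_top ?_
    (ENNReal.tsum_le_tsum fun n => wnorm_neumannSeries_diag_le S hv n h)
  rw [ENNReal.tsum_mul_left, ENNReal.tsum_geometric]
  refine ENNReal.mul_ne_top ENNReal.coe_ne_top (ENNReal.inv_ne_top.2 ?_)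
  exact (tsub_pos_of_lt hh).ne'

/-- The solution `X` of `X + P (h X) = 1`, where `P` is the truncation to the exponents in `S`. -/
noncomputable def neumannSum (S : Set ℤ) (h : Loop) : Loop :=
  ∑' n, neumannSeries S n fun _ => h

/-- The norm of h stays below 1 at some radius r > 1. There the series is dominated by a geometric
one, and absolute convergence at such a radius implies convergence in `Loop`. -/
theorem hasSum_neumannSum (S : Set ℤ) {h : Loop} (hh : wnorm (powWeight 1) h < 1) :
    HasSum (fun n => neumannSeries S n fun _ => h) (neumannSum S h) := by
  obtain ⟨r, hr, hrh⟩ := Loop.exists_wnorm_lt hh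
  exact (Loop.summable_of_wnorm hr
    (tsum_wnorm_neumannSeries_ne_top S (isWeight_powWeight hr.le) hrh)).hasSum

theorem neumannSum_eq (S : Set ℤ) {h : Loop} (hh : wnorm (powWeight 1) h < 1) :
    neumannSum S h = 1 - Loop.restrict S (h * neumannSum S h) := by
  have h1 := hasSum_neumannSum S hh
  have h2 : HasSum (fun n => neumannSeries S (n + 1) fun _ => h)
      (-Loop.restrict S (h * neumannSum S h)) :=
    ((Loop.restrict S).hasSum (h1.mul_left h)).neg
  have h3 := (hasSum_nat_add_iff' 1).2 h1
  rw [Finset.sum_range_one, neumannSeries_zero] at h3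
  rw [sub_eq_add_neg, ← h3.unique h2, add_sub_cancel]

theorem wnorm_neumannSum_sub_one_le (S : Set ℤ) {v : ℕ → ℝ≥0} (hv : IsWeight v) {h : Loop}
    (hh : wnorm (powWeight 1) h < 1) :
    wnorm v (neumannSum S h - 1) ≤ v 0 * (wnorm v h * (1 - wnorm v h)⁻¹) := by
  have h3 := (hasSum_nat_add_iff' 1).2 (hasSum_neumannSum S hh)
  rw [Finset.sum_range_one, neumannSeries_zero] at h3
  refine (Loop.wnorm_le_of_hasSum h3 v).trans ?_
  refine (ENNReal.tsum_le_tsum fun n => wnorm_neumannSeries_diag_le S hv (n + 1) h).trans_eq ?_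
  simp_rw [pow_succ']
  rw [ENNReal.tsum_mul_left, ENNReal.tsum_mul_left, ENNReal.tsum_geometric]

/-- Truncation does not increase norms, so D ↦ -P(hD) is a strict contraction in the Wiener norm. -/
theorem eq_zero_of_eq_neg_restrict {S : Set ℤ} {h D : Loop} (hh : wnorm (powWeight 1) h < 1)
    (hD : D = -Loop.restrict S (h * D)) : D = 0 := by
  have hw : IsWeight (powWeight 1) := isWeight_powWeight le_rfl
  refine wnorm_eq_zero hw ?_
  by_contra h0
  have h1 : wnorm (powWeight 1) D ≤ wnorm (powWeight 1) h * wnorm (powWeight 1) D := by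
    conv_lhs => rw [hD, wnorm_neg]
    exact (Loop.wnorm_restrict_le _ _ _).trans (wnorm_mul_le hw _ _)
  have h2 := ENNReal.mul_lt_mul_left h0 (wnorm_ne_top isSubexp_powWeight_one D) hh
  rw [one_mul] at h2
  exact absurd h1 (not_le.2 h2)

theorem eq_neumannSum {S : Set ℤ} {h X : Loop} (hh : wnorm (powWeight 1) h < 1)
    (hX : X = 1 - Loop.restrict S (h * X)) : X = neumannSum S h := by
  rw [← sub_eq_zero]
  refine eq_zero_of_eq_neg_restrict hh (S := S) ?_
  conv_lhs => rw [hX, neumannSum_eq S hh]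
  rw [mul_sub, map_sub]
  abel

theorem neumannSum_zero (S : Set ℤ) : neumannSum S 0 = 1 :=
  (eq_neumannSum (by simp [wnorm_zero]) (by simp)).symm

theorem continuousAt_neumannSum_zero (S : Set ℤ) : ContinuousAt (neumannSum S) 0 := by
  rw [ContinuousAt, neumannSum_zero]
  refine Loop.tendsto_nhds_iff.2 fun v hv hv' => ?_
  have h1 : Tendsto (fun h => wnorm v h) (𝓝 0) (𝓝 0) := by
    simpa using Loop.tendsto_wnorm_sub hv hv' 0
  have h2 : Tendsto (fun h => (v 0 : ℝ≥0∞) * (wnorm v h * (1 - wnorm v h)⁻¹)) (𝓝 0) (𝓝 0) := by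
    have h3 : Tendsto (fun h => (1 - wnorm v h)⁻¹) (𝓝 0) (𝓝 1) := by
      have := (ENNReal.Tendsto.sub tendsto_const_nhds h1 (.inl ENNReal.one_ne_top)).inv
      simpa using this
    have := ENNReal.Tendsto.const_mul (a := (v 0 : ℝ≥0∞))
      (ENNReal.Tendsto.mul h1 (.inr ENNReal.one_ne_top) h3 (.inr ENNReal.zero_ne_top))
      (.inr ENNReal.coe_ne_top)
    simpa using this
  refine tendsto_of_tendsto_of_tendsto_of_le_of_le' tendsto_const_nhds h2
    (Eventually.of_forall fun _ => zero_le) ?_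
  filter_upwards [h1.eventually (gt_mem_nhds one_pos)] with h hh
  exact wnorm_neumannSum_sub_one_le S hv ((wnorm_powWeight_one_le hv h).trans_lt hh)

end Neumann

/-! ### Calculus of real analytic maps between loops. -/

section LoopAnalytic

open scoped ENNReal NNReal
open Filter

theorem wnorm_powWeight_mono {r s : ℝ≥0} (h : r ≤ s) (Φ : Loop) :
    wnorm (powWeight r) Φ ≤ wnorm (powWeight s) Φ :=
  wnorm_mono (fun n => pow_le_pow_left₀ zero_le h n) Φ

/-- A strong form of real analyticity at a point: continuity, and a power series which converges
on a ball of the Wiener norm, for each vector absolutely on some fixed annulus. -/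
def LoopAnalyticAt (f : Loop → Loop) (a : Loop) : Prop :=
  ContinuousAt f a ∧ ∃ (p : FormalMultilinearSeries ℝ Loop Loop) (δ : ℝ≥0∞), 0 < δ ∧
    ∀ h, wnorm (powWeight 1) h < δ →
      (∃ r : ℝ≥0, 1 < r ∧ ∑' n, wnorm (powWeight r) (p n fun _ => h) ≠ ∞) ∧
        HasSum (fun n => p n fun _ => h) (f (a + h))

theorem Loop.eventually_wnorm_lt {δ : ℝ≥0∞} (hδ : 0 < δ) :
    ∀ᶠ h : Loop in 𝓝 0, wnorm (powWeight 1) h < δ := by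
  have := (Loop.tendsto_wnorm_sub (isWeight_powWeight le_rfl) isSubexp_powWeight_one 0).eventually
    (gt_mem_nhds hδ)
  simpa using this

theorem LoopAnalyticAt.exists_series {f : Loop → Loop} {a : Loop} (hf : LoopAnalyticAt f a) :
    ∃ p : FormalMultilinearSeries ℝ Loop Loop,
      ∀ᶠ h in 𝓝 (0 : Loop), HasSum (fun n => p n fun _ => h) (f (a + h)) := by
  obtain ⟨-, p, δ, hδ, hp⟩ := hf
  exact ⟨p, (Loop.eventually_wnorm_lt hδ).mono fun h hh => (hp h hh).2⟩

theorem LoopAnalyticAt.congr {f g : Loop → Loop} {a : Loop} (hf : LoopAnalyticAt f a)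
    {δ : ℝ≥0∞} (hδ : 0 < δ) (h : ∀ k, wnorm (powWeight 1) k < δ → f (a + k) = g (a + k)) :
    LoopAnalyticAt g a := by
  obtain ⟨hc, p, ε, hε, hp⟩ := hf
  refine ⟨hc.congr ?_, p, min ε δ, lt_min hε hδ, fun k hk => ?_⟩
  · have h1 : Tendsto (fun x : Loop => x - a) (𝓝 a) (𝓝 0) := by
      simpa using (continuous_sub_right a).tendsto a
    filter_upwards [h1.eventually (Loop.eventually_wnorm_lt hδ)] with x hx
    simpa using h (x - a) hx
  · obtain ⟨hk1, hk2⟩ := lt_min_iff.1 hk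
    refine ⟨(hp k hk1).1, ?_⟩
    rw [← h k hk2]
    exact (hp k hk1).2

/-- The power series of an affine map with value `c` and linear part `L`. -/
noncomputable def affineSeries (c : Loop) (L : Loop →L[ℝ] Loop) :
    FormalMultilinearSeries ℝ Loop Loop
  | 0 => ContinuousMultilinearMap.constOfIsEmpty ℝ _ c
  | 1 => ContinuousMultilinearMap.ofSubsingleton ℝ Loop Loop (0 : Fin 1) L
  | _ + 2 => 0

theorem affineSeries_zero (c : Loop) (L : Loop →L[ℝ] Loop) (m : Fin 0 → Loop) :
    affineSeries c L 0 m = c := rfl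

theorem affineSeries_one (c : Loop) (L : Loop →L[ℝ] Loop) (h : Loop) :
    affineSeries c L 1 (fun _ => h) = L h := rfl

theorem LoopAnalyticAt.of_affine {f : Loop → Loop} {a : Loop} (L : Loop →L[ℝ] Loop)
    (hf : ∀ h, f (a + h) = f a + L h) : LoopAnalyticAt f a := by
  have hzero : ∀ h : Loop, ∀ n ∉ Finset.range 2, affineSeries (f a) L n (fun _ => h) = 0 := by
    intro h n hn
    obtain ⟨m, rfl⟩ : ∃ m, n = m + 2 := ⟨n - 2, by simp at hn; omega⟩
    rfl
  refine ⟨?_, affineSeries (f a) L, 1, one_pos, fun h _ => ⟨?_, ?_⟩⟩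
  · have : f = fun x => f a + L (x - a) := funext fun x => by simpa using hf (x - a)
    rw [this]
    fun_prop
  · obtain ⟨r, hr, h1⟩ := (f a).exists_wnorm_ne_top
    obtain ⟨s, hs, h2⟩ := (L h).exists_wnorm_ne_top
    refine ⟨min r s, lt_min hr hs, ?_⟩
    rw [tsum_eq_sum (s := Finset.range 2) fun n hn => by rw [hzero h n hn, wnorm_zero],
      Finset.sum_range_succ, Finset.sum_range_one, affineSeries_zero, affineSeries_one]
    exact ENNReal.add_ne_top.2
      ⟨ne_top_of_le_ne_top h1 (wnorm_powWeight_mono (min_le_left _ _) _),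
        ne_top_of_le_ne_top h2 (wnorm_powWeight_mono (min_le_right _ _) _)⟩
  · have := hasSum_sum_of_ne_finset_zero (L := .unconditional ℕ) (hzero h)
    rwa [Finset.sum_range_succ, Finset.sum_range_one, affineSeries_zero, affineSeries_one,
      ← hf] at this

theorem LoopAnalyticAt.const (c a : Loop) : LoopAnalyticAt (fun _ => c) a :=
  .of_affine 0 fun h => by simp

/-- Affine inner maps suffice for moving base points. Composition of power series with nonlinear
inner maps is carried out in normed spaces only. -/
theorem LoopAnalyticAt.comp_affine {f g : Loop → Loop} {a : Loop} (L : Loop →L[ℝ] Loop)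
    (C : ℝ≥0∞) (hC : C ≠ ∞) (hL : ∀ h, wnorm (powWeight 1) (L h) ≤ C * wnorm (powWeight 1) h)
    (hg : ∀ h, g (a + h) = g a + L h) (hf : LoopAnalyticAt f (g a)) :
    LoopAnalyticAt (fun x => f (g x)) a := by
  obtain ⟨hc, p, δ, hδ, hp⟩ := hf
  refine ⟨hc.comp (LoopAnalyticAt.of_affine L hg).1,
    fun n => (p n).compContinuousLinearMap fun _ => L, δ / C, ENNReal.div_pos hδ.ne' hC,
    fun h hh => ?_⟩
  have h1 : wnorm (powWeight 1) (L h) < δ := by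
    refine (hL h).trans_lt ?_
    rw [mul_comm]
    exact ENNReal.mul_lt_of_lt_div hh
  have := hp _ h1
  rw [← hg] at this
  exact this

theorem LoopAnalyticAt.clm_comp {f : Loop → Loop} {a : Loop} (hf : LoopAnalyticAt f a)
    (L : Loop →L[ℝ] Loop) (C : ℝ≥0∞) (hC : C ≠ ∞) (hL : ∀ v h, wnorm v (L h) ≤ C * wnorm v h) :
    LoopAnalyticAt (fun x => L (f x)) a := by
  obtain ⟨hc, p, δ, hδ, hp⟩ := hf
  refine ⟨L.continuous.continuousAt.comp hc, fun n => L.compContinuousMultilinearMap (p n), δ, hδ,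
    fun h hh => ⟨?_, L.hasSum (hp h hh).2⟩⟩
  obtain ⟨r, hr, hs⟩ := (hp h hh).1
  refine ⟨r, hr, ne_top_of_le_ne_top (ENNReal.mul_ne_top hC hs) ?_⟩
  rw [← ENNReal.tsum_mul_left]
  exact ENNReal.tsum_le_tsum fun n => hL _ _

/-- The product of two continuous multilinear maps in separate groups of variables. -/
noncomputable def multilinearMul {E : Type*} [AddCommGroup E] [Module ℝ E] [TopologicalSpace E]
    {i j : ℕ} (p : E [×i]→L[ℝ] Loop) (q : E [×j]→L[ℝ] Loop) : E [×(i + j)]→L[ℝ] Loop where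
  toFun m := p (fun k => m (Fin.castAdd j k)) * q (fun k => m (Fin.natAdd i k))
  map_update_add' := by
    intro inst m l x y
    cases Subsingleton.elim inst (instDecidableEqFin (i + j))
    cases l using Fin.addCases with
    | left l =>
      have h1 : ∀ x : E, (fun k => Function.update m (Fin.castAdd j l) x (Fin.castAdd j k)) =
          Function.update (fun k => m (Fin.castAdd j k)) l x := fun x =>
        Function.update_comp_eq_of_injective m (Fin.castAdd_injective i j) l x
      have h2 : ∀ x : E, (fun k => Function.update m (Fin.castAdd j l) x (Fin.natAdd i k)) =
          (fun k => m (Fin.natAdd i k)) := fun x =>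
        funext fun k => Function.update_of_ne (by
          intro h; have := congrArg Fin.val h; simp at this; omega) _ _
      simp only [h1, h2, ContinuousMultilinearMap.map_update_add, add_mul]
    | right l =>
      have h1 : ∀ x : E, (fun k => Function.update m (Fin.natAdd i l) x (Fin.natAdd i k)) =
          Function.update (fun k => m (Fin.natAdd i k)) l x := fun x =>
        Function.update_comp_eq_of_injective m (Fin.natAdd_injective j i) l x
      have h2 : ∀ x : E, (fun k => Function.update m (Fin.natAdd i l) x (Fin.castAdd j k)) =
          (fun k => m (Fin.castAdd j k)) := fun x =>
        funext fun k => Function.update_of_ne (by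
          intro h; have := congrArg Fin.val h; simp at this; omega) _ _
      simp only [h1, h2, ContinuousMultilinearMap.map_update_add, mul_add]
  map_update_smul' := by
    intro inst m l c x
    cases Subsingleton.elim inst (instDecidableEqFin (i + j))
    cases l using Fin.addCases with
    | left l =>
      have h1 : ∀ x : E, (fun k => Function.update m (Fin.castAdd j l) x (Fin.castAdd j k)) =
          Function.update (fun k => m (Fin.castAdd j k)) l x := fun x =>
        Function.update_comp_eq_of_injective m (Fin.castAdd_injective i j) l x
      have h2 : ∀ x : E, (fun k => Function.update m (Fin.castAdd j l) x (Fin.natAdd i k)) =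
          (fun k => m (Fin.natAdd i k)) := fun x =>
        funext fun k => Function.update_of_ne (by
          intro h; have := congrArg Fin.val h; simp at this; omega) _ _
      simp only [h1, h2, ContinuousMultilinearMap.map_update_smul, smul_mul_assoc]
    | right l =>
      have h1 : ∀ x : E, (fun k => Function.update m (Fin.natAdd i l) x (Fin.natAdd i k)) =
          Function.update (fun k => m (Fin.natAdd i k)) l x := fun x =>
        Function.update_comp_eq_of_injective m (Fin.natAdd_injective j i) l x
      have h2 : ∀ x : E, (fun k => Function.update m (Fin.natAdd i l) x (Fin.castAdd j k)) =
          (fun k => m (Fin.castAdd j k)) := fun x =>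
        funext fun k => Function.update_of_ne (by
          intro h; have := congrArg Fin.val h; simp at this; omega) _ _
      simp only [h1, h2, ContinuousMultilinearMap.map_update_smul, mul_smul_comm]
  cont := (p.cont.comp (continuous_pi fun _ => continuous_apply _)).mul
    (q.cont.comp (continuous_pi fun _ => continuous_apply _))

/-- The Cauchy product of two power series. -/
noncomputable def cauchySeries (p q : FormalMultilinearSeries ℝ Loop Loop) :
    FormalMultilinearSeries ℝ Loop Loop := fun n =>
  ∑ x : Finset.HasAntidiagonal.antidiagonal n, (multilinearMul (p x.1.1) (q x.1.2)).domDomCongr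
    (finCongr (Finset.HasAntidiagonal.mem_antidiagonal.1 x.2))

theorem cauchySeries_diag (p q : FormalMultilinearSeries ℝ Loop Loop) (n : ℕ) (h : Loop) :
    cauchySeries p q n (fun _ => h) =
      ∑ x : Finset.HasAntidiagonal.antidiagonal n, p x.1.1 (fun _ => h) * q x.1.2 (fun _ => h) := by
  rw [cauchySeries, sum_apply]
  rfl

/-- The absolute convergence on an annulus built into `LoopAnalyticAt` serves here: on the smaller
of the two annuli the double series converges absolutely, so it may be rearranged into the Cauchy
product. -/
theorem LoopAnalyticAt.mul {f g : Loop → Loop} {a : Loop} (hf : LoopAnalyticAt f a)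
    (hg : LoopAnalyticAt g a) : LoopAnalyticAt (fun x => f x * g x) a := by
  obtain ⟨hfc, p, δ, hδ, hp⟩ := hf
  obtain ⟨hgc, q, ε, hε, hq⟩ := hg
  refine ⟨hfc.mul hgc, cauchySeries p q, min δ ε, lt_min hδ hε, fun h hh => ?_⟩
  obtain ⟨h1, h2⟩ := lt_min_iff.1 hh
  obtain ⟨⟨r, hr, hrp⟩, hps⟩ := hp h h1
  obtain ⟨⟨s, hs, hsq⟩, hqs⟩ := hq h h2
  set t := min r s with ht
  have ht1 : 1 < t := lt_min hr hs
  have hw : IsWeight (powWeight t) := isWeight_powWeight ht1.le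
  have hP : ∑' n, wnorm (powWeight t) (p n fun _ => h) ≠ ∞ := ne_top_of_le_ne_top hrp
    (ENNReal.tsum_le_tsum fun n => wnorm_powWeight_mono (min_le_left _ _) _)
  have hQ : ∑' n, wnorm (powWeight t) (q n fun _ => h) ≠ ∞ := ne_top_of_le_ne_top hsq
    (ENNReal.tsum_le_tsum fun n => wnorm_powWeight_mono (min_le_right _ _) _)
  have hprod : ∑' x : ℕ × ℕ, wnorm (powWeight t) ((p x.1 fun _ => h) * (q x.2 fun _ => h)) ≠ ∞ := by
    refine ne_top_of_le_ne_top (ENNReal.mul_ne_top hP hQ) ?_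
    refine (ENNReal.tsum_le_tsum fun x => wnorm_mul_le hw _ _).trans_eq ?_
    rw [ENNReal.tsum_prod (f := fun i j : ℕ => wnorm (powWeight t) (p i fun _ => h) *
      wnorm (powWeight t) (q j fun _ => h)), ← ENNReal.tsum_mul_right]
    exact tsum_congr fun n => ENNReal.tsum_mul_left
  refine ⟨⟨t, ht1, ne_top_of_le_ne_top hprod ?_⟩, ?_⟩
  · rw [← Finset.HasAntidiagonal.sigmaAntidiagonalEquivProd.tsum_eq, ENNReal.tsum_sigma']
    refine ENNReal.tsum_le_tsum fun n => ?_
    rw [cauchySeries_diag, tsum_fintype]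
    exact Finset.le_sum_of_subadditive _ (wnorm_zero _).le (wnorm_add_le _) _ _
  · have h3 := hps.mul hqs (Loop.summable_of_wnorm ht1 hprod)
    have h4 := (Finset.HasAntidiagonal.sigmaAntidiagonalEquivProd.hasSum_iff.2 h3).sigma
      (fun n => hasSum_fintype _)
    refine h4.congr_fun fun n => ?_
    rw [cauchySeries_diag]
    rfl

end LoopAnalytic

/-! ### Birkhoff factorization near the identity. -/

section LocalFactors

open scoped ENNReal NNReal
open Filter

theorem loopAnalyticAt_neumannSum_zero (S : Set ℤ) : LoopAnalyticAt (neumannSum S) 0 := by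
  refine ⟨continuousAt_neumannSum_zero S, neumannSeries S, 1, one_pos, fun h hh => ?_⟩
  rw [zero_add]
  obtain ⟨r, hr, hrh⟩ := Loop.exists_wnorm_lt hh
  exact ⟨⟨r, hr, tsum_wnorm_neumannSeries_ne_top S (isWeight_powWeight hr.le) hrh⟩,
    hasSum_neumannSum S hh⟩

/-- The inverse of the second factor in the Birkhoff factorization of `1 + h`. -/
noncomputable def birkhoffMinus (h : Loop) : Loop := neumannSum (Set.Iio 0) h

/-- The first factor in the Birkhoff factorization of `1 + h`. -/
noncomputable def birkhoffPlus (h : Loop) : Loop := (1 + h) * birkhoffMinus h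

theorem supportedIn_birkhoffMinus_sub_one {h : Loop} (hh : wnorm (powWeight 1) h < 1) :
    (birkhoffMinus h - 1).SupportedIn (Set.Iio 0) := by
  have := neumannSum_eq (Set.Iio 0) hh
  rw [birkhoffMinus, this, sub_sub_cancel_left]
  exact (Loop.supportedIn_restrict _ _).neg

theorem supportedIn_of_sub_one {X : Loop} (h : (X - 1).SupportedIn (Set.Iio 0)) :
    X.SupportedIn (Set.Iic 0) := by
  have := (h.mono Set.Iio_subset_Iic_self).add (Loop.supportedIn_one (S := Set.Iic 0) (by simp))
  rwa [sub_add_cancel] at this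

theorem coeff_zero_of_sub_one {X : Loop} (h : (X - 1).SupportedIn (Set.Iio 0)) :
    loopCoeff X 0 = 1 := by
  have := h 0 (by simp)
  rwa [Loop.coeff_sub, Loop.coeff_one, if_pos rfl, sub_eq_zero] at this

theorem restrict_Iio_one : Loop.restrict (Set.Iio 0) 1 = 0 := by
  rw [Loop.one_eq_monomial]
  exact (Loop.supportedIn_monomial (by simp) _).restrict_compl

/-- With P the projection to negative exponents, P X = X - 1, so the equation X = 1 - P(hX) says
exactly that P((1 + h)X) = 0. -/
theorem supportedIn_birkhoffPlus {h : Loop} (hh : wnorm (powWeight 1) h < 1) :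
    (birkhoffPlus h).SupportedIn (Set.Ici 0) := by
  rw [← Set.compl_Iio]
  refine Loop.supportedIn_compl_of_restrict_eq_zero ?_
  have h1 := neumannSum_eq (Set.Iio 0) hh
  have h2 := (supportedIn_birkhoffMinus_sub_one hh).restrict_eq
  rw [map_sub, restrict_Iio_one, sub_zero] at h2
  rw [birkhoffPlus, add_mul, one_mul, map_add, h2, birkhoffMinus]
  nth_rw 1 [h1]
  abel

/-- The two support conditions together give back the fixed point equation, whose solution is
unique. -/
theorem eq_birkhoffMinus {h X : Loop} (hh : wnorm (powWeight 1) h < 1)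
    (h1 : (X - 1).SupportedIn (Set.Iio 0)) (h2 : ((1 + h) * X).SupportedIn (Set.Ici 0)) :
    X = birkhoffMinus h := by
  refine eq_neumannSum hh ?_
  rw [← Set.compl_Iio] at h2
  have h3 := h2.restrict_compl
  have h4 := h1.restrict_eq
  rw [map_sub, restrict_Iio_one, sub_zero] at h4
  rw [add_mul, one_mul, map_add, h4] at h3
  rw [eq_sub_iff_add_eq, ← sub_eq_zero, ← h3]
  abel

/-- Without truncation, that is for S = ℤ, the series is the ordinary Neumann series of (1 + u)⁻¹.
-/
theorem Loop.exists_rightInverse {u : Loop} (hu : wnorm (powWeight 1) u < 1) :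
    ∃ R : Loop, (1 + u) * R = 1 := by
  refine ⟨neumannSum Set.univ u, ?_⟩
  have := neumannSum_eq Set.univ hu
  rw [Loop.restrict_univ, eq_sub_iff_add_eq] at this
  rwa [add_mul, one_mul]

/-- The radius 1/4 gives ‖X - 1‖ ≤ (1/4)/(3/4) = 1/3, hence ‖(1 + h)X - 1‖ ≤ 1/4 + 1/3 + 1/12 = 2/3.
So the plus factor is invertible. -/
theorem wnorm_birkhoffPlus_sub_one_lt {h : Loop} (hh : wnorm (powWeight 1) h < 1 / 4) :
    wnorm (powWeight 1) (birkhoffPlus h - 1) < 1 := by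
  have hw : IsWeight (powWeight 1) := isWeight_powWeight le_rfl
  have h1 : wnorm (powWeight 1) h < 1 := hh.trans_le (by
    rw [one_div]; exact ENNReal.inv_le_one.2 (by norm_num))
  have hX := wnorm_neumannSum_sub_one_le (Set.Iio 0) hw h1
  obtain ⟨a, ha⟩ : ∃ a, a = wnorm (powWeight 1) h := ⟨_, rfl⟩
  rw [← ha] at hh h1 hX
  have hx : wnorm (powWeight 1) (birkhoffMinus h - 1) ≤ 1 / 3 := by
    refine hX.trans ?_
    lift a to ℝ≥0 using h1.ne_top
    have hh' : a < 1 / 4 := by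
      rw [← ENNReal.coe_lt_coe]
      refine hh.trans_eq ?_
      rw [ENNReal.coe_div (by norm_num)]; rfl
    have ha1 : (0 : ℝ≥0) < 1 - a := tsub_pos_of_lt (hh'.trans (by norm_num))
    have e : ((1 / 3 : ℝ≥0) : ℝ≥0∞) = 1 / 3 := by rw [ENNReal.coe_div (by norm_num)]; rfl
    rw [← e, ← ENNReal.coe_one, ← ENNReal.coe_sub, ← ENNReal.coe_inv ha1.ne', ← ENNReal.coe_mul,
      ← ENNReal.coe_mul, ENNReal.coe_le_coe, powWeight, pow_zero, one_mul, ← div_eq_mul_inv,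
      div_le_iff₀ ha1, ← NNReal.coe_le_coe, NNReal.coe_mul, NNReal.coe_sub (by
        exact (hh'.trans (by norm_num)).le)]
    have : (a : ℝ) < 1 / 4 := by exact_mod_cast hh'
    push_cast
    linarith
  have hsplit : birkhoffPlus h - 1 = h + (birkhoffMinus h - 1) + h * (birkhoffMinus h - 1) := by
    rw [birkhoffPlus]; noncomm_ring
  rw [hsplit]
  calc _ ≤ wnorm (powWeight 1) h + wnorm (powWeight 1) (birkhoffMinus h - 1) +
        wnorm (powWeight 1) h * wnorm (powWeight 1) (birkhoffMinus h - 1) :=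
        (wnorm_add_le _ _ _).trans (add_le_add (wnorm_add_le _ _ _) (wnorm_mul_le hw _ _))
    _ ≤ 1 / 4 + 1 / 3 + 1 / 4 * (1 / 3) := by rw [← ha]; gcongr
    _ < 1 := by
      have e : ((1 / 4 + 1 / 3 + 1 / 4 * (1 / 3) : ℝ≥0) : ℝ≥0∞) =
          1 / 4 + 1 / 3 + 1 / 4 * (1 / 3) := by
        rw [ENNReal.coe_add, ENNReal.coe_add, ENNReal.coe_mul, ENNReal.coe_div (by norm_num),
          ENNReal.coe_div (by norm_num)]
        rfl
      rw [← e, ← ENNReal.coe_one, ENNReal.coe_lt_coe]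
      rw [← NNReal.coe_lt_coe]
      push_cast
      norm_num

/-- With G = (1 + h)X and GR = 1 one has (1 + h + k)X = G(1 + RkX). Factoring the last bracket,
which is close to 1, solves the problem at h + k, and uniqueness identifies the solution. Thus the
power series at 0 yields one at h. -/
theorem birkhoffMinus_add {h k R : Loop} (hh : wnorm (powWeight 1) h < 1)
    (hR : birkhoffPlus h * R = 1) (hhk : wnorm (powWeight 1) (h + k) < 1)
    (hk : wnorm (powWeight 1) (R * k * birkhoffMinus h) < 1) :
    birkhoffMinus (h + k) = birkhoffMinus h * birkhoffMinus (R * k * birkhoffMinus h) := by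
  refine (eq_birkhoffMinus hhk ?_ ?_).symm
  · have h1 := supportedIn_birkhoffMinus_sub_one hh
    have h2 := supportedIn_birkhoffMinus_sub_one hk
    have h3 := h1.mul (U := Set.Iio 0) (fun i hi j hj => by simp at *; omega) h2
    have := (h1.add h2).add h3
    convert this using 1
    noncomm_ring
  · have h1 : (1 + (h + k)) * (birkhoffMinus h * birkhoffMinus (R * k * birkhoffMinus h)) =
        birkhoffPlus h * birkhoffPlus (R * k * birkhoffMinus h) := by
      have h2 : (1 + (h + k)) * birkhoffMinus h =
          birkhoffPlus h * (1 + R * k * birkhoffMinus h) := by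
        rw [mul_add, mul_one, ← mul_assoc, ← mul_assoc, hR, one_mul, birkhoffPlus, ← add_mul,
          add_assoc]
      rw [← mul_assoc, h2, mul_assoc]
      rfl
    rw [h1]
    exact (supportedIn_birkhoffPlus hh).mul (fun i hi j hj => by simp at *; omega)
      (supportedIn_birkhoffPlus hk)

/-- Multiplication by fixed loops from both sides. -/
noncomputable def Loop.sandwichL (A B : Loop) : Loop →L[ℝ] Loop where
  toFun h := A * h * B
  map_add' x y := by rw [mul_add, add_mul]
  map_smul' c x := by rw [mul_smul_comm, smul_mul_assoc, RingHom.id_apply]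
  cont := (continuous_const.mul continuous_id).mul continuous_const

theorem Loop.wnorm_sandwichL_le {v : ℕ → ℝ≥0} (hv : IsWeight v) (A B h : Loop) :
    wnorm v (Loop.sandwichL A B h) ≤ wnorm v A * wnorm v B * wnorm v h := by
  refine (wnorm_mul_le hv _ _).trans ?_
  rw [mul_right_comm]
  gcongr
  exact wnorm_mul_le hv _ _

theorem LoopAnalyticAt.comp_sandwich {f g : Loop → Loop} {a : Loop} (A B : Loop)
    (hg : ∀ h, g (a + h) = g a + A * h * B) (hf : LoopAnalyticAt f (g a)) :
    LoopAnalyticAt (fun x => f (g x)) a :=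
  hf.comp_affine (Loop.sandwichL A B) (wnorm (powWeight 1) A * wnorm (powWeight 1) B)
    (ENNReal.mul_ne_top (wnorm_ne_top isSubexp_powWeight_one _)
      (wnorm_ne_top isSubexp_powWeight_one _))
    (Loop.wnorm_sandwichL_le (isWeight_powWeight le_rfl) A B) hg

theorem quarter_le_one : (1 / 4 : ℝ≥0∞) ≤ 1 := by
  rw [one_div]; exact ENNReal.inv_le_one.2 (by norm_num)

theorem exists_rightInverse_birkhoffPlus {h : Loop} (hh : wnorm (powWeight 1) h < 1 / 4) :
    ∃ R, birkhoffPlus h * R = 1 := by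
  obtain ⟨R, hR⟩ := Loop.exists_rightInverse (wnorm_birkhoffPlus_sub_one_lt hh)
  exact ⟨R, by rwa [add_sub_cancel] at hR⟩

theorem exists_ball_birkhoffMinus_add {h : Loop} (hh : wnorm (powWeight 1) h < 1 / 4) :
    ∃ (A B : Loop) (δ : ℝ≥0∞), 0 < δ ∧ ∀ k, wnorm (powWeight 1) k < δ →
      birkhoffMinus (h + k) = birkhoffMinus h * birkhoffMinus (A * k * B) := by
  have hw : IsWeight (powWeight 1) := isWeight_powWeight le_rfl
  obtain ⟨R, hR⟩ := exists_rightInverse_birkhoffPlus hh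
  have hh1 := hh.trans_le quarter_le_one
  set C := wnorm (powWeight 1) R * wnorm (powWeight 1) (birkhoffMinus h)
  have hC : C ≠ ∞ := ENNReal.mul_ne_top (wnorm_ne_top isSubexp_powWeight_one _)
      (wnorm_ne_top isSubexp_powWeight_one _)
  -- The first bound keeps h + k in the unit ball, the second keeps RkX there.
  refine ⟨R, birkhoffMinus h, min (1 - wnorm (powWeight 1) h) (1 / C),
    lt_min (tsub_pos_of_lt hh1) (ENNReal.div_pos one_ne_zero hC), fun k hk => ?_⟩
  obtain ⟨h1, h2⟩ := lt_min_iff.1 hk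
  refine birkhoffMinus_add hh1 hR ((wnorm_add_le _ _ _).trans_lt ?_)
    ((Loop.wnorm_sandwichL_le hw R (birkhoffMinus h) k).trans_lt ?_)
  · rw [add_comm]
    exact lt_tsub_iff_right.1 h1
  · rw [mul_comm]
    exact ENNReal.mul_lt_of_lt_div h2

theorem loopAnalyticAt_birkhoffMinus {h : Loop} (hh : wnorm (powWeight 1) h < 1 / 4) :
    LoopAnalyticAt birkhoffMinus h := by
  obtain ⟨A, B, δ, hδ, hAB⟩ := exists_ball_birkhoffMinus_add hh
  have h1 : LoopAnalyticAt (fun x => birkhoffMinus (A * (x - h) * B)) h := by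
    refine LoopAnalyticAt.comp_sandwich (f := birkhoffMinus) (g := fun x => A * (x - h) * B) A B
      (fun k => ?_) ?_
    · simp
    · simpa using! loopAnalyticAt_neumannSum_zero (Set.Iio 0)
  refine ((LoopAnalyticAt.const (birkhoffMinus h) h).mul h1).congr hδ fun k hk => ?_
  rw [hAB k hk, add_sub_cancel_left]

theorem loopAnalyticAt_birkhoffPlus {h : Loop} (hh : wnorm (powWeight 1) h < 1 / 4) :
    LoopAnalyticAt birkhoffPlus h :=
  (LoopAnalyticAt.of_affine (f := fun x => 1 + x) (ContinuousLinearMap.id ℝ Loop)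
    fun k => by simp [add_assoc]).mul (loopAnalyticAt_birkhoffMinus hh)

end LocalFactors

/-! ### The Wiener norm, used to compose the constant term with nonlinear analytic maps. -/

section WienerAlgebra

open scoped Matrix.Norms.Operator ENNReal NNReal
open Filter

/-- The loops as a normed algebra with the Wiener norm, the sum of the norms of the Laurent
coefficients. -/
def WLoop : Type := Loop

noncomputable instance : Ring WLoop := inferInstanceAs (Ring Loop)
noncomputable instance : Algebra ℝ WLoop := inferInstanceAs (Algebra ℝ Loop)

/-- The Wiener norm as a group norm. -/
noncomputable def wienerGroupNorm : AddGroupNorm WLoop where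
  toFun Φ := (wnorm (powWeight 1) Φ).toReal
  map_zero' := by
    have : wnorm (powWeight 1) (0 : WLoop) = 0 := wnorm_zero _
    rw [this, ENNReal.toReal_zero]
  add_le' Φ Ψ := map_add_le_add (weightSeminorm (powWeight 1) isSubexp_powWeight_one) Φ Ψ
  neg' Φ := congrArg ENNReal.toReal (wnorm_neg (powWeight 1) Φ)
  eq_zero_of_map_eq_zero' Φ h :=
    wnorm_eq_zero (isWeight_powWeight le_rfl) (((ENNReal.toReal_eq_zero_iff _).1 h).resolve_right
      (wnorm_ne_top isSubexp_powWeight_one Φ))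

noncomputable instance : NormedAddCommGroup WLoop := wienerGroupNorm.toNormedAddCommGroup

theorem WLoop.enorm_eq (Φ : WLoop) : ‖Φ‖ₑ = wnorm (powWeight 1) Φ := by
  rw [← ofReal_norm]
  exact ENNReal.ofReal_toReal (wnorm_ne_top isSubexp_powWeight_one Φ)

noncomputable instance : NormedRing WLoop :=
  { (inferInstance : NormedAddCommGroup WLoop), (inferInstance : Ring WLoop) with
    norm_mul_le := fun Φ Ψ => by
      have h := wnorm_mul_le (isWeight_powWeight le_rfl : IsWeight (powWeight 1)) Φ Ψ
      have := ENNReal.toReal_mono (ENNReal.mul_ne_top (wnorm_ne_top isSubexp_powWeight_one Φ)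
        (wnorm_ne_top isSubexp_powWeight_one Ψ)) h
      rwa [ENNReal.toReal_mul] at this }

noncomputable instance : NormedAlgebra ℝ WLoop where
  norm_smul_le c Φ :=
    (map_smul_eq_mul (weightSeminorm (powWeight 1) isSubexp_powWeight_one) c Φ).le

/-- The identity, as a continuous map to the Wiener norm topology. -/
noncomputable def toWLoop : Loop →L[ℝ] WLoop :=
  ⟨{ toFun := fun Φ => Φ, map_add' := fun _ _ => rfl, map_smul' := fun _ _ => rfl },
    Loop.continuous_of_enorm_le (E := WLoop) _ fun Φ => (WLoop.enorm_eq Φ).le⟩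

/-- A Laurent coefficient as a continuous map for the Wiener norm. -/
noncomputable def WLoop.coeffL (k : ℤ) : WLoop →L[ℝ] M2 :=
  LinearMap.mkContinuous
    ({ toFun := fun Φ => Loop.coeffₗ k Φ, map_add' := fun Φ Ψ => Loop.coeff_add Φ Ψ k,
       map_smul' := fun c Φ => Loop.coeff_smul c Φ k } : WLoop →ₗ[ℝ] M2) 1 fun Φ => by
    rw [one_mul, ← toReal_enorm, ← toReal_enorm, WLoop.enorm_eq]
    exact ENNReal.toReal_mono (wnorm_ne_top isSubexp_powWeight_one Φ)
      (enorm_coeff_le (isWeight_powWeight le_rfl) Φ k)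

/-- The Neumann series for the Wiener norm. -/
noncomputable def wienerSeries (S : Set ℤ) : FormalMultilinearSeries ℝ WLoop WLoop := fun n =>
  MultilinearMap.mkContinuous (E := fun _ : Fin n => WLoop) (G := WLoop)
    (neumannSeries S n).toMultilinearMap 1 fun m => by
      have h := wnorm_neumannSeries_le S (isWeight_powWeight le_rfl : IsWeight (powWeight 1)) n m
      have h1 := ENNReal.toReal_mono ?_ h
      · rw [ENNReal.toReal_mul, ENNReal.toReal_prod] at h1
        rw [one_mul]
        refine h1.trans_eq ?_
        rw [powWeight, pow_zero, ENNReal.coe_one, ENNReal.toReal_one, one_mul]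
        rfl
      · exact ENNReal.mul_ne_top ENNReal.coe_ne_top
          (ENNReal.prod_ne_top fun i _ => wnorm_ne_top isSubexp_powWeight_one (m i))

/-- `neumannSum` on the Wiener algebra. -/
noncomputable def WLoop.neumannSum (S : Set ℤ) : WLoop → WLoop := _root_.neumannSum S

/-- `birkhoffMinus` on the Wiener algebra. -/
noncomputable def WLoop.birkhoffMinus : WLoop → WLoop := _root_.birkhoffMinus

/-- `birkhoffPlus` on the Wiener algebra. -/
noncomputable def WLoop.birkhoffPlus : WLoop → WLoop := _root_.birkhoffPlus

/-- The analytic loops are not complete for the Wiener norm. The sum exists nevertheless, because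
the series already converges in the finer topology of `Loop`. -/
theorem hasFPowerSeriesOnBall_neumannSum (S : Set ℤ) :
    HasFPowerSeriesOnBall (WLoop.neumannSum S) (wienerSeries S) 0 1 where
  r_le := by
    refine FormalMultilinearSeries.le_radius_of_bound _ 1 fun n => ?_
    rw [NNReal.coe_one, one_pow, mul_one]
    exact MultilinearMap.mkContinuous_norm_le _ zero_le_one _
  r_pos := one_pos
  hasSum := by
    intro y hy
    rw [mem_eball_zero_iff, WLoop.enorm_eq] at hy
    rw [zero_add]
    exact toWLoop.hasSum (hasSum_neumannSum S hy)

theorem analyticAt_birkhoffMinus {h : Loop} (hh : wnorm (powWeight 1) h < 1 / 4) :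
    AnalyticAt ℝ WLoop.birkhoffMinus (toWLoop h) := by
  obtain ⟨A, B, δ, hδ, hAB⟩ := exists_ball_birkhoffMinus_add hh
  have h0 : AnalyticAt ℝ WLoop.birkhoffMinus 0 :=
    (hasFPowerSeriesOnBall_neumannSum (Set.Iio 0)).analyticAt
  set h' : WLoop := toWLoop h with hh'
  have h1 : AnalyticAt ℝ (fun x : WLoop => toWLoop A * (x - h') * toWLoop B) h' :=
    (analyticAt_const.mul (analyticAt_id.sub analyticAt_const)).mul analyticAt_const
  have h2 : AnalyticAt ℝ
      (fun x : WLoop => WLoop.birkhoffMinus (toWLoop A * (x - h') * toWLoop B)) h' := by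
    refine AnalyticAt.fun_comp ?_ h1
    rwa [sub_self, mul_zero, zero_mul]
  have h3 : AnalyticAt ℝ (fun x : WLoop => WLoop.birkhoffMinus h' *
      WLoop.birkhoffMinus (toWLoop A * (x - h') * toWLoop B)) h' := analyticAt_const.mul h2
  refine h3.congr ?_
  have h4 : ∀ᶠ x : WLoop in 𝓝 h', ‖x - h'‖ₑ < δ := by
    have : Tendsto (fun x : WLoop => ‖x - h'‖ₑ) (𝓝 h') (𝓝 ‖h' - h'‖ₑ) :=
      (continuous_enorm.comp (continuous_sub_right h')).tendsto h'
    rw [sub_self, enorm_zero] at this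
    exact this.eventually (gt_mem_nhds hδ)
  filter_upwards [h4] with x hx
  rw [WLoop.enorm_eq] at hx
  have hx' : h' + (x - h') = x := add_sub_cancel h' x
  exact (hAB _ hx).symm.trans (congrArg WLoop.birkhoffMinus hx')

theorem analyticAt_birkhoffPlus {h : Loop} (hh : wnorm (powWeight 1) h < 1 / 4) :
    AnalyticAt ℝ WLoop.birkhoffPlus (toWLoop h) :=
  (analyticAt_const.add analyticAt_id).mul (analyticAt_birkhoffMinus hh)

/-- Constant loops, as a continuous linear map. -/
noncomputable def Loop.constL : M2 →L[ℝ] Loop :=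
  LinearMap.toContinuousLinearMap
    { toFun := Loop.monomial 0
      map_add' := fun a b => Loop.ext fun z => by
        simp only [Loop.add_apply, Loop.monomial_apply, smul_add]
      map_smul' := fun c a => Loop.ext fun z => by
        rw [RingHom.id_apply, Loop.smul_apply, Loop.monomial_apply, Loop.monomial_apply,
          smul_comm] }

theorem Loop.constL_apply (m : M2) : Loop.constL m = Loop.monomial 0 m := rfl

/-- The way back from the normed setting: for maps with values in constant loops, absolute
convergence of matrices gives convergence on every annulus. -/
theorem loopAnalyticAt_const_of_analyticAt {φ : WLoop → M2} {a : Loop}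
    (hφ : AnalyticAt ℝ φ (toWLoop a)) :
    LoopAnalyticAt (fun x => Loop.constL (φ (toWLoop x))) a := by
  have hc : ContinuousAt (fun x : Loop => Loop.constL (φ (toWLoop x))) a :=
    Loop.constL.continuous.continuousAt.comp
      (ContinuousAt.comp (g := φ) (f := toWLoop) hφ.continuousAt toWLoop.continuous.continuousAt)
  obtain ⟨p, ρ, hp⟩ := hφ
  refine ⟨hc, fun n => Loop.constL.compContinuousMultilinearMap
    ((p n).compContinuousLinearMap fun _ => toWLoop), ρ, hp.r_pos, fun h hh => ?_⟩
  have hh' : toWLoop h ∈ Metric.eball (0 : WLoop) ρ := by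
    rw [mem_eball_zero_iff, WLoop.enorm_eq]
    exact hh
  have hsum := Loop.constL.hasSum (hp.hasSum hh')
  rw [← map_add] at hsum
  -- Any radius would do: a constant loop only sees the weight at 0, which is 1.
  refine ⟨⟨2, one_lt_two, ?_⟩, hsum⟩
  have hs := p.summable_norm_apply (Metric.eball_subset_eball hp.r_le hh')
  have hw : ∀ m : M2, wnorm (powWeight 2) (Loop.constL m) = ‖m‖₊ := fun m => by
    rw [Loop.constL_apply, wnorm_monomial]
    simp [powWeight, enorm_eq_nnnorm]
  have hw' : ∀ n, wnorm (powWeight 2) (Loop.constL.compContinuousMultilinearMap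
      ((p n).compContinuousLinearMap fun _ => toWLoop) fun _ => h) =
        ‖p n fun _ => toWLoop h‖₊ := fun n => hw _
  simp_rw [hw']
  exact ENNReal.tsum_coe_ne_top_iff_summable.2
    (NNReal.summable_coe (f := fun n => ‖p n fun _ => toWLoop h‖₊) |>.1 hs)

end WienerAlgebra

/-! ### The Iwasawa decomposition of SL(2,ℂ) and its analyticity. -/

section Iwasawa

open scoped Matrix.Norms.Operator ComplexConjugate

/-- The norm of the first column. -/
noncomputable def columnNorm (m : M2) : ℝ :=
  √((m 0 0).re ^ 2 + (m 0 0).im ^ 2 + ((m 1 0).re ^ 2 + (m 1 0).im ^ 2))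

/-- The inner product of the two columns. -/
noncomputable def columnInner (m : M2) : ℂ := conj (m 0 0) * m 0 1 + conj (m 1 0) * m 1 1

/-- The upper triangular factor of a matrix of determinant one in the Iwasawa decomposition. -/
noncomputable def iwasawaR (m : M2) : M2 :=
  !![(columnNorm m : ℂ), ((columnNorm m)⁻¹ : ℝ) * columnInner m; 0, ((columnNorm m)⁻¹ : ℝ)]

/-- The inverse of the upper triangular factor. -/
noncomputable def iwasawaRInv (m : M2) : M2 :=
  !![((columnNorm m)⁻¹ : ℝ), -(((columnNorm m)⁻¹ : ℝ) * columnInner m); 0, (columnNorm m : ℂ)]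

theorem columnNorm_sq_eq (m : M2) :
    columnNorm m ^ 2 = (m 0 0).re ^ 2 + (m 0 0).im ^ 2 + ((m 1 0).re ^ 2 + (m 1 0).im ^ 2) :=
  Real.sq_sqrt (by positivity)

theorem columnNorm_pos {m : M2} (hm : m 0 0 ≠ 0 ∨ m 1 0 ≠ 0) : 0 < columnNorm m := by
  refine Real.sqrt_pos.2 ?_
  rcases hm with h | h <;> rw [Ne, Complex.ext_iff, not_and_or] at h <;>
    rcases h with h | h <;> simp only [Complex.zero_re, Complex.zero_im] at h <;> positivity

theorem iwasawaR_mul_inv {m : M2} (hm : 0 < columnNorm m) : iwasawaR m * iwasawaRInv m = 1 := by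
  have h : (columnNorm m : ℂ) ≠ 0 := by exact_mod_cast hm.ne'
  ext i j
  fin_cases i <;> fin_cases j <;> simp [iwasawaR, iwasawaRInv, Matrix.mul_apply, h]
  field_simp
  ring

theorem iwasawa_unitary {m : M2} (hd : m.det = 1) (hm : 0 < columnNorm m) :
    m * iwasawaRInv m ∈ Matrix.specialUnitaryGroup (Fin 2) ℂ := by
  have h : (columnNorm m : ℂ) ≠ 0 := by exact_mod_cast hm.ne'
  have hN : (columnNorm m : ℂ) ^ 2 = m 0 0 * conj (m 0 0) + m 1 0 * conj (m 1 0) := by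
    rw [Complex.mul_conj, Complex.mul_conj, Complex.normSq_apply, Complex.normSq_apply]
    have := columnNorm_sq_eq m
    norm_cast
    rw [this]
    ring
  rw [Matrix.det_fin_two] at hd
  -- Gram–Schmidt: the first column is normalized, and determinant 1 forces the second to be its
  -- conjugate orthogonal complement.
  have e : m * iwasawaRInv m = !![m 0 0 * (columnNorm m : ℂ)⁻¹, -conj (m 1 0) * (columnNorm m : ℂ)⁻¹;
      m 1 0 * (columnNorm m : ℂ)⁻¹, conj (m 0 0) * (columnNorm m : ℂ)⁻¹] := by
    ext i j
    fin_cases i <;> fin_cases j <;>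
      simp [iwasawaRInv, Matrix.mul_apply, columnInner] <;> field_simp
    · rw [hN]; linear_combination (-conj (m 1 0)) * hd
    · rw [hN]; linear_combination (conj (m 0 0)) * hd
  rw [e, Matrix.mem_specialUnitaryGroup_iff, Matrix.mem_unitaryGroup_iff]
  constructor
  · ext i j
    fin_cases i <;> fin_cases j <;>
      simp [Matrix.mul_apply, Matrix.star_eq_conjTranspose] <;> field_simp
    · rw [hN]; ring
    · ring
    · ring
    · rw [hN]; ring
  · rw [Matrix.det_fin_two_of]
    field_simp
    rw [hN]; ring

theorem analyticAt_entry (i j : Fin 2) (m : M2) : AnalyticAt ℝ (fun m : M2 => m i j) m :=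
  (LinearMap.toContinuousLinearMap
    ({ toFun := fun m => m i j, map_add' := fun _ _ => rfl, map_smul' := fun _ _ => rfl } :
      M2 →ₗ[ℝ] ℂ)).analyticAt m

theorem analyticAt_columnNorm {m : M2} (hm : 0 < columnNorm m) : AnalyticAt ℝ columnNorm m := by
  have hre : ∀ i j, AnalyticAt ℝ (fun m : M2 => (m i j).re) m := fun i j =>
    (Complex.reCLM.analyticAt _).comp (analyticAt_entry i j m)
  have him : ∀ i j, AnalyticAt ℝ (fun m : M2 => (m i j).im) m := fun i j =>
    (Complex.imCLM.analyticAt _).comp (analyticAt_entry i j m)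
  have h1 : AnalyticAt ℝ (fun m : M2 =>
      (m 0 0).re ^ 2 + (m 0 0).im ^ 2 + ((m 1 0).re ^ 2 + (m 1 0).im ^ 2)) m :=
    (((hre 0 0).pow 2).add ((him 0 0).pow 2)).add (((hre 1 0).pow 2).add ((him 1 0).pow 2))
  have h2 : AnalyticAt ℝ (fun x : ℝ => √x)
      ((m 0 0).re ^ 2 + (m 0 0).im ^ 2 + ((m 1 0).re ^ 2 + (m 1 0).im ^ 2)) :=
    (Real.contDiffAt_sqrt (Real.sqrt_pos.1 hm).ne').analyticAt
  exact h2.fun_comp (f := fun m : M2 =>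
    (m 0 0).re ^ 2 + (m 0 0).im ^ 2 + ((m 1 0).re ^ 2 + (m 1 0).im ^ 2)) h1

theorem analyticAt_columnInner (m : M2) : AnalyticAt ℝ columnInner m := by
  have hconj : ∀ i j, AnalyticAt ℝ (fun m : M2 => conj (m i j)) m := fun i j =>
    (Complex.conjCLE.toContinuousLinearMap.analyticAt _).comp (analyticAt_entry i j m)
  exact ((hconj 0 0).mul (analyticAt_entry 0 1 m)).add ((hconj 1 0).mul (analyticAt_entry 1 1 m))

theorem analyticAt_upperTriangular {E : Type*} [NormedAddCommGroup E] [NormedSpace ℝ E]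
    {a b d : E → ℂ} {x : E} (ha : AnalyticAt ℝ a x) (hb : AnalyticAt ℝ b x)
    (hd : AnalyticAt ℝ d x) : AnalyticAt ℝ (fun x => (!![a x, b x; 0, d x] : M2)) x := by
  have h : (fun x => (!![a x, b x; 0, d x] : M2)) = fun x =>
      a x • (!![1, 0; 0, 0] : M2) + b x • (!![0, 1; 0, 0] : M2) + d x • (!![0, 0; 0, 1] : M2) := by
    funext x
    ext i j
    fin_cases i <;> fin_cases j <;> simp
  rw [h]
  exact ((ha.smul analyticAt_const).add (hb.smul analyticAt_const)).add (hd.smul analyticAt_const)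

theorem analyticAt_iwasawaR {m : M2} (hm : 0 < columnNorm m) : AnalyticAt ℝ iwasawaR m := by
  have hN := analyticAt_columnNorm hm
  have hc : AnalyticAt ℝ (fun m => (columnNorm m : ℂ)) m :=
    (Complex.ofRealCLM.analyticAt _).comp hN
  have hi : AnalyticAt ℝ (fun m => (((columnNorm m)⁻¹ : ℝ) : ℂ)) m :=
    (Complex.ofRealCLM.analyticAt _).comp (hN.inv hm.ne')
  exact analyticAt_upperTriangular hc (hi.mul (analyticAt_columnInner m)) hi

theorem analyticAt_iwasawaRInv {m : M2} (hm : 0 < columnNorm m) :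
    AnalyticAt ℝ iwasawaRInv m := by
  have hN := analyticAt_columnNorm hm
  have hc : AnalyticAt ℝ (fun m => (columnNorm m : ℂ)) m :=
    (Complex.ofRealCLM.analyticAt _).comp hN
  have hi : AnalyticAt ℝ (fun m => (((columnNorm m)⁻¹ : ℝ) : ℂ)) m :=
    (Complex.ofRealCLM.analyticAt _).comp (hN.inv hm.ne')
  exact analyticAt_upperTriangular hi (hi.mul (analyticAt_columnInner m)).neg hc

end Iwasawa

/-! ### Holomorphic extension as decay and support of coefficients. -/

section Extensions

open scoped Matrix.Norms.Operator ENNReal NNReal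
open Filter

/-- The Laurent coefficients decay faster than every exponential. -/
def Loop.Rapid (Φ : Loop) : Prop := ∀ r : ℝ≥0, 1 < r → wnorm (powWeight r) Φ ≠ ∞

theorem Loop.Rapid.mul {Φ Ψ : Loop} (hΦ : Φ.Rapid) (hΨ : Ψ.Rapid) : (Φ * Ψ).Rapid := fun r hr =>
  ne_top_of_le_ne_top (ENNReal.mul_ne_top (hΦ r hr) (hΨ r hr))
    (wnorm_mul_le (isWeight_powWeight hr.le) Φ Ψ)

theorem Loop.Rapid.summable {Φ : Loop} (h : Φ.Rapid) {r : ℝ} (hr : 1 < r) :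
    Summable fun k : ℤ => r ^ k.natAbs * ‖loopCoeff Φ k‖ := by
  lift r to ℝ≥0 using by linarith
  exact wnorm_powWeight_ne_top_iff.1 (h r (by exact_mod_cast hr))

theorem Loop.rapid_monomial (k : ℤ) (m : M2) : (Loop.monomial k m).Rapid := fun r _ => by
  rw [wnorm_monomial]
  exact ENNReal.mul_ne_top ENNReal.coe_ne_top enorm_ne_top

/-- Negative powers of 0 are 0 by convention, so no assumption on the support is needed. -/
theorem laurentSum_zero (a : ℤ → M2) : laurentSum a 0 = a 0 := by
  ext i j
  rw [laurentSum, tsum_eq_single 0 fun k hk => by rw [zero_zpow k hk, zero_mul], zpow_zero,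
    one_mul]

theorem supportedIn_of_isHolExt {Φ : Loop} {g : ℂ → M2}
    (hg : IsHolExt (Metric.closedBall 0 1) Φ g) : Φ.SupportedIn (Set.Ici 0) := fun k hk => by
  ext i j
  rw [loopCoeff_apply_of_ext hg.2, laurentCoeff_of_neg (hg.1 i j) (by simpa using hk)]
  rfl

theorem coeff_zero_of_isHolExt {Φ : Loop} {g : ℂ → M2}
    (hg : IsHolExt (Metric.closedBall 0 1) Φ g) : loopCoeff Φ 0 = g 0 := by
  ext i j
  rw [loopCoeff_apply_of_ext hg.2, laurentCoeff_zero (hg.1 i j)]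

theorem rapid_of_isHolExt {Φ : Loop} {g : ℂ → M2} (hg : IsHolExt {0}ᶜ Φ g) : Φ.Rapid := by
  intro r hr
  have hr' : (1 : ℝ) < r := by exact_mod_cast hr
  refine wnorm_powWeight_ne_top_iff.2 (summable_natAbs_of_ext (g := g) (r := r + 1) r.coe_nonneg
    (by linarith) (by linarith) ⟨fun i j => (hg.1 i j).mono fun z hz => ?_, hg.2⟩)
  rintro rfl
  have h1 := hz.1
  rw [norm_zero] at h1
  have : (0 : ℝ) < ((r : ℝ) + 1)⁻¹ := by positivity
  linarith

theorem exists_isHolExt_compl_zero_iff {Φ : Loop} : (∃ g, IsHolExt {0}ᶜ Φ g) ↔ Φ.Rapid := by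
  refine ⟨fun ⟨g, hg⟩ => rapid_of_isHolExt hg, fun h =>
    ⟨laurentSum (loopCoeff Φ), fun i j z hz => ?_, Φ.laurentSum_coeff⟩⟩
  have hz0 : 0 < ‖z‖ := norm_pos_iff.2 (by simpa using hz)
  obtain ⟨r, hr⟩ := exists_gt (max 1 (max ‖z‖ ‖z‖⁻¹))
  obtain ⟨h1, h2⟩ := max_lt_iff.1 hr
  obtain ⟨h2, h3⟩ := max_lt_iff.1 h2
  exact analyticOnNhd_laurentSum (by linarith) (h.summable h1) i j z
    ⟨inv_lt_of_inv_lt₀ hz0 h3, h2⟩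

/-- The condition p on the value at 0 is left free: it is used for SU(2) and, after z ↦ z⁻¹, for the
triangular matrices at infinity. -/
theorem exists_isHolExt_closedBall_iff {Φ : Loop} {p : M2 → Prop} :
    (∃ g, IsHolExt (Metric.closedBall 0 1) Φ g ∧ p (g 0)) ↔
      Φ.SupportedIn (Set.Ici 0) ∧ p (loopCoeff Φ 0) := by
  constructor
  · rintro ⟨g, hg, hp⟩
    exact ⟨supportedIn_of_isHolExt hg, coeff_zero_of_isHolExt hg ▸ hp⟩
  · rintro ⟨h, hp⟩
    obtain ⟨r, hr, hs⟩ := Φ.exists_summable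
    refine ⟨laurentSum (loopCoeff Φ), ⟨fun i j => ?_, Φ.laurentSum_coeff⟩, by
      rwa [laurentSum_zero]⟩
    exact (analyticOnNhd_laurentSum_ball (by linarith) hs
      (fun k hk => h k (by simpa using hk)) i j).mono (Metric.closedBall_subset_ball hr)

theorem exists_isHolExt_univ_iff {Φ : Loop} {p : M2 → Prop} :
    (∃ g, IsHolExt Set.univ Φ g ∧ p (g 0)) ↔
      Φ.Rapid ∧ Φ.SupportedIn (Set.Ici 0) ∧ p (loopCoeff Φ 0) := by
  constructor
  · rintro ⟨g, hg, hp⟩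
    refine ⟨rapid_of_isHolExt ⟨fun i j => (hg.1 i j).mono (Set.subset_univ _), hg.2⟩,
      exists_isHolExt_closedBall_iff.1
        ⟨g, ⟨fun i j => (hg.1 i j).mono (Set.subset_univ _), hg.2⟩, hp⟩⟩
  · rintro ⟨hr, h, hp⟩
    refine ⟨laurentSum (loopCoeff Φ), ⟨fun i j z _ => ?_, Φ.laurentSum_coeff⟩, by
      rwa [laurentSum_zero]⟩
    obtain ⟨r, hr'⟩ := exists_gt (max 1 ‖z‖)
    obtain ⟨h1, h2⟩ := max_lt_iff.1 hr'
    exact analyticOnNhd_laurentSum_ball (by linarith) (hr.summable h1)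
      (fun k hk => h k (by simpa using hk)) i j z (by simpa using h2)

/-- The loop `z ↦ Φ z⁻¹`. -/
noncomputable def Loop.rev (Φ : Loop) : Loop :=
  ⟨fun z => Φ z⁻¹, by
    obtain ⟨g, hg, hgΦ⟩ := Φ.2
    refine ⟨fun z => g z⁻¹, fun i j z hz => ?_, fun z => ?_⟩
    · have hz0 : z ≠ 0 := by rintro rfl; simp at hz
      refine (hg i j z⁻¹ ?_).comp (analyticAt_inv hz0)
      simpa using hz
    · exact (congrArg g (Circle.coe_inv z).symm).trans (hgΦ z⁻¹)⟩

theorem Loop.rev_apply (Φ : Loop) (z : Circle) : Φ.rev z = Φ z⁻¹ := rfl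

theorem Loop.coeff_rev (Φ : Loop) (k : ℤ) : loopCoeff Φ.rev k = loopCoeff Φ (-k) := by
  refine congrFun (loopCoeff_eq_of_hasSum (a := fun k => loopCoeff Φ (-k)) ?_ fun z => ?_) k
  · exact (Equiv.neg ℤ).summable_iff.2 Φ.summable_norm_coeff
  · have := (Equiv.neg ℤ).hasSum_iff.2 (Φ.hasSum_coeff z⁻¹)
    rw [Loop.rev_apply]
    refine this.congr_fun fun k => ?_
    simp

theorem Loop.supportedIn_rev_iff {Φ : Loop} :
    Φ.rev.SupportedIn (Set.Ici 0) ↔ Φ.SupportedIn (Set.Iic 0) := by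
  simp only [Loop.SupportedIn, Loop.coeff_rev, Set.mem_Ici, Set.mem_Iic, not_le]
  refine ⟨fun h k hk => ?_, fun h k hk => h _ (by omega)⟩
  simpa using h (-k) (by omega)

theorem Loop.wnorm_rev (v : ℕ → ℝ≥0) (Φ : Loop) : wnorm v Φ.rev = wnorm v Φ := by
  rw [wnorm, wnorm, ← (Equiv.neg ℤ).tsum_eq]
  exact tsum_congr fun k => by simp [Loop.coeff_rev]

theorem Loop.rapid_rev_iff {Φ : Loop} : Φ.rev.Rapid ↔ Φ.Rapid := by
  simp only [Loop.Rapid, Loop.wnorm_rev]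

theorem mem_LambdaStarSL_iff {Φ : Loop} : Φ ∈ LambdaStarSL ↔ Φ ∈ LambdaSL ∧ Φ.Rapid :=
  and_congr_right fun _ => exists_isHolExt_compl_zero_iff

/-- Upper triangular matrices with positive diagonal entries `ρ`, `ρ⁻¹`. -/
def IsPosTriangular (m : M2) : Prop :=
  ∃ (ρ : ℝ) (c : ℂ), 0 < ρ ∧ m = !![(ρ : ℂ), c; 0, (ρ : ℂ)⁻¹]

theorem mem_LambdaPlusSU_closedBall_iff {Φ : Loop} :
    Φ ∈ LambdaPlusSU (Metric.closedBall 0 1) ↔ Φ ∈ LambdaSL ∧ Φ.SupportedIn (Set.Ici 0) ∧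
      loopCoeff Φ 0 ∈ Matrix.specialUnitaryGroup (Fin 2) ℂ :=
  and_congr_right fun _ => exists_isHolExt_closedBall_iff
    (p := fun m => m ∈ Matrix.specialUnitaryGroup (Fin 2) ℂ)

theorem mem_LambdaPlusSU_univ_iff {Φ : Loop} :
    Φ ∈ LambdaPlusSU Set.univ ↔ Φ.Rapid ∧ Φ ∈ LambdaPlusSU (Metric.closedBall 0 1) := by
  rw [mem_LambdaPlusSU_closedBall_iff, and_left_comm]
  exact and_congr_right fun _ => exists_isHolExt_univ_iff
    (p := fun m => m ∈ Matrix.specialUnitaryGroup (Fin 2) ℂ)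

theorem mem_LambdaMinusR_closedBall_iff {Φ : Loop} :
    Φ ∈ LambdaMinusR (Metric.closedBall 0 1) ↔ Φ ∈ LambdaSL ∧ Φ.SupportedIn (Set.Iic 0) ∧
      IsPosTriangular (loopCoeff Φ 0) := by
  refine and_congr_right fun _ => (exists_isHolExt_closedBall_iff (Φ := Φ.rev)
    (p := IsPosTriangular)).trans ?_
  rw [Loop.supportedIn_rev_iff, Loop.coeff_rev, neg_zero]

theorem mem_LambdaMinusR_univ_iff {Φ : Loop} :
    Φ ∈ LambdaMinusR Set.univ ↔ Φ.Rapid ∧ Φ ∈ LambdaMinusR (Metric.closedBall 0 1) := by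
  rw [mem_LambdaMinusR_closedBall_iff, and_left_comm]
  refine and_congr_right fun _ => (exists_isHolExt_univ_iff (Φ := Φ.rev)
    (p := IsPosTriangular)).trans ?_
  rw [Loop.supportedIn_rev_iff, Loop.coeff_rev, neg_zero, Loop.rapid_rev_iff]

end Extensions

/-! ### The adjugate as a linear inverse on ΛSL(2,ℂ), and decay of factors. -/

section Adjugate

open scoped Matrix.Norms.Operator ENNReal NNReal

/-- The adjugate of `2 × 2` matrices, as a linear map. -/
noncomputable def adjugateL : M2 →L[ℝ] M2 :=
  LinearMap.toContinuousLinearMap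
    { toFun := Matrix.adjugate
      map_add' := fun a b => by
        simp only [Matrix.adjugate_fin_two]
        ext i j
        fin_cases i <;> fin_cases j <;> simp [add_comm]
      map_smul' := fun c a => by
        simp only [Matrix.adjugate_fin_two]
        ext i j
        fin_cases i <;> fin_cases j <;> simp }

theorem adjugateL_apply (m : M2) : adjugateL m = m.adjugate := rfl

theorem norm_adjugate_le (m : M2) : ‖m.adjugate‖ ≤ 2 * ‖m‖ := by
  refine norm_le_two_mul fun i j => ?_
  rw [Matrix.adjugate_fin_two]
  fin_cases i <;> fin_cases j <;> simpa using norm_entry_le m _ _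

theorem Loop.summable_adjugate (Φ : Loop) : ∃ r : ℝ, 1 < r ∧
    Summable fun k : ℤ => r ^ k.natAbs * ‖(loopCoeff Φ k).adjugate‖ := by
  obtain ⟨r, hr, h⟩ := Φ.exists_summable
  refine ⟨r, hr, (h.mul_left 2).of_nonneg_of_le (fun k => by positivity) fun k => ?_⟩
  rw [mul_left_comm]
  gcongr
  exact norm_adjugate_le _

/-- The pointwise adjugate of a loop. -/
noncomputable def Loop.adj (Φ : Loop) : Loop :=
  Loop.ofCoeff (fun k => (loopCoeff Φ k).adjugate) Φ.summable_adjugate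

theorem Loop.coeff_adj (Φ : Loop) (k : ℤ) : loopCoeff Φ.adj k = (loopCoeff Φ k).adjugate :=
  congrFun (Loop.coeff_ofCoeff Φ.summable_adjugate) k

theorem Loop.adj_apply (Φ : Loop) (z : Circle) : Φ.adj z = (Φ z).adjugate := by
  refine (Φ.adj.hasSum_coeff z).unique ?_
  refine (adjugateL.hasSum (Φ.hasSum_coeff z)).congr_fun fun k => ?_
  rw [Loop.coeff_adj, adjugateL_apply, Matrix.adjugate_smul]
  simp

theorem Loop.wnorm_adj_le (v : ℕ → ℝ≥0) (Φ : Loop) : wnorm v Φ.adj ≤ 2 * wnorm v Φ := by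
  rw [wnorm, wnorm, ← ENNReal.tsum_mul_left]
  refine ENNReal.tsum_le_tsum fun k => ?_
  rw [mul_left_comm, Loop.coeff_adj]
  gcongr
  simp only [enorm_eq_nnnorm]
  exact_mod_cast norm_adjugate_le (loopCoeff Φ k)

/-- The pointwise adjugate, as a continuous linear map. -/
noncomputable def Loop.adjL : Loop →L[ℝ] Loop :=
  ⟨{ toFun := Loop.adj
     map_add' := fun Φ Ψ => Loop.ext fun z => by
       simp only [Loop.adj_apply, Loop.add_apply, ← adjugateL_apply, map_add]
     map_smul' := fun c Φ => Loop.ext fun z => by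
       rw [RingHom.id_apply, Loop.smul_apply, Loop.adj_apply, Loop.adj_apply, Loop.smul_apply,
         ← adjugateL_apply, map_smul]; rfl },
    Loop.continuous_of_wnorm_le _ 2 fun v Φ => by
      simpa using Loop.wnorm_adj_le v Φ⟩

theorem Loop.SupportedIn.adj {S : Set ℤ} {Φ : Loop} (h : Φ.SupportedIn S) :
    Φ.adj.SupportedIn S := fun k hk => by
  rw [Loop.coeff_adj, h k hk, ← adjugateL_apply, map_zero]

theorem mul_adj_of_mem {Φ : Loop} (h : Φ ∈ LambdaSL) : Φ * Φ.adj = 1 := Loop.ext fun z => by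
  rw [Loop.mul_apply, Loop.adj_apply, Matrix.mul_adjugate, h z, one_smul, Loop.one_apply]

theorem adj_mul_of_mem {Φ : Loop} (h : Φ ∈ LambdaSL) : Φ.adj * Φ = 1 := Loop.ext fun z => by
  rw [Loop.mul_apply, Loop.adj_apply, Matrix.adjugate_mul, h z, one_smul, Loop.one_apply]

theorem mul_mem_LambdaSL {Φ Ψ : Loop} (hΦ : Φ ∈ LambdaSL) (hΨ : Ψ ∈ LambdaSL) :
    Φ * Ψ ∈ LambdaSL := fun z => by
  rw [Loop.mul_apply, Matrix.det_mul, hΦ z, hΨ z, one_mul]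

theorem adj_mem_LambdaSL {Φ : Loop} (hΦ : Φ ∈ LambdaSL) : Φ.adj ∈ LambdaSL := fun z => by
  rw [Loop.adj_apply, Matrix.det_adjugate, hΦ z, one_pow]

theorem monomial_zero_mem_LambdaSL {m : M2} (hm : m.det = 1) :
    Loop.monomial 0 m ∈ LambdaSL := fun z => by
  rw [Loop.monomial_apply, zpow_zero, one_smul, hm]

/-- The two Birkhoff factors inherit rapid decay from the product. -/
theorem Loop.Rapid.left {Φ C : Loop} (hΦ : Φ.Rapid) (hC : C.SupportedIn (Set.Iic 0))
    (h : (Φ * C).SupportedIn (Set.Ici 0)) : (Φ * C).Rapid := by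
  intro r hr
  refine ne_top_of_le_ne_top (ENNReal.mul_ne_top (hΦ r hr)
    (wnorm_ne_top isSubexp_powWeight_one C)) (wnorm_mul_le_of_forall fun k j => ?_)
  by_cases hk : k ∈ Set.Ici (0 : ℤ)
  · by_cases hj : k - j ∈ Set.Iic (0 : ℤ)
    · simp only [Set.mem_Ici, Set.mem_Iic] at hk hj
      right; right; right
      simp only [powWeight, one_pow, mul_one]
      -- From k ≥ 0 and k - j ≤ 0 follows |k| ≤ |j|: the weight falls entirely on Φ, and C only
      -- enters through its Wiener norm.
      exact pow_le_pow_right₀ hr.le (by omega)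
    · exact .inr (.inr (.inl (hC _ hj)))
  · exact .inl (h k hk)

theorem Loop.Rapid.right {Φ C : Loop} (hΦ : Φ.Rapid) (hC : C.SupportedIn (Set.Ici 0))
    (h : (C * Φ).SupportedIn (Set.Iic 0)) : (C * Φ).Rapid := by
  intro r hr
  refine ne_top_of_le_ne_top (ENNReal.mul_ne_top (wnorm_ne_top isSubexp_powWeight_one C)
    (hΦ r hr)) (wnorm_mul_le_of_forall fun k j => ?_)
  by_cases hk : k ∈ Set.Iic (0 : ℤ)
  · by_cases hj : j ∈ Set.Ici (0 : ℤ)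
    · simp only [Set.mem_Ici, Set.mem_Iic] at hk hj
      right; right; right
      simp only [powWeight, one_pow, one_mul]
      -- Mirror image: k ≤ 0 ≤ j gives |k| ≤ |k - j|.
      exact pow_le_pow_right₀ hr.le (by omega)
    · exact .inr (.inl (hC _ hj))
  · exact .inl (h k hk)

end Adjugate

/-! ### The big cell, normalized factors and their uniqueness. -/

section Factorization

open scoped Matrix.Norms.Operator ENNReal NNReal
open Filter

theorem Loop.coeff_zero_mul {Φ Ψ : Loop}
    (h : ∀ j : ℤ, j ≠ 0 → loopCoeff Φ j = 0 ∨ loopCoeff Ψ (0 - j) = 0) :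
    loopCoeff (Φ * Ψ : Loop) 0 = loopCoeff Φ 0 * loopCoeff Ψ 0 := by
  refine (Φ.hasSum_coeff_mul Ψ 0).unique (hasSum_single 0 fun j hj => ?_)
  rcases h j hj with h | h
  · exact mul_eq_zero_of_left h _
  · exact mul_eq_zero_of_right _ h

theorem Loop.SupportedIn.coeff_zero_mul_Ici {Φ Ψ : Loop} (hΦ : Φ.SupportedIn (Set.Ici 0))
    (hΨ : Ψ.SupportedIn (Set.Ici 0)) :
    loopCoeff (Φ * Ψ : Loop) 0 = loopCoeff Φ 0 * loopCoeff Ψ 0 :=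
  Loop.coeff_zero_mul fun j hj => (lt_or_gt_of_ne hj).imp (fun h => hΦ _ (by simpa using h))
    fun h => hΨ _ (by simpa using h)

theorem Loop.SupportedIn.coeff_zero_mul_Iic {Φ Ψ : Loop} (hΦ : Φ.SupportedIn (Set.Iic 0))
    (hΨ : Ψ.SupportedIn (Set.Iic 0)) :
    loopCoeff (Φ * Ψ : Loop) 0 = loopCoeff Φ 0 * loopCoeff Ψ 0 :=
  Loop.coeff_zero_mul fun j hj => (lt_or_gt_of_ne hj).symm.imp
    (fun h => hΦ _ (by simpa using h)) fun h => hΨ _ (by simpa using h)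

theorem Loop.SupportedIn.mul_Ici {Φ Ψ : Loop} (hΦ : Φ.SupportedIn (Set.Ici 0))
    (hΨ : Ψ.SupportedIn (Set.Ici 0)) : (Φ * Ψ).SupportedIn (Set.Ici 0) :=
  hΦ.mul (fun _ hi _ hj => add_nonneg (Set.mem_Ici.1 hi) (Set.mem_Ici.1 hj)) hΨ

theorem Loop.SupportedIn.mul_Iic {Φ Ψ : Loop} (hΦ : Φ.SupportedIn (Set.Iic 0))
    (hΨ : Ψ.SupportedIn (Set.Iic 0)) : (Φ * Ψ).SupportedIn (Set.Iic 0) :=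
  hΦ.mul (fun _ hi _ hj => add_nonpos (Set.mem_Iic.1 hi) (Set.mem_Iic.1 hj)) hΨ

theorem Loop.eq_monomial_zero {Φ : Loop} (h1 : Φ.SupportedIn (Set.Ici 0))
    (h2 : Φ.SupportedIn (Set.Iic 0)) : Φ = Loop.monomial 0 (loopCoeff Φ 0) := by
  refine Loop.ext_coeff fun k => ?_
  rw [Loop.coeff_monomial]
  rcases lt_trichotomy k 0 with h | rfl | h
  · rw [Pi.single_eq_of_ne h.ne]
    exact h1 k (by simpa using h)
  · rw [Pi.single_eq_same]
  · rw [Pi.single_eq_of_ne h.ne']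
    exact h2 k (by simpa using h)

theorem Loop.coeff_zero_monomial (m : M2) : loopCoeff (Loop.monomial 0 m) 0 = m := by
  rw [Loop.coeff_monomial, Pi.single_eq_same]

theorem Loop.monomial_zero_mul (a b : M2) :
    Loop.monomial 0 a * Loop.monomial 0 b = Loop.monomial 0 (a * b) := Loop.ext fun z => by
  rw [Loop.mul_apply, Loop.monomial_apply, Loop.monomial_apply, Loop.monomial_apply, zpow_zero,
    one_smul, one_smul, one_smul]

/-- Loops in `ΛSL(2,ℂ)` without Laurent coefficients of negative order. -/
def LambdaPlus : Set Loop := {Φ | Φ ∈ LambdaSL ∧ Φ.SupportedIn (Set.Ici 0)}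

/-- Loops in `ΛSL(2,ℂ)` without Laurent coefficients of positive order. -/
def LambdaMinus : Set Loop := {Φ | Φ ∈ LambdaSL ∧ Φ.SupportedIn (Set.Iic 0)}

theorem mul_mem_LambdaPlus {Φ Ψ : Loop} (hΦ : Φ ∈ LambdaPlus) (hΨ : Ψ ∈ LambdaPlus) :
    Φ * Ψ ∈ LambdaPlus := ⟨mul_mem_LambdaSL hΦ.1 hΨ.1, hΦ.2.mul_Ici hΨ.2⟩

theorem mul_mem_LambdaMinus {Φ Ψ : Loop} (hΦ : Φ ∈ LambdaMinus) (hΨ : Ψ ∈ LambdaMinus) :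
    Φ * Ψ ∈ LambdaMinus := ⟨mul_mem_LambdaSL hΦ.1 hΨ.1, hΦ.2.mul_Iic hΨ.2⟩

theorem adj_mem_LambdaPlus {Φ : Loop} (hΦ : Φ ∈ LambdaPlus) : Φ.adj ∈ LambdaPlus :=
  ⟨adj_mem_LambdaSL hΦ.1, hΦ.2.adj⟩

theorem adj_mem_LambdaMinus {Φ : Loop} (hΦ : Φ ∈ LambdaMinus) : Φ.adj ∈ LambdaMinus :=
  ⟨adj_mem_LambdaSL hΦ.1, hΦ.2.adj⟩

theorem monomial_zero_mem_LambdaPlus {m : M2} (hm : m.det = 1) :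
    Loop.monomial 0 m ∈ LambdaPlus :=
  ⟨monomial_zero_mem_LambdaSL hm, Loop.supportedIn_monomial (by simp) m⟩

theorem monomial_zero_mem_LambdaMinus {m : M2} (hm : m.det = 1) :
    Loop.monomial 0 m ∈ LambdaMinus :=
  ⟨monomial_zero_mem_LambdaSL hm, Loop.supportedIn_monomial (by simp) m⟩

theorem det_eq_one_of_mul_adjugate {m : M2} (h : m * m.adjugate = 1) : m.det = 1 := by
  rw [Matrix.mul_adjugate] at h
  simpa using congrFun (congrFun h 0) 0

/-- On plus loops the constant term is multiplicative, so the constant terms of Φ and of its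
adjugate are inverse to each other. -/
theorem det_coeff_zero_of_mem_LambdaPlus {Φ : Loop} (hΦ : Φ ∈ LambdaPlus) :
    (loopCoeff Φ 0).det = 1 := by
  refine det_eq_one_of_mul_adjugate ?_
  rw [← Loop.coeff_adj, ← hΦ.2.coeff_zero_mul_Ici hΦ.2.adj, mul_adj_of_mem hΦ.1, Loop.coeff_one,
    if_pos rfl]

theorem det_coeff_zero_of_mem_LambdaMinus {Φ : Loop} (hΦ : Φ ∈ LambdaMinus) :
    (loopCoeff Φ 0).det = 1 := by
  refine det_eq_one_of_mul_adjugate ?_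
  rw [← Loop.coeff_adj, ← hΦ.2.coeff_zero_mul_Iic hΦ.2.adj, mul_adj_of_mem hΦ.1, Loop.coeff_one,
    if_pos rfl]

theorem mem_LambdaPlusSU_iff {Φ : Loop} :
    Φ ∈ LambdaPlusSU (Metric.closedBall 0 1) ↔
      Φ ∈ LambdaPlus ∧ loopCoeff Φ 0 ∈ Matrix.specialUnitaryGroup (Fin 2) ℂ :=
  mem_LambdaPlusSU_closedBall_iff.trans and_assoc.symm

theorem mem_LambdaMinusR_iff {Φ : Loop} :
    Φ ∈ LambdaMinusR (Metric.closedBall 0 1) ↔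
      Φ ∈ LambdaMinus ∧ IsPosTriangular (loopCoeff Φ 0) :=
  mem_LambdaMinusR_closedBall_iff.trans and_assoc.symm

/-- The big cell: the loops that are a product of a loop without negative Laurent coefficients
and a loop without positive ones. -/
def bigCell : Set Loop := {Φ | ∃ F ∈ LambdaPlus, ∃ B ∈ LambdaMinus, F * B = Φ}

theorem columnNorm_pos_of_det_ne_zero {m : M2} (h : m.det ≠ 0) : 0 < columnNorm m := by
  refine columnNorm_pos ?_
  by_contra! h'
  exact h (by rw [Matrix.det_fin_two, h'.1, h'.2]; ring)

theorem isPosTriangular_iwasawaR {m : M2} (hm : 0 < columnNorm m) :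
    IsPosTriangular (iwasawaR m) :=
  ⟨columnNorm m, _, hm, by rw [iwasawaR, Complex.ofReal_inv]⟩

theorem det_iwasawaR {m : M2} (hm : 0 < columnNorm m) : (iwasawaR m).det = 1 := by
  have h : (columnNorm m : ℂ) ≠ 0 := by exact_mod_cast hm.ne'
  rw [iwasawaR, Matrix.det_fin_two_of, Complex.ofReal_inv, mul_inv_cancel₀ h]
  ring

theorem det_iwasawaRInv {m : M2} (hm : 0 < columnNorm m) : (iwasawaRInv m).det = 1 := by
  have h : (columnNorm m : ℂ) ≠ 0 := by exact_mod_cast hm.ne'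
  rw [iwasawaRInv, Matrix.det_fin_two_of, Complex.ofReal_inv, inv_mul_cancel₀ h]
  ring

/-- The first factor of `F * B`, normalized by means of the Iwasawa decomposition of the
product `m` of the constant terms; `b` is the constant term of `B`. -/
noncomputable def normalizeLeft (F : Loop) (m b : M2) : Loop :=
  F * Loop.monomial 0 (b * iwasawaRInv m)

/-- The second factor of `F * B`, normalized. -/
noncomputable def normalizeRight (B : Loop) (m b : M2) : Loop :=
  Loop.monomial 0 (iwasawaR m * b.adjugate) * B

/-- Writing FB = (F b R⁻¹)(R b⁻¹ B) with R the triangular Iwasawa factor of m, the constant terms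
become m R⁻¹, which is in SU(2), and R. -/
theorem normalize_mem {F B : Loop} (hF : F ∈ LambdaPlus) (hB : B ∈ LambdaMinus) {m b : M2}
    (hb : loopCoeff B 0 = b) (hm : loopCoeff F 0 * b = m) :
    normalizeLeft F m b ∈ LambdaPlusSU (Metric.closedBall 0 1) ∧
      normalizeRight B m b ∈ LambdaMinusR (Metric.closedBall 0 1) ∧
      normalizeLeft F m b * normalizeRight B m b = F * B := by
  have hdb : b.det = 1 := hb ▸ det_coeff_zero_of_mem_LambdaMinus hB
  have hdm : m.det = 1 := by
    rw [← hm, Matrix.det_mul, det_coeff_zero_of_mem_LambdaPlus hF, hdb, one_mul]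
  have hN : 0 < columnNorm m := columnNorm_pos_of_det_ne_zero (by rw [hdm]; exact one_ne_zero)
  have hl : Loop.monomial 0 (b * iwasawaRInv m) ∈ LambdaPlus := monomial_zero_mem_LambdaPlus (by
    rw [Matrix.det_mul, hdb, det_iwasawaRInv hN, one_mul])
  have hr : Loop.monomial 0 (iwasawaR m * b.adjugate) ∈ LambdaMinus :=
    monomial_zero_mem_LambdaMinus (by
      rw [Matrix.det_mul, Matrix.det_adjugate, hdb, det_iwasawaR hN, one_pow, one_mul])
  refine ⟨mem_LambdaPlusSU_iff.2 ⟨mul_mem_LambdaPlus hF hl, ?_⟩,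
    mem_LambdaMinusR_iff.2 ⟨mul_mem_LambdaMinus hr hB, ?_⟩, ?_⟩
  · rw [normalizeLeft, hF.2.coeff_zero_mul_Ici hl.2, Loop.coeff_zero_monomial, ← mul_assoc, hm]
    exact iwasawa_unitary hdm hN
  · rw [normalizeRight, hr.2.coeff_zero_mul_Iic hB.2, Loop.coeff_zero_monomial, hb, mul_assoc,
      Matrix.adjugate_mul, hdb, one_smul, mul_one]
    exact isPosTriangular_iwasawaR hN
  · have h1 : b * iwasawaRInv m * (iwasawaR m * b.adjugate) = 1 := by
      rw [mul_assoc, ← mul_assoc (iwasawaRInv m), mul_eq_one_comm.1 (iwasawaR_mul_inv hN), one_mul,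
        Matrix.mul_adjugate, hdb, one_smul]
    rw [normalizeLeft, normalizeRight, mul_assoc, ← mul_assoc (Loop.monomial 0 _),
      Loop.monomial_zero_mul, h1, ← Loop.one_eq_monomial, one_mul]

theorem bigCell_eq_image :
    bigCell = (fun P : Loop × Loop => P.1 * P.2) ''
      (LambdaPlusSU (Metric.closedBall 0 1) ×ˢ LambdaMinusR (Metric.closedBall 0 1)) := by
  ext Φ
  constructor
  · rintro ⟨F, hF, B, hB, rfl⟩
    obtain ⟨h1, h2, h3⟩ := normalize_mem hF hB rfl rfl
    exact ⟨(_, _), ⟨h1, h2⟩, h3⟩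
  · rintro ⟨⟨F, B⟩, ⟨hF, hB⟩, rfl⟩
    exact ⟨F, (mem_LambdaPlusSU_iff.1 hF).1, B, (mem_LambdaMinusR_iff.1 hB).1, rfl⟩

theorem bigCell_subset : bigCell ⊆ LambdaSL := by
  rintro _ ⟨F, hF, B, hB, rfl⟩
  exact mul_mem_LambdaSL hF.1 hB.1

/-- The first column of cr = s makes c upper triangular with positive corner; unitarity makes that
corner 1 and kills the off-diagonal entry. -/
theorem eq_one_of_isPosTriangular {c r s : M2} (hc : c ∈ Matrix.specialUnitaryGroup (Fin 2) ℂ)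
    (hr : IsPosTriangular r) (hs : IsPosTriangular s) (h : c * r = s) : c = 1 := by
  obtain ⟨ρ, x, hρ, rfl⟩ := hr
  obtain ⟨σ, y, hσ, rfl⟩ := hs
  have hρ' : (ρ : ℂ) ≠ 0 := by exact_mod_cast hρ.ne'
  have e := fun i j => congrFun (congrFun h i) j
  have e10 := e 1 0
  have e00 := e 0 0
  simp only [Matrix.mul_apply, Fin.sum_univ_two, Matrix.of_apply, Matrix.cons_val', Matrix.cons_val_zero,
    Matrix.cons_val_one, Matrix.cons_val_fin_one, mul_zero, add_zero, mul_eq_zero, hρ', or_false]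
    at e10 e00
  obtain ⟨hu, hd⟩ := Matrix.mem_specialUnitaryGroup_iff.1 hc
  rw [Matrix.det_fin_two, e10, mul_zero, sub_zero] at hd
  have hu' := congrFun (congrFun (Matrix.mem_unitaryGroup_iff'.1 hu) 0)
  have u00 := hu' 0
  have u01 := hu' 1
  simp [Matrix.mul_apply, Matrix.star_eq_conjTranspose, e10] at u00 u01
  have hc0 : c 0 0 = ((σ / ρ : ℝ) : ℂ) := by
    rw [Complex.ofReal_div, eq_div_iff hρ', e00]
  rw [hc0, Complex.conj_ofReal] at u00
  have h1 : (σ / ρ) * (σ / ρ) = 1 := by exact_mod_cast u00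
  have h2 : σ / ρ = 1 := by nlinarith [div_pos hσ hρ]
  rw [h2, Complex.ofReal_one] at hc0
  rw [hc0, one_mul] at hd
  rw [hc0] at u01
  simp at u01
  ext i j
  fin_cases i <;> fin_cases j <;> simp [hc0, e10, hd, u01]

/-- If FB = F'B', then F'⁻¹F = B'B⁻¹ is both a plus and a minus loop, hence a constant c. It is in
SU(2) by the first factors and trivial by the second. -/
theorem injOn_mul :
    Set.InjOn (fun P : Loop × Loop => P.1 * P.2)
      (LambdaPlusSU (Metric.closedBall 0 1) ×ˢ LambdaMinusR (Metric.closedBall 0 1)) := by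
  rintro ⟨F, B⟩ ⟨hF, hB⟩ ⟨F', B'⟩ ⟨hF', hB'⟩ h
  obtain ⟨hF, hF0⟩ := mem_LambdaPlusSU_iff.1 hF
  obtain ⟨hF', hF0'⟩ := mem_LambdaPlusSU_iff.1 hF'
  obtain ⟨hB, hB0⟩ := mem_LambdaMinusR_iff.1 hB
  obtain ⟨hB', hB0'⟩ := mem_LambdaMinusR_iff.1 hB'
  replace h : F * B = F' * B' := h
  have hD : F'.adj * F = B' * B.adj := by
    calc F'.adj * F = F'.adj * (F * B) * B.adj := by
          rw [mul_assoc, mul_assoc F, mul_adj_of_mem hB.1, mul_one]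
      _ = B' * B.adj := by rw [h, ← mul_assoc, adj_mul_of_mem hF'.1, one_mul]
  have h1 := mul_mem_LambdaPlus (adj_mem_LambdaPlus hF') hF
  have h2 := mul_mem_LambdaMinus hB' (adj_mem_LambdaMinus hB)
  obtain ⟨c, hc⟩ : ∃ c, F'.adj * F = Loop.monomial 0 c :=
    ⟨_, Loop.eq_monomial_zero h1.2 (hD ▸ h2.2)⟩
  have eF : F = F' * Loop.monomial 0 c := by
    rw [← hc, ← mul_assoc, mul_adj_of_mem hF'.1, one_mul]
  have eB : B' = Loop.monomial 0 c * B := by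
    rw [← hc, hD, mul_assoc, adj_mul_of_mem hB.1, mul_one]
  have hcs : c ∈ Matrix.specialUnitaryGroup (Fin 2) ℂ := by
    have h0 := congrArg (fun Φ : Loop => loopCoeff Φ 0) eF
    beta_reduce at h0
    rw [hF'.2.coeff_zero_mul_Ici (Loop.supportedIn_monomial (by simp) c),
      Loop.coeff_zero_monomial] at h0
    have h3 := mul_mem (Unitary.star_mem hF0'.1) hF0.1
    rw [h0, ← mul_assoc, Matrix.mem_unitaryGroup_iff'.1 hF0'.1, one_mul] at h3
    have h4 := (Matrix.mem_specialUnitaryGroup_iff.1 hF0).2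
    rw [h0, Matrix.det_mul, (Matrix.mem_specialUnitaryGroup_iff.1 hF0').2, one_mul] at h4
    exact Matrix.mem_specialUnitaryGroup_iff.2 ⟨h3, h4⟩
  have h0 := congrArg (fun Φ : Loop => loopCoeff Φ 0) eB
  beta_reduce at h0
  rw [(Loop.supportedIn_monomial (by simp) c : (Loop.monomial 0 c).SupportedIn
    (Set.Iic 0)).coeff_zero_mul_Iic hB.2, Loop.coeff_zero_monomial] at h0
  have hc1 := eq_one_of_isPosTriangular hcs hB0 hB0' h0.symm
  rw [hc1, ← Loop.one_eq_monomial] at eF eB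
  rw [mul_one] at eF
  rw [one_mul] at eB
  rw [eF, eB]

end Factorization

/-! ### Analytic local factors, and the diffeomorphisms onto the two cells. -/

section LocalInverse

open scoped Matrix.Norms.Operator ENNReal NNReal
open Filter

theorem det_eq_one_of_mul_adj {Φ : Loop} (h : Φ * Φ.adj = 1) : Φ ∈ LambdaSL := fun z => by
  have h1 := congrArg (fun Ψ : Loop => Ψ z) h
  beta_reduce at h1
  rw [Loop.mul_apply, Loop.adj_apply, Loop.one_apply] at h1
  exact det_eq_one_of_mul_adjugate h1

theorem Loop.mul_adj_congr {A X : Loop} (hA : A ∈ LambdaSL) :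
    (A * X) * (A * X).adj = X * X.adj := Loop.ext fun z => by
  rw [Loop.mul_apply (A * X), Loop.mul_apply X, Loop.adj_apply, Loop.adj_apply,
    Matrix.mul_adjugate, Matrix.mul_adjugate, Loop.mul_apply, Matrix.det_mul, hA z, one_mul]

/-- Since det(1 + h) = 1, the plus loop G = (1 + h)X and the minus loop X have the same determinant.
It is therefore constant, and equal to 1 because X has constant term 1. Determinants appear as
products with the adjugate, which keeps them inside `Loop`. -/
theorem birkhoff_mem {h : Loop} (hh : wnorm (powWeight 1) h < 1) (hd : 1 + h ∈ LambdaSL) :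
    birkhoffPlus h ∈ LambdaPlus ∧ birkhoffMinus h ∈ LambdaMinus := by
  have hX := supportedIn_birkhoffMinus_sub_one hh
  have hX' := supportedIn_of_sub_one hX
  have hG := supportedIn_birkhoffPlus hh
  have e : birkhoffPlus h * (birkhoffPlus h).adj = birkhoffMinus h * (birkhoffMinus h).adj :=
    Loop.mul_adj_congr hd
  have h1 : birkhoffMinus h * (birkhoffMinus h).adj = 1 := by
    rw [Loop.eq_monomial_zero (e ▸ hG.mul_Ici hG.adj) (hX'.mul_Iic hX'.adj),
      hX'.coeff_zero_mul_Iic hX'.adj, Loop.coeff_adj, coeff_zero_of_sub_one hX,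
      Matrix.adjugate_one, mul_one, ← Loop.one_eq_monomial]
  exact ⟨⟨det_eq_one_of_mul_adj (e.trans h1), hG⟩, det_eq_one_of_mul_adj h1, hX'⟩

theorem isUnit_coeff_zero_birkhoffPlus {h : Loop} (hh : wnorm (powWeight 1) h < 1 / 4) :
    IsUnit (loopCoeff (birkhoffPlus h) 0) := by
  have h1 := (enorm_coeff_le (isWeight_powWeight le_rfl) (birkhoffPlus h - 1) 0).trans_lt
    (wnorm_birkhoffPlus_sub_one_lt hh)
  rw [Loop.coeff_sub, Loop.coeff_one, if_pos rfl, enorm_eq_nnnorm, ← ENNReal.coe_one,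
    ENNReal.coe_lt_coe] at h1
  have h2 := isUnit_one_sub_of_norm_lt_one (x := 1 - loopCoeff (birkhoffPlus h) 0)
    (by rw [norm_sub_rev]; exact_mod_cast h1)
  rwa [sub_sub_cancel] at h2

/-- Loops near `F₀ * B₀`, moved to a neighbourhood of zero. -/
noncomputable def moveToZero (F₀ B₀ Φ : Loop) : Loop := F₀.adj * Φ * B₀.adj - 1

/-- The unnormalized first factor of loops near `F₀ * B₀`. -/
noncomputable def localLeft (F₀ B₀ Φ : Loop) : Loop := F₀ * birkhoffPlus (moveToZero F₀ B₀ Φ)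

/-- The unnormalized second factor of loops near `F₀ * B₀`. -/
noncomputable def localRight (F₀ B₀ Φ : Loop) : Loop :=
  (birkhoffMinus (moveToZero F₀ B₀ Φ)).adj * B₀

/-- The product of the constant terms of the two unnormalized factors. -/
noncomputable def localConst (F₀ B₀ Φ : Loop) : M2 :=
  loopCoeff F₀ 0 * loopCoeff (birkhoffPlus (moveToZero F₀ B₀ Φ)) 0 * loopCoeff B₀ 0

/-- The local inverse of the multiplication near `F₀ * B₀`. -/
noncomputable def localFactors (F₀ B₀ Φ : Loop) : Loop × Loop :=
  (normalizeLeft (localLeft F₀ B₀ Φ) (localConst F₀ B₀ Φ) (loopCoeff B₀ 0),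
    normalizeRight (localRight F₀ B₀ Φ) (localConst F₀ B₀ Φ) (loopCoeff B₀ 0))

/-- The domain of the local inverse of the multiplication near `F₀ * B₀`. -/
def localDomain (F₀ B₀ : Loop) : Set Loop :=
  {Φ | wnorm (powWeight 1) (moveToZero F₀ B₀ Φ) < 1 / 4}

theorem moveToZero_add (F₀ B₀ a h : Loop) :
    moveToZero F₀ B₀ (a + h) = moveToZero F₀ B₀ a + F₀.adj * h * B₀.adj := by
  rw [moveToZero, moveToZero, mul_add, add_mul]
  abel

theorem continuous_moveToZero (F₀ B₀ : Loop) : Continuous (moveToZero F₀ B₀) :=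
  ((continuous_const.mul continuous_id).mul continuous_const).sub continuous_const

theorem moveToZero_self {F₀ B₀ : Loop} (hF : F₀ ∈ LambdaSL) (hB : B₀ ∈ LambdaSL) :
    moveToZero F₀ B₀ (F₀ * B₀) = 0 := by
  rw [moveToZero, ← mul_assoc, adj_mul_of_mem hF, one_mul, mul_adj_of_mem hB, sub_self]

theorem isOpen_setOf_wnorm_lt (δ : ℝ≥0∞) : IsOpen {Φ : Loop | wnorm (powWeight 1) Φ < δ} := by
  refine isOpen_iff_mem_nhds.2 fun a ha => Loop.mem_nhds_iff.2
    ⟨_, isWeight_powWeight le_rfl, isSubexp_powWeight_one, δ - wnorm (powWeight 1) a,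
      tsub_pos_of_lt ha, fun x hx => ?_⟩
  have h1 := wnorm_add_le (powWeight 1) (x - a) a
  rw [sub_add_cancel] at h1
  exact h1.trans_lt (lt_tsub_iff_right.1 hx)

theorem isOpen_localDomain (F₀ B₀ : Loop) : IsOpen (localDomain F₀ B₀) :=
  (isOpen_setOf_wnorm_lt _).preimage (continuous_moveToZero F₀ B₀)

theorem mem_localDomain {F₀ B₀ : Loop} (hF : F₀ ∈ LambdaSL) (hB : B₀ ∈ LambdaSL) :
    F₀ * B₀ ∈ localDomain F₀ B₀ := by
  change wnorm (powWeight 1) (moveToZero F₀ B₀ (F₀ * B₀)) < 1 / 4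
  rw [moveToZero_self hF hB, wnorm_zero]
  exact ENNReal.div_pos one_ne_zero (by norm_num)

/-- Here 1 + h = F₀⁻¹ΦB₀⁻¹ = GX⁻¹, so Φ = (F₀G)(X⁻¹B₀). The constant term of X is 1, so X⁻¹B₀ has
the constant term of B₀, independently of Φ. -/
theorem localFactors_mem {F₀ B₀ Φ : Loop} (hF : F₀ ∈ LambdaPlus) (hB : B₀ ∈ LambdaMinus)
    (hΦ : Φ ∈ LambdaSL) (h : Φ ∈ localDomain F₀ B₀) :
    localFactors F₀ B₀ Φ ∈
        LambdaPlusSU (Metric.closedBall 0 1) ×ˢ LambdaMinusR (Metric.closedBall 0 1) ∧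
      (localFactors F₀ B₀ Φ).1 * (localFactors F₀ B₀ Φ).2 = Φ := by
  have h1 : wnorm (powWeight 1) (moveToZero F₀ B₀ Φ) < 1 := lt_of_lt_of_le h quarter_le_one
  have e : 1 + moveToZero F₀ B₀ Φ = F₀.adj * Φ * B₀.adj := add_sub_cancel _ _
  obtain ⟨hG, hX⟩ := birkhoff_mem h1 (by
    rw [e]
    exact mul_mem_LambdaSL (mul_mem_LambdaSL (adj_mem_LambdaSL hF.1) hΦ) (adj_mem_LambdaSL hB.1))
  have hL : localLeft F₀ B₀ Φ ∈ LambdaPlus := mul_mem_LambdaPlus hF hG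
  have hR : localRight F₀ B₀ Φ ∈ LambdaMinus := mul_mem_LambdaMinus (adj_mem_LambdaMinus hX) hB
  have hb : loopCoeff (localRight F₀ B₀ Φ) 0 = loopCoeff B₀ 0 := by
    rw [localRight, hX.2.adj.coeff_zero_mul_Iic hB.2, Loop.coeff_adj,
      coeff_zero_of_sub_one (supportedIn_birkhoffMinus_sub_one h1), Matrix.adjugate_one, one_mul]
  obtain ⟨h2, h3, h4⟩ := normalize_mem hL hR (m := localConst F₀ B₀ Φ) hb (by
    rw [localLeft, hF.2.coeff_zero_mul_Ici hG.2, localConst])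
  refine ⟨⟨h2, h3⟩, h4.trans ?_⟩
  rw [localLeft, localRight, birkhoffPlus, mul_assoc, mul_assoc, ← mul_assoc (birkhoffMinus _),
    mul_adj_of_mem hX.1, one_mul, e, mul_assoc, mul_assoc, adj_mul_of_mem hB.1, mul_one,
    ← mul_assoc, mul_adj_of_mem hF.1, one_mul]

/-- The local factors must be analytic on an open subset of the whole space, where determinants need
not be 1. The radius 1/4 keeps the constant term of the plus factor invertible, which is enough for
the Iwasawa formulas. -/
theorem columnNorm_localConst_pos {F₀ B₀ Φ : Loop} (hF : F₀ ∈ LambdaPlus) (hB : B₀ ∈ LambdaMinus)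
    (h : Φ ∈ localDomain F₀ B₀) : 0 < columnNorm (localConst F₀ B₀ Φ) := by
  refine columnNorm_pos_of_det_ne_zero ?_
  rw [localConst, Matrix.det_mul, Matrix.det_mul, det_coeff_zero_of_mem_LambdaPlus hF,
    det_coeff_zero_of_mem_LambdaMinus hB, one_mul, mul_one]
  exact ((Matrix.isUnit_iff_isUnit_det _).1 (isUnit_coeff_zero_birkhoffPlus h)).ne_zero

/-- The nonlinear composition with f takes place in the Wiener algebra; only the affine map
`moveToZero` is composed in `Loop`. -/
theorem loopAnalyticAt_const_localConst {F₀ B₀ Φ : Loop} (h : Φ ∈ localDomain F₀ B₀)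
    {f : M2 → M2} (hf : AnalyticAt ℝ f (localConst F₀ B₀ Φ)) :
    LoopAnalyticAt (fun x => Loop.monomial 0 (f (localConst F₀ B₀ x))) Φ := by
  have h1 : AnalyticAt ℝ (fun y : WLoop => loopCoeff F₀ 0 *
      WLoop.coeffL 0 (WLoop.birkhoffPlus y) * loopCoeff B₀ 0)
      (toWLoop (moveToZero F₀ B₀ Φ)) :=
    (analyticAt_const.mul (((WLoop.coeffL 0).analyticAt _).fun_comp
      (analyticAt_birkhoffPlus h))).mul analyticAt_const
  have h2 := loopAnalyticAt_const_of_analyticAt (AnalyticAt.fun_comp (g := f) (f := fun y : WLoop =>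
    loopCoeff F₀ 0 * WLoop.coeffL 0 (WLoop.birkhoffPlus y) * loopCoeff B₀ 0) hf h1)
  exact LoopAnalyticAt.comp_sandwich F₀.adj B₀.adj (moveToZero_add F₀ B₀ Φ) h2

theorem loopAnalyticAt_localFactors {F₀ B₀ Φ : Loop} (hF : F₀ ∈ LambdaPlus)
    (hB : B₀ ∈ LambdaMinus) (h : Φ ∈ localDomain F₀ B₀) :
    LoopAnalyticAt (fun x => (localFactors F₀ B₀ x).1) Φ ∧
      LoopAnalyticAt (fun x => (localFactors F₀ B₀ x).2) Φ := by
  have hN := columnNorm_localConst_pos hF hB h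
  constructor
  · exact ((LoopAnalyticAt.const F₀ Φ).mul (.comp_sandwich F₀.adj B₀.adj
      (moveToZero_add F₀ B₀ Φ) (loopAnalyticAt_birkhoffPlus h))).mul
      (loopAnalyticAt_const_localConst h (analyticAt_const.mul (analyticAt_iwasawaRInv hN)))
  · refine (loopAnalyticAt_const_localConst h ((analyticAt_iwasawaR hN).mul analyticAt_const)).mul
      (LoopAnalyticAt.mul ?_ (LoopAnalyticAt.const B₀ Φ))
    exact ((LoopAnalyticAt.comp_sandwich F₀.adj B₀.adj (moveToZero_add F₀ B₀ Φ)
      (loopAnalyticAt_birkhoffMinus h))).clm_comp Loop.adjL 2 (by norm_num) Loop.wnorm_adj_le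

theorem realAnalyticOnOpen_of_loopAnalyticAt {f : Loop → Loop × Loop} {W : Set Loop}
    (h1 : ∀ a ∈ W, LoopAnalyticAt (fun x => (f x).1) a)
    (h2 : ∀ a ∈ W, LoopAnalyticAt (fun x => (f x).2) a) : RealAnalyticOnOpen f W := by
  refine ⟨fun a ha => ((h1 a ha).1.prodMk (h2 a ha).1).continuousWithinAt, fun a ha => ?_⟩
  obtain ⟨p, hp⟩ := (h1 a ha).exists_series
  obtain ⟨q, hq⟩ := (h2 a ha).exists_series
  refine ⟨fun n => (p n).prod (q n), ?_⟩
  filter_upwards [hp, hq] with h h3 h4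
  exact h3.prodMk h4

theorem RealAnalyticOnSubset.mono {E F : Type*}
    [AddCommGroup E] [Module ℝ E] [TopologicalSpace E] [IsTopologicalAddGroup E]
    [ContinuousConstSMul ℝ E]
    [AddCommGroup F] [Module ℝ F] [TopologicalSpace F] [IsTopologicalAddGroup F]
    [ContinuousConstSMul ℝ F] {f : E → F} {X Y : Set E} (h : RealAnalyticOnSubset f Y)
    (hXY : X ⊆ Y) : RealAnalyticOnSubset f X := fun x hx => by
  obtain ⟨W, hW, hxW, f', hf', e⟩ := h x (hXY hx)
  exact ⟨W, hW, hxW, f', hf', fun y hy => e y ⟨hXY hy.1, hy.2⟩⟩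

/-- The power series of the multiplication of loops at `a`. -/
noncomputable def mulSeries (a : Loop × Loop) : FormalMultilinearSeries ℝ (Loop × Loop) Loop
  | 0 => ContinuousMultilinearMap.constOfIsEmpty ℝ _ (a.1 * a.2)
  | 1 => ContinuousMultilinearMap.ofSubsingleton ℝ (Loop × Loop) Loop (0 : Fin 1)
      ((Loop.sandwichL a.1 1).comp (ContinuousLinearMap.snd ℝ Loop Loop) +
        (Loop.sandwichL 1 a.2).comp (ContinuousLinearMap.fst ℝ Loop Loop))
  | 2 => multilinearMul
      (ContinuousMultilinearMap.ofSubsingleton ℝ (Loop × Loop) Loop (0 : Fin 1)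
        (ContinuousLinearMap.fst ℝ Loop Loop))
      (ContinuousMultilinearMap.ofSubsingleton ℝ (Loop × Loop) Loop (0 : Fin 1)
        (ContinuousLinearMap.snd ℝ Loop Loop))
  | _ + 3 => 0

theorem realAnalyticOnOpen_mul :
    RealAnalyticOnOpen (fun P : Loop × Loop => P.1 * P.2) Set.univ := by
  refine ⟨(continuous_fst.mul continuous_snd).continuousOn, fun a _ => ⟨mulSeries a,
    .of_forall fun h => ?_⟩⟩
  have h0 : ∀ n ∉ Finset.range 3, mulSeries a n (fun _ => h) = 0 := by
    intro n hn
    obtain ⟨m, rfl⟩ : ∃ m, n = m + 3 := ⟨n - 3, by simp at hn; omega⟩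
    rfl
  have h1 := hasSum_sum_of_ne_finset_zero (L := .unconditional ℕ) h0
  rw [Finset.sum_range_succ, Finset.sum_range_succ, Finset.sum_range_one] at h1
  change HasSum (fun n => mulSeries a n fun _ => h) ((a.1 + h.1) * (a.2 + h.2))
  have e : (a.1 + h.1) * (a.2 + h.2) =
      a.1 * a.2 + (a.1 * h.2 * 1 + 1 * h.1 * a.2) + h.1 * h.2 := by noncomm_ring
  rw [e]
  exact h1

theorem realAnalyticOnSubset_mul (X : Set (Loop × Loop)) :
    RealAnalyticOnSubset (fun P : Loop × Loop => P.1 * P.2) X := fun _ _ =>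
  ⟨Set.univ, isOpen_univ, Set.mem_univ _, _, realAnalyticOnOpen_mul, fun _ _ => rfl⟩

/-- The factors of a loop in the big cell. -/
noncomputable def bigCellFactors : Loop → Loop × Loop :=
  Function.invFunOn (fun P : Loop × Loop => P.1 * P.2)
    (LambdaPlusSU (Metric.closedBall 0 1) ×ˢ LambdaMinusR (Metric.closedBall 0 1))

theorem bigCellFactors_mem {Φ : Loop} (h : Φ ∈ bigCell) :
    bigCellFactors Φ ∈
      LambdaPlusSU (Metric.closedBall 0 1) ×ˢ LambdaMinusR (Metric.closedBall 0 1) :=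
  Function.invFunOn_mem (by rwa [bigCell_eq_image] at h)

theorem bigCellFactors_mul {Φ : Loop} (h : Φ ∈ bigCell) :
    (bigCellFactors Φ).1 * (bigCellFactors Φ).2 = Φ :=
  Function.invFunOn_eq (f := fun P : Loop × Loop => P.1 * P.2) (by rwa [bigCell_eq_image] at h)

theorem bigCellFactors_of_mem {P : Loop × Loop} (h : P ∈
    LambdaPlusSU (Metric.closedBall 0 1) ×ˢ LambdaMinusR (Metric.closedBall 0 1)) :
    bigCellFactors (P.1 * P.2) = P :=
  injOn_mul.leftInvOn_invFunOn h

theorem mem_bigCell_of_mem_localDomain {F₀ B₀ Φ : Loop} (hF : F₀ ∈ LambdaPlus)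
    (hB : B₀ ∈ LambdaMinus) (hΦ : Φ ∈ LambdaSL) (h : Φ ∈ localDomain F₀ B₀) : Φ ∈ bigCell := by
  obtain ⟨h1, h2⟩ := localFactors_mem hF hB hΦ h
  rw [bigCell_eq_image]
  exact ⟨_, h1, h2⟩

theorem exists_isOpen_bigCell : ∃ O : Set Loop, IsOpen O ∧ bigCell = O ∩ LambdaSL := by
  refine ⟨⋃ (F : LambdaPlus) (B : LambdaMinus), localDomain F B,
    isOpen_iUnion fun F => isOpen_iUnion fun B => isOpen_localDomain _ _, ?_⟩
  ext Φ
  simp only [Set.mem_inter_iff, Set.mem_iUnion]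
  constructor
  · intro h
    refine ⟨?_, bigCell_subset h⟩
    obtain ⟨F, hF, B, hB, rfl⟩ := h
    exact ⟨⟨F, hF⟩, ⟨B, hB⟩, mem_localDomain hF.1 hB.1⟩
  · rintro ⟨⟨F, B, h⟩, hΦ⟩
    exact mem_bigCell_of_mem_localDomain F.2 B.2 hΦ h

theorem isOpen_preimage_bigCell {S : Set Loop} (hS : S ⊆ LambdaSL) :
    IsOpen ((↑) ⁻¹' bigCell : Set S) := by
  obtain ⟨O, hO, h⟩ := exists_isOpen_bigCell
  have : ((↑) ⁻¹' bigCell : Set S) = (↑) ⁻¹' O := by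
    ext Φ
    simp only [Set.mem_preimage, h, Set.mem_inter_iff, hS Φ.2, and_true]
  rw [this]
  exact hO.preimage continuous_subtype_val

/-- By uniqueness of the normalized factorization, the global inverse agrees on the big cell with
each of the analytic local inverses. -/
theorem realAnalyticOnSubset_bigCellFactors : RealAnalyticOnSubset bigCellFactors bigCell := by
  rintro _ ⟨F, hF, B, hB, rfl⟩
  refine ⟨localDomain F B, isOpen_localDomain _ _, mem_localDomain hF.1 hB.1, localFactors F B,
    realAnalyticOnOpen_of_loopAnalyticAt (fun a ha => (loopAnalyticAt_localFactors hF hB ha).1)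
      (fun a ha => (loopAnalyticAt_localFactors hF hB ha).2), fun Φ hΦ => ?_⟩
  obtain ⟨h1, h2⟩ := localFactors_mem hF hB (bigCell_subset hΦ.1) hΦ.2
  rw [← bigCellFactors_of_mem h1, h2]

theorem isRealAnalyticDiffeo_mul :
    IsRealAnalyticDiffeo (fun P : Loop × Loop => P.1 * P.2)
      (LambdaPlusSU (Metric.closedBall 0 1) ×ˢ LambdaMinusR (Metric.closedBall 0 1)) bigCell :=
  ⟨fun P hP => by rw [bigCell_eq_image]; exact ⟨P, hP, rfl⟩, realAnalyticOnSubset_mul _,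
    bigCellFactors, fun _ h => bigCellFactors_mem h,
    ⟨fun _ h => bigCellFactors_of_mem h, fun _ h => bigCellFactors_mul h⟩,
    realAnalyticOnSubset_bigCellFactors⟩

theorem LambdaStarSL_subset : LambdaStarSL ⊆ LambdaSL := fun _ h => h.1

/-- Each factor is the product of FB with the inverse of the other, and its one-sided support lets
it inherit the decay of FB. -/
theorem Loop.rapid_factors {F B : Loop} (hF : F ∈ LambdaPlus) (hB : B ∈ LambdaMinus)
    (h : (F * B).Rapid) : F.Rapid ∧ B.Rapid := by
  constructor
  · have h1 : F * B * B.adj = F := by rw [mul_assoc, mul_adj_of_mem hB.1, mul_one]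
    have h2 := h.left hB.2.adj (by rw [h1]; exact hF.2)
    rwa [h1] at h2
  · have h1 : F.adj * (F * B) = B := by rw [← mul_assoc, adj_mul_of_mem hF.1, one_mul]
    have h2 := h.right hF.2.adj (by rw [h1]; exact hB.2)
    rwa [h1] at h2

theorem isRealAnalyticDiffeo_mul_star :
    IsRealAnalyticDiffeo (fun P : Loop × Loop => P.1 * P.2)
      (LambdaPlusSU Set.univ ×ˢ LambdaMinusR Set.univ) (bigCell ∩ LambdaStarSL) := by
  have hsub : LambdaPlusSU Set.univ ×ˢ LambdaMinusR Set.univ ⊆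
      LambdaPlusSU (Metric.closedBall 0 1) ×ˢ LambdaMinusR (Metric.closedBall 0 1) :=
    Set.prod_mono (fun _ h => (mem_LambdaPlusSU_univ_iff.1 h).2)
      fun _ h => (mem_LambdaMinusR_univ_iff.1 h).2
  refine ⟨fun P hP => ?_, realAnalyticOnSubset_mul _, bigCellFactors, fun Φ hΦ => ?_,
    ⟨fun P hP => bigCellFactors_of_mem (hsub hP), fun Φ hΦ => bigCellFactors_mul hΦ.1⟩,
    realAnalyticOnSubset_bigCellFactors.mono Set.inter_subset_left⟩
  · have h1 : P.1 * P.2 ∈ bigCell := by rw [bigCell_eq_image]; exact ⟨P, hsub hP, rfl⟩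
    exact ⟨h1, mem_LambdaStarSL_iff.2 ⟨bigCell_subset h1,
      (mem_LambdaPlusSU_univ_iff.1 hP.1).1.mul (mem_LambdaMinusR_univ_iff.1 hP.2).1⟩⟩
  · obtain ⟨h1, h2⟩ := bigCellFactors_mem hΦ.1
    have h3 := (mem_LambdaStarSL_iff.1 hΦ.2).2
    rw [← bigCellFactors_mul hΦ.1] at h3
    obtain ⟨h4, h5⟩ := Loop.rapid_factors (mem_LambdaPlusSU_iff.1 h1).1
      (mem_LambdaMinusR_iff.1 h2).1 h3
    exact ⟨mem_LambdaPlusSU_univ_iff.2 ⟨h4, h1⟩, mem_LambdaMinusR_univ_iff.2 ⟨h5, h2⟩⟩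

end LocalInverse

/-! ### Density of the big cell, through unipotent loops. -/

section Density

open scoped Matrix.Norms.Operator ENNReal NNReal
open Filter

theorem Loop.coeff_monomial_mul (k : ℤ) (m : M2) (Φ : Loop) (n : ℤ) :
    loopCoeff (Loop.monomial k m * Φ : Loop) n = m * loopCoeff Φ (n - k) := by
  refine ((Loop.monomial k m).hasSum_coeff_mul Φ n).unique ?_
  have h : loopCoeff (Loop.monomial k m) k = m := by rw [Loop.coeff_monomial, Pi.single_eq_same]
  have := hasSum_single (f := fun j => loopCoeff (Loop.monomial k m) j * loopCoeff Φ (n - j)) k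
    fun j hj => mul_eq_zero_of_left (by rw [Loop.coeff_monomial, Pi.single_eq_of_ne hj]) _
  beta_reduce at this
  rwa [h] at this

theorem Loop.coeff_mul_monomial (k : ℤ) (m : M2) (Φ : Loop) (n : ℤ) :
    loopCoeff (Φ * Loop.monomial k m : Loop) n = loopCoeff Φ (n - k) * m := by
  refine (Φ.hasSum_coeff_mul (Loop.monomial k m) n).unique ?_
  have h : loopCoeff (Loop.monomial k m) (n - (n - k)) = m := by
    rw [Loop.coeff_monomial, sub_sub_cancel, Pi.single_eq_same]
  have := hasSum_single (f := fun j => loopCoeff Φ j * loopCoeff (Loop.monomial k m) (n - j))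
    (n - k) fun j hj => mul_eq_zero_of_right _ (by
      rw [Loop.coeff_monomial, Pi.single_eq_of_ne fun h => hj (by omega)])
  beta_reduce at this
  rwa [h] at this

theorem Loop.Rapid.add {Φ Ψ : Loop} (hΦ : Φ.Rapid) (hΨ : Ψ.Rapid) : (Φ + Ψ).Rapid := fun r hr =>
  ne_top_of_le_ne_top (ENNReal.add_ne_top.2 ⟨hΦ r hr, hΨ r hr⟩) (wnorm_add_le _ Φ Ψ)

theorem Loop.rapid_one : (1 : Loop).Rapid := by
  rw [Loop.one_eq_monomial]
  exact Loop.rapid_monomial _ _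

/-- The loops of the big cell that extend to the punctured plane. -/
def starCell : Set Loop := bigCell ∩ LambdaStarSL

theorem mul_mem_starCell {Φ Ψ : Loop} (hΦ : Φ ∈ starCell) (hΨ : Ψ.Rapid)
    (h : Φ * Ψ ∈ bigCell) : Φ * Ψ ∈ starCell :=
  ⟨h, mem_LambdaStarSL_iff.2 ⟨bigCell_subset h, (mem_LambdaStarSL_iff.1 hΦ.2).2.mul hΨ⟩⟩

/-- The loops whose right multiplication preserves the closure of `starCell`. -/
def closureStabilizer : Submonoid Loop where
  carrier := {s | ∀ x ∈ closure starCell, x * s ∈ closure starCell}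
  mul_mem' := fun {a b} ha hb x hx => by
    rw [← mul_assoc]
    exact hb _ (ha x hx)
  one_mem' := fun x hx => by rwa [mul_one]

theorem mem_closureStabilizer {s : Loop} (h : ∀ x ∈ starCell, x * s ∈ closure starCell) :
    s ∈ closureStabilizer := fun x hx => by
  have := map_mem_closure (continuous_mul_const s) hx h
  rwa [closure_closure] at this

theorem isClosed_closureStabilizer : IsClosed (closureStabilizer : Set Loop) := by
  have : (closureStabilizer : Set Loop) =
      ⋂ x ∈ closure starCell, (fun s => x * s) ⁻¹' closure starCell := by
    ext s
    simp only [Set.mem_iInter, Set.mem_preimage]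
    rfl
  rw [this]
  exact isClosed_biInter fun x _ => isClosed_closure.preimage (continuous_const_mul x)

theorem one_mem_starCell : (1 : Loop) ∈ starCell := by
  have h : ∀ z, ((1 : Loop) z).det = 1 := fun z => by rw [Loop.one_apply, Matrix.det_one]
  exact ⟨⟨1, ⟨h, Loop.supportedIn_one (by simp)⟩, 1, ⟨h, Loop.supportedIn_one (by simp)⟩,
    mul_one 1⟩, mem_LambdaStarSL_iff.2 ⟨h, Loop.rapid_one⟩⟩

theorem mem_closureStabilizer_of_mem_LambdaMinus {s : Loop} (hs : s ∈ LambdaMinus)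
    (hr : s.Rapid) : s ∈ closureStabilizer := by
  refine mem_closureStabilizer fun x hx => subset_closure (mul_mem_starCell hx hr ?_)
  obtain ⟨F, hF, B, hB, rfl⟩ := hx.1
  exact ⟨F, hF, B * s, mul_mem_LambdaMinus hB hs, (mul_assoc _ _ _).symm⟩

theorem monomial_zero_mem_closureStabilizer {m : M2} (hm : m.det = 1) :
    Loop.monomial 0 m ∈ closureStabilizer :=
  mem_closureStabilizer_of_mem_LambdaMinus (monomial_zero_mem_LambdaMinus hm)
    (Loop.rapid_monomial _ _)

/-- The loop `z ↦ 1 + z ^ k • m`. -/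
noncomputable def Loop.oneAdd (k : ℤ) (m : M2) : Loop := 1 + Loop.monomial k m

theorem Loop.oneAdd_apply (k : ℤ) (m : M2) (z : Circle) :
    Loop.oneAdd k m z = 1 + (z : ℂ) ^ k • m := by
  rw [Loop.oneAdd, Loop.add_apply, Loop.one_apply, Loop.monomial_apply]

theorem Loop.rapid_oneAdd (k : ℤ) (m : M2) : (Loop.oneAdd k m).Rapid :=
  Loop.rapid_one.add (Loop.rapid_monomial _ _)

theorem det_one_add_eq_one {m : M2} (h1 : m.trace = 0) (h2 : m.det = 0) (c : ℂ) :
    (1 + c • m).det = 1 := by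
  rw [Matrix.trace_fin_two] at h1
  rw [Matrix.det_fin_two] at h2
  rw [Matrix.det_fin_two]
  simp
  linear_combination c * h1 + c ^ 2 * h2

theorem oneAdd_mem_LambdaSL {m : M2} (h1 : m.trace = 0) (h2 : m.det = 0) (k : ℤ) :
    Loop.oneAdd k m ∈ LambdaSL := fun z => by
  rw [Loop.oneAdd_apply]
  exact det_one_add_eq_one h1 h2 _

theorem continuous_monomial (k : ℤ) : Continuous (Loop.monomial k) := by
  have : Loop.monomial k = fun m => Loop.monomial k 1 * Loop.constL m := by
    funext m
    refine Loop.ext fun z => ?_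
    rw [Loop.mul_apply, Loop.constL_apply, Loop.monomial_apply, Loop.monomial_apply,
      Loop.monomial_apply, zpow_zero, one_smul, smul_mul_assoc, one_mul]
  rw [this]
  exact continuous_const.mul Loop.constL.continuous

theorem continuous_oneAdd (k : ℤ) : Continuous (Loop.oneAdd k) :=
  continuous_const.add (continuous_monomial k)

/-- Let u be the second column of b. The matrix t = d · u(u₂, -u₁) is nilpotent and kills u, and bN
= c · u e₁ᵀ for N = cE₂₁. Moreover tb = d · u e₁ᵀ because det b = 1, so the last equation reduces to
a scalar one for d. -/
theorem exists_shear {b b' : M2} (hdet : b.det = 1) {c : ℂ}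
    (hc : 1 + c * (b 1 1 * b' 0 1 - b 0 1 * b' 1 1) ≠ 0) :
    ∃ t : M2, t.trace = 0 ∧ t.det = 0 ∧ t * t = 0 ∧ t * b * !![0, 0; c, 0] = 0 ∧
      b * !![0, 0; c, 0] + t * b + t * b' * !![0, 0; c, 0] = 0 := by
  obtain ⟨p, q, r, t, rfl⟩ : ∃ p q r t : ℂ, b = !![p, q; r, t] := ⟨_, _, _, _, b.eta_fin_two⟩
  obtain ⟨p', q', r', t', rfl⟩ : ∃ p q r t : ℂ, b' = !![p, q; r, t] :=
    ⟨_, _, _, _, b'.eta_fin_two⟩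
  rw [Matrix.det_fin_two_of] at hdet
  replace hc : 1 + c * (t * q' - q * t') ≠ 0 := hc
  -- This is c + d + dc(t q' - q t') = 0, the coefficient of u e₁ᵀ in the last equation.
  obtain ⟨d, hd⟩ : ∃ d, d * (1 + c * (t * q' - q * t')) = -c := ⟨_, div_mul_cancel₀ _ hc⟩
  have hzero : (0 : M2) = !![0, 0; 0, 0] := Matrix.eta_fin_two 0
  refine ⟨!![d * (q * t), d * -q ^ 2; d * t ^ 2, d * -(t * q)], ?_, ?_, ?_, ?_, ?_⟩
  · rw [Matrix.trace_fin_two_of]; ring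
  · rw [Matrix.det_fin_two_of]; ring
  · rw [Matrix.mul_fin_two, hzero]
    congr! 2 <;> ring_nf
  · rw [Matrix.mul_fin_two, Matrix.mul_fin_two, hzero]
    congr! 2 <;> ring_nf
  · rw [Matrix.mul_fin_two, Matrix.mul_fin_two, Matrix.mul_fin_two, Matrix.mul_fin_two]
    ext i j
    fin_cases i <;> fin_cases j <;> simp
    · linear_combination q * hd + d * q * hdet
    · ring
    · linear_combination t * hd + d * t * hdet
    · ring

/-- Right multiplication by `1 + c z E₂₁` preserves the big cell for all but at most one `c`. -/
theorem mul_oneAdd_mem_bigCell {F B : Loop} (hF : F ∈ LambdaPlus) (hB : B ∈ LambdaMinus) (c : ℂ)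
    (hc : 1 + c * (loopCoeff B 0 1 1 * loopCoeff B (-1) 0 1 -
      loopCoeff B 0 0 1 * loopCoeff B (-1) 1 1) ≠ 0) :
    F * B * Loop.oneAdd 1 !![0, 0; c, 0] ∈ bigCell := by
  set N : M2 := !![0, 0; c, 0] with hN
  obtain ⟨t, httr, htdet, htt, hbN, hlin⟩ :=
    exists_shear (det_coeff_zero_of_mem_LambdaMinus hB) hc
  have hNtr : N.trace = 0 := by rw [hN, Matrix.trace_fin_two_of]; ring
  have hNdet : N.det = 0 := by rw [hN, Matrix.det_fin_two_of]; ring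
  have hsup : ∀ m : M2, (Loop.oneAdd 1 m).SupportedIn (Set.Ici 0) := fun m =>
    (Loop.supportedIn_one (by simp)).add (Loop.supportedIn_monomial (by simp) m)
  -- Left multiplication by 1 + zt removes the positive coefficients of B(1 + zN). Its inverse 1 -
  -- zt is a plus loop and is absorbed into F.
  refine ⟨F * Loop.oneAdd 1 (-t), mul_mem_LambdaPlus hF ⟨oneAdd_mem_LambdaSL
    (by rw [Matrix.trace_neg, httr, neg_zero]) (by rw [Matrix.det_neg, htdet, mul_zero]) 1,
    hsup _⟩, Loop.oneAdd 1 t * (B * Loop.oneAdd 1 N), ⟨mul_mem_LambdaSL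
    (oneAdd_mem_LambdaSL httr htdet 1) (mul_mem_LambdaSL hB.1 (oneAdd_mem_LambdaSL hNtr hNdet 1)),
    fun k hk => ?_⟩, ?_⟩
  · have hP : ∀ k, loopCoeff (B * Loop.oneAdd 1 N : Loop) k =
        loopCoeff B k + loopCoeff B (k - 1) * N := fun k => by
      rw [Loop.oneAdd, mul_add, mul_one, Loop.coeff_add, Loop.coeff_mul_monomial]
    have hQ : loopCoeff (Loop.oneAdd 1 t * (B * Loop.oneAdd 1 N) : Loop) k =
        loopCoeff (B * Loop.oneAdd 1 N : Loop) k +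
          t * loopCoeff (B * Loop.oneAdd 1 N : Loop) (k - 1) := by
      rw [Loop.oneAdd, add_mul, one_mul, Loop.coeff_add, Loop.coeff_monomial_mul]
    have hk0 : 0 < k := by simpa using hk
    have hBp : ∀ j : ℤ, 0 < j → loopCoeff B j = 0 := fun j hj => hB.2 j (by simpa using hj)
    rw [hQ, hP, hP, hBp k hk0, zero_add]
    -- Only the exponents 1 and 2 can occur; there the coefficients vanish by the two matrix
    -- equations for t.
    rcases eq_or_ne k 1 with rfl | hk1
    · rw [sub_self, zero_sub, mul_add, ← mul_assoc, ← add_assoc]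
      exact hlin
    · rw [hBp (k - 1) (by omega), zero_mul, zero_add, zero_add, ← mul_assoc]
      rcases eq_or_ne k 2 with rfl | hk2
      · exact hbN
      · rw [hBp (k - 1 - 1) (by omega), mul_zero, zero_mul]
  · have h1 : Loop.oneAdd 1 (-t) * Loop.oneAdd 1 t = 1 := Loop.ext fun z => by
      rw [Loop.mul_apply, Loop.oneAdd_apply, Loop.oneAdd_apply, Loop.one_apply, smul_neg, add_mul,
        mul_add, one_mul, one_mul, mul_add, mul_one, neg_mul, smul_mul_smul_comm, htt, smul_zero]
      abel
    rw [mul_assoc, ← mul_assoc (Loop.oneAdd 1 (-t)), h1, one_mul, mul_assoc]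

/-- For a given FB at most one c is exceptional, and it is a limit of admissible ones; the closure
absorbs it. -/
theorem oneAdd_lower_mem_closureStabilizer (c : ℂ) :
    Loop.oneAdd 1 !![0, 0; c, 0] ∈ closureStabilizer := by
  refine mem_closureStabilizer fun x hx => ?_
  obtain ⟨F, hF, B, hB, rfl⟩ := hx.1
  obtain ⟨κ, hκ⟩ : ∃ κ, κ = loopCoeff B 0 1 1 * loopCoeff B (-1) 0 1 -
      loopCoeff B 0 0 1 * loopCoeff B (-1) 1 1 := ⟨_, rfl⟩
  have hd : Dense {c : ℂ | 1 + c * κ ≠ 0} := by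
    by_cases h : κ = 0
    · simp [h]
    · refine (dense_compl_singleton (-1 / κ)).mono fun c hc => ?_
      contrapose! hc
      have h' : 1 + c * κ = 0 := not_not.1 hc
      rw [Set.notMem_compl_iff, Set.mem_singleton_iff, eq_div_iff h]
      linear_combination h'
  have hcont : Continuous fun c : ℂ => F * B * Loop.oneAdd 1 !![0, 0; c, 0] := by
    refine continuous_const.mul ((continuous_oneAdd 1).comp ?_)
    refine continuous_matrix fun i j => ?_
    fin_cases i <;> fin_cases j <;> simp <;> fun_prop
  refine map_mem_closure (f := fun c : ℂ => F * B * Loop.oneAdd 1 !![0, 0; c, 0]) hcont (hd c)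
    fun c' hc' => mul_mem_starCell hx (Loop.rapid_oneAdd _ _) (mul_oneAdd_mem_bigCell hF hB c' ?_)
  rw [← hκ]
  exact hc'

/-- The upper unipotent loop with off-diagonal entry `c * z ^ k`. -/
noncomputable def Loop.upperMonomial (k : ℤ) (c : ℂ) : Loop := Loop.oneAdd k !![0, c; 0, 0]

/-- The lower unipotent loop with off-diagonal entry `c * z ^ k`. -/
noncomputable def Loop.lowerMonomial (k : ℤ) (c : ℂ) : Loop := Loop.oneAdd k !![0, 0; c, 0]

/-- The diagonal loop with entries `z ^ k` and `z ^ (-k)`. -/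
noncomputable def Loop.diagMonomial (k : ℤ) : Loop :=
  Loop.monomial k !![1, 0; 0, 0] + Loop.monomial (-k) !![0, 0; 0, 1]

theorem Loop.upperMonomial_apply (k : ℤ) (c : ℂ) (z : Circle) :
    Loop.upperMonomial k c z = !![1, (z : ℂ) ^ k * c; 0, 1] := by
  rw [Loop.upperMonomial, Loop.oneAdd_apply]
  ext i j
  fin_cases i <;> fin_cases j <;> simp

theorem Loop.lowerMonomial_apply (k : ℤ) (c : ℂ) (z : Circle) :
    Loop.lowerMonomial k c z = !![1, 0; (z : ℂ) ^ k * c, 1] := by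
  rw [Loop.lowerMonomial, Loop.oneAdd_apply]
  ext i j
  fin_cases i <;> fin_cases j <;> simp

theorem Loop.diagMonomial_apply (k : ℤ) (z : Circle) :
    Loop.diagMonomial k z = !![(z : ℂ) ^ k, 0; 0, ((z : ℂ) ^ k)⁻¹] := by
  rw [Loop.diagMonomial, Loop.add_apply, Loop.monomial_apply, Loop.monomial_apply, zpow_neg]
  ext i j
  fin_cases i <;> fin_cases j <;> simp

theorem Loop.monomial_zero_apply (m : M2) (z : Circle) : Loop.monomial 0 m z = m := by
  rw [Loop.monomial_apply, zpow_zero, one_smul]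

/-- The rotation by a right angle. -/
def quarterTurn : M2 := !![0, 1; -1, 0]

/-- The inverse rotation. -/
def quarterTurnInv : M2 := !![0, -1; 1, 0]

theorem quarterTurn_mem : Loop.monomial 0 quarterTurn ∈ closureStabilizer :=
  monomial_zero_mem_closureStabilizer (by rw [quarterTurn, Matrix.det_fin_two_of]; ring)

theorem quarterTurnInv_mem : Loop.monomial 0 quarterTurnInv ∈ closureStabilizer :=
  monomial_zero_mem_closureStabilizer (by rw [quarterTurnInv, Matrix.det_fin_two_of]; ring)

theorem upper_mem_closureStabilizer_iff (k : ℤ) (c : ℂ) :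
    Loop.upperMonomial k (-c) ∈ closureStabilizer ↔
      Loop.lowerMonomial k c ∈ closureStabilizer := by
  constructor <;> intro h
  · have e : Loop.lowerMonomial k c = Loop.monomial 0 quarterTurn * Loop.upperMonomial k (-c) *
        Loop.monomial 0 quarterTurnInv := Loop.ext fun z => by
      rw [Loop.mul_apply, Loop.mul_apply, Loop.monomial_zero_apply, Loop.monomial_zero_apply,
        Loop.upperMonomial_apply, Loop.lowerMonomial_apply, quarterTurn, quarterTurnInv,
        Matrix.mul_fin_two, Matrix.mul_fin_two]
      simp
    rw [e]
    exact mul_mem (mul_mem quarterTurn_mem h) quarterTurnInv_mem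
  · have e : Loop.upperMonomial k (-c) = Loop.monomial 0 quarterTurnInv * Loop.lowerMonomial k c *
        Loop.monomial 0 quarterTurn := Loop.ext fun z => by
      rw [Loop.mul_apply, Loop.mul_apply, Loop.monomial_zero_apply, Loop.monomial_zero_apply,
        Loop.upperMonomial_apply, Loop.lowerMonomial_apply, quarterTurn, quarterTurnInv,
        Matrix.mul_fin_two, Matrix.mul_fin_two]
      simp
    rw [e]
    exact mul_mem (mul_mem quarterTurnInv_mem h) quarterTurn_mem

theorem upperMonomial_mem_of_nonpos {k : ℤ} (hk : k ≤ 0) (c : ℂ) :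
    Loop.upperMonomial k c ∈ closureStabilizer :=
  mem_closureStabilizer_of_mem_LambdaMinus ⟨oneAdd_mem_LambdaSL
    (by rw [Matrix.trace_fin_two_of]; ring) (by rw [Matrix.det_fin_two_of]; ring) k,
    (Loop.supportedIn_one (by simp)).add (Loop.supportedIn_monomial (Set.mem_Iic.2 hk) _)⟩ (Loop.rapid_oneAdd _ _)

theorem upperMonomial_one_mem (c : ℂ) : Loop.upperMonomial 1 c ∈ closureStabilizer := by
  have := (upper_mem_closureStabilizer_iff 1 (-c)).2 (oneAdd_lower_mem_closureStabilizer (-c))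
  rwa [neg_neg] at this

/-- The classical expression of diag(a, a⁻¹), with a = z^k, by elementary matrices and a quarter
turn. -/
theorem diagMonomial_mem {k : ℤ} (h1 : Loop.upperMonomial k 1 ∈ closureStabilizer)
    (h2 : Loop.lowerMonomial (-k) (-1) ∈ closureStabilizer) :
    Loop.diagMonomial k ∈ closureStabilizer := by
  have e : Loop.diagMonomial k = Loop.upperMonomial k 1 * Loop.lowerMonomial (-k) (-1) *
      Loop.upperMonomial k 1 * Loop.monomial 0 quarterTurnInv := Loop.ext fun z => by
    have hz : (z : ℂ) ^ k ≠ 0 := zpow_ne_zero _ (Circle.coe_ne_zero z)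
    rw [Loop.mul_apply, Loop.mul_apply, Loop.mul_apply, Loop.monomial_zero_apply,
        Loop.upperMonomial_apply, Loop.lowerMonomial_apply, Loop.diagMonomial_apply,
        quarterTurnInv, Matrix.mul_fin_two, Matrix.mul_fin_two, Matrix.mul_fin_two, zpow_neg]
    simp [hz]
  rw [e]
  exact mul_mem (mul_mem (mul_mem h1 h2) h1) quarterTurnInv_mem

theorem diagMonomial_one_mem : Loop.diagMonomial 1 ∈ closureStabilizer :=
  diagMonomial_mem (upperMonomial_one_mem 1)
    ((upper_mem_closureStabilizer_iff _ _).1 (upperMonomial_mem_of_nonpos (by simp) _))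

theorem diagMonomial_neg_one_mem : Loop.diagMonomial (-1) ∈ closureStabilizer :=
  diagMonomial_mem (upperMonomial_mem_of_nonpos (by simp) _)
    ((upper_mem_closureStabilizer_iff _ _).1 (by
      rw [neg_neg, neg_neg]
      exact upperMonomial_one_mem 1))

/-- Conjugation by diag(z, z⁻¹) multiplies the upper right entry by z². -/
theorem upperMonomial_mem_of_mem_sub_two {k : ℤ} {c : ℂ}
    (h : Loop.upperMonomial (k - 2) c ∈ closureStabilizer) :
    Loop.upperMonomial k c ∈ closureStabilizer := by
  have e : Loop.upperMonomial k c = Loop.diagMonomial 1 * Loop.upperMonomial (k - 2) c *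
      Loop.diagMonomial (-1) := Loop.ext fun z => by
    have hz : (z : ℂ) ≠ 0 := Circle.coe_ne_zero z
    rw [Loop.mul_apply, Loop.mul_apply, Loop.upperMonomial_apply, Loop.upperMonomial_apply,
        Loop.diagMonomial_apply, Loop.diagMonomial_apply, Matrix.mul_fin_two, Matrix.mul_fin_two,
        zpow_neg, zpow_one, zpow_sub₀ hz, zpow_two]
    ext i j
    fin_cases i <;> fin_cases j <;> simp [hz]
    field_simp
  rw [e]
  exact mul_mem (mul_mem diagMonomial_one_mem h) diagMonomial_neg_one_mem

theorem upperMonomial_mem (k : ℤ) (c : ℂ) : Loop.upperMonomial k c ∈ closureStabilizer := by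
  rcases le_or_gt k 0 with hk | hk
  · exact upperMonomial_mem_of_nonpos hk c
  lift k to ℕ using hk.le
  induction k using Nat.strong_induction_on with
  | _ k ih =>
    rcases Nat.lt_or_ge k 2 with h | h
    · obtain rfl : k = 1 := by omega
      exact upperMonomial_one_mem c
    · refine upperMonomial_mem_of_mem_sub_two ?_
      rcases eq_or_ne k 2 with rfl | h2
      · exact upperMonomial_mem_of_nonpos (by simp) c
      · have := ih (k - 2) (by omega) (by omega)
        rwa [Nat.cast_sub h] at this

/-- The upper unipotent loop whose off-diagonal entry is that of `Φ`. -/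
noncomputable def Loop.upper (Φ : Loop) : Loop :=
  1 + Loop.monomial 0 !![1, 0; 0, 0] * Φ * Loop.monomial 0 !![0, 0; 0, 1]

theorem Loop.upper_apply (Φ : Loop) (z : Circle) : Φ.upper z = !![1, Φ z 0 1; 0, 1] := by
  rw [Loop.upper, Loop.add_apply, Loop.mul_apply, Loop.mul_apply, Loop.monomial_zero_apply,
    Loop.monomial_zero_apply, Loop.one_apply, Matrix.eta_fin_two (Φ z), Matrix.mul_fin_two,
    Matrix.mul_fin_two]
  ext i j
  fin_cases i <;> fin_cases j <;> simp

theorem Loop.continuous_upper : Continuous Loop.upper :=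
  continuous_const.add ((continuous_const.mul continuous_id).mul continuous_const)

theorem Loop.upper_add (Φ Ψ : Loop) : (Φ + Ψ).upper = Φ.upper * Ψ.upper := Loop.ext fun z => by
  rw [Loop.mul_apply, Loop.upper_apply, Loop.upper_apply, Loop.upper_apply, Loop.add_apply,
    Matrix.mul_fin_two]
  simp [add_comm]

theorem Loop.upper_zero : Loop.upper 0 = 1 := by
  rw [Loop.upper, mul_zero, zero_mul, add_zero]

theorem Loop.upper_monomial (k : ℤ) (m : M2) :
    (Loop.monomial k m).upper = Loop.upperMonomial k (m 0 1) := Loop.ext fun z => by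
  rw [Loop.upper_apply, Loop.upperMonomial_apply, Loop.monomial_apply, Matrix.smul_apply,
    smul_eq_mul]

theorem Loop.hasSum_monomial (Φ : Loop) :
    HasSum (fun k => Loop.monomial k (loopCoeff Φ k)) Φ := by
  obtain ⟨r, hr, h⟩ := Φ.exists_wnorm_ne_top
  have hs : Summable fun k => Loop.monomial k (loopCoeff Φ k) := by
    refine Loop.summable_of_wnorm hr ?_
    simp only [wnorm_monomial]
    exact h
  have e : ∑' k, Loop.monomial k (loopCoeff Φ k) = Φ := Loop.ext_coeff fun n => by
    refine ((Loop.coeffL n).hasSum hs.hasSum).unique ?_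
    have := hasSum_single (f := fun k => Loop.coeffL n (Loop.monomial k (loopCoeff Φ k))) n
      fun k hk => by
        rw [Loop.coeffL_apply, Loop.coeff_monomial, Pi.single_eq_of_ne hk.symm]
    rwa [Loop.coeffL_apply, Loop.coeff_monomial, Pi.single_eq_same] at this
  have := hs.hasSum
  rwa [e] at this

/-- `Loop.upper` is continuous and turns sums into products, so Laurent polynomials give products of
monomial loops, and the stabilizer is closed. -/
theorem upper_mem (Φ : Loop) : Φ.upper ∈ closureStabilizer := by
  refine isClosed_closureStabilizer.mem_of_tendsto
    ((Loop.continuous_upper.tendsto Φ).comp Φ.hasSum_monomial) (.of_forall fun s => ?_)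
  change (∑ k ∈ s, Loop.monomial k (loopCoeff Φ k)).upper ∈ closureStabilizer
  induction s using Finset.cons_induction with
  | empty => rw [Finset.sum_empty, Loop.upper_zero]; exact one_mem _
  | cons k s hk ih =>
    rw [Finset.sum_cons, Loop.upper_add, Loop.upper_monomial]
    exact mul_mem (upperMonomial_mem _ _) ih

theorem exists_lower_mem (Φ : Loop) :
    ∃ Ψ ∈ closureStabilizer, ∀ z, Ψ z = !![1, 0; Φ z 1 0, 1] := by
  refine ⟨_, mul_mem (mul_mem quarterTurn_mem (upper_mem (Loop.monomial 0 quarterTurn * Φ *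
    Loop.monomial 0 quarterTurnInv))) quarterTurnInv_mem, fun z => ?_⟩
  rw [Loop.mul_apply, Loop.mul_apply, Loop.upper_apply, Loop.mul_apply, Loop.mul_apply,
    Loop.monomial_zero_apply, Loop.monomial_zero_apply, Matrix.eta_fin_two (Φ z), quarterTurn,
    quarterTurnInv, Matrix.mul_fin_two, Matrix.mul_fin_two, Matrix.mul_fin_two, Matrix.mul_fin_two]
  ext i j
  fin_cases i <;> fin_cases j <;> simp

theorem exists_loop_div (Φ : Loop) (h : ∀ z, Φ z 1 0 ≠ 0) (i : Fin 2) :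
    ∃ Ψ : Loop, ∀ z, Ψ z 0 1 = (Φ z i i - 1) / Φ z 1 0 := by
  obtain ⟨g, hg, hgΦ⟩ := Φ.2
  refine ⟨⟨fun z => !![0, (Φ z i i - 1) / Φ z 1 0; 0, 0],
    fun z => !![0, (g z i i - 1) / g z 1 0; 0, 0], fun k l => ?_, fun z => ?_⟩, fun z => rfl⟩
  · have h1 : AnalyticOnNhd ℂ (fun z => (g z i i - 1) / g z 1 0) (Metric.sphere 0 1) := by
      refine ((hg i i).sub analyticOnNhd_const).div (hg 1 0) fun z hz => ?_
      have h2 : z ∈ Submonoid.unitSphere ℂ := hz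
      exact fun h3 => h ⟨z, h2⟩ ((congrFun (congrFun (hgΦ ⟨z, h2⟩) 1) 0).symm.trans h3)
    fin_cases k <;> fin_cases l
    · exact analyticOnNhd_const
    · exact h1
    · exact analyticOnNhd_const
    · exact analyticOnNhd_const
  · beta_reduce
    rw [hgΦ]

/-- For entries a, b, c, d with ad - bc = 1 and c ≠ 0, the matrix is upper((a - 1)/c) · lower(c) ·
upper((d - 1)/c). -/
theorem mem_closureStabilizer_of_ne_zero {Φ : Loop} (hΦ : Φ ∈ LambdaSL) (h : ∀ z, Φ z 1 0 ≠ 0) :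
    Φ ∈ closureStabilizer := by
  obtain ⟨A, hA⟩ := exists_loop_div Φ h 0
  obtain ⟨D, hD⟩ := exists_loop_div Φ h 1
  obtain ⟨C, hCm, hC⟩ := exists_lower_mem Φ
  have e : Φ = A.upper * C * D.upper := Loop.ext fun z => by
    have hd := hΦ z
    have hz := h z
    rw [Matrix.det_fin_two] at hd
    rw [Loop.mul_apply, Loop.mul_apply, Loop.upper_apply, Loop.upper_apply, hA, hC, hD,
      Matrix.mul_fin_two, Matrix.mul_fin_two]
    ext i j
    fin_cases i <;> fin_cases j <;> simp <;> field_simp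
    · ring
    · linear_combination -hd
    · ring
  rw [e]
  exact mul_mem (mul_mem (upper_mem A) hCm) (upper_mem D)

/-- The bad values are ε = -Φ₁₀/Φ₀₀ at points of the circle with Φ₀₀ ≠ 0: the image of a planar null
set under a differentiable map, again a null set. Where Φ₀₀ = 0, determinant 1 forces Φ₁₀ ≠ 0. -/
theorem exists_forall_add_mul_ne_zero {Φ : Loop} (hΦ : Φ ∈ LambdaSL) :
    ∃ ε : ℂ, ∀ z, Φ z 1 0 + ε * Φ z 0 0 ≠ 0 := by
  obtain ⟨g, hg, hgΦ⟩ := Φ.2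
  let s : Set ℂ := {z | z ∈ Metric.sphere (0 : ℂ) 1 ∧ g z 0 0 ≠ 0}
  have hs : MeasureTheory.volume s = 0 :=
    MeasureTheory.measure_mono_null (fun z hz => hz.1)
      (MeasureTheory.Measure.addHaar_sphere _ (0 : ℂ) 1)
  have himg : MeasureTheory.volume ((fun z => -(g z 1 0 / g z 0 0)) '' s) = 0 := by
    refine MeasureTheory.addHaar_image_eq_zero_of_differentiableOn_of_addHaar_eq_zero _
      (fun z hz => ?_) hs
    exact (((hg 1 0 z hz.1).div (hg 0 0 z hz.1) hz.2).neg.differentiableAt.restrictScalars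
      ℝ).differentiableWithinAt
  obtain ⟨ε, hε⟩ : ∃ ε, ε ∉ (fun z => -(g z 1 0 / g z 0 0)) '' s := by
    by_contra! h
    rw [Set.eq_univ_of_forall h] at himg
    simp at himg
  refine ⟨ε, fun z hz => ?_⟩
  by_cases h0 : Φ z 0 0 = 0
  · rw [h0, mul_zero, add_zero] at hz
    have := hΦ z
    rw [Matrix.det_fin_two, h0, hz] at this
    simp at this
  · refine hε ⟨z, ⟨mem_sphere_zero_iff_norm.2 (Circle.norm_coe z), by rwa [hgΦ]⟩, ?_⟩
    beta_reduce
    rw [hgΦ, neg_eq_iff_eq_neg, div_eq_iff h0]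
    linear_combination hz

theorem LambdaSL_subset_closureStabilizer : LambdaSL ⊆ closureStabilizer := fun Φ hΦ => by
  obtain ⟨ε, hε⟩ := exists_forall_add_mul_ne_zero hΦ
  have hd : ∀ ε : ℂ, (!![1, 0; ε, 1] : M2).det = 1 := fun ε => by
    rw [Matrix.det_fin_two_of]; ring
  have h1 : Loop.monomial 0 !![1, 0; ε, 1] * Φ ∈ closureStabilizer := by
    refine mem_closureStabilizer_of_ne_zero
      (mul_mem_LambdaSL (monomial_zero_mem_LambdaSL (hd ε)) hΦ) fun z => ?_
    rw [Loop.mul_apply, Loop.monomial_zero_apply]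
    simpa [Matrix.mul_apply, add_comm] using hε z
  have e : Φ = Loop.monomial 0 !![1, 0; -ε, 1] * (Loop.monomial 0 !![1, 0; ε, 1] * Φ) := by
    have : (!![1, 0; -ε, 1] : M2) * !![1, 0; ε, 1] = 1 := by
      rw [Matrix.mul_fin_two, Matrix.one_fin_two]
      simp
    rw [← mul_assoc, Loop.monomial_zero_mul, this, ← Loop.one_eq_monomial, one_mul]
  rw [e]
  exact mul_mem (monomial_zero_mem_closureStabilizer (hd _)) h1

theorem LambdaSL_subset_closure : LambdaSL ⊆ closure starCell := fun Φ hΦ => by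
  have := LambdaSL_subset_closureStabilizer hΦ 1 (subset_closure one_mem_starCell)
  rwa [one_mul] at this

/-- The approximating loops lie in `starCell`, hence in every S between the two groups, so both
density statements are instances. -/
theorem dense_preimage_bigCell {S : Set Loop} (h1 : LambdaStarSL ⊆ S) (h2 : S ⊆ LambdaSL) :
    Dense ((↑) ⁻¹' bigCell : Set S) := by
  refine Subtype.dense_iff.2 ((h2.trans LambdaSL_subset_closure).trans (closure_mono ?_))
  exact fun Φ hΦ => ⟨⟨Φ, h1 hΦ.2⟩, hΦ.1, rfl⟩

end Density

end BigCell

theorem propositionP :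
    ∃ U : Set Loop, U ⊆ LambdaSL ∧
      -- loops that are analytic on the circle
      (IsOpen ((↑) ⁻¹' U : Set LambdaSL) ∧ Dense ((↑) ⁻¹' U : Set LambdaSL) ∧
        IsRealAnalyticDiffeo (fun P : Loop × Loop => P.1 * P.2)
          (LambdaPlusSU (Metric.closedBall 0 1) ×ˢ LambdaMinusR (Metric.closedBall 0 1)) U) ∧
      -- loops that are holomorphic on the punctured plane
      (IsOpen ((↑) ⁻¹' U : Set LambdaStarSL) ∧ Dense ((↑) ⁻¹' U : Set LambdaStarSL) ∧
        IsRealAnalyticDiffeo (fun P : Loop × Loop => P.1 * P.2)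
          (LambdaPlusSU Set.univ ×ˢ LambdaMinusR Set.univ) (U ∩ LambdaStarSL)) :=
  ⟨bigCell, bigCell_subset,
    ⟨isOpen_preimage_bigCell subset_rfl, dense_preimage_bigCell LambdaStarSL_subset subset_rfl,
      isRealAnalyticDiffeo_mul⟩,
    isOpen_preimage_bigCell LambdaStarSL_subset,
    dense_preimage_bigCell subset_rfl LambdaStarSL_subset, isRealAnalyticDiffeo_mul_star⟩
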